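/- Notation. For a partition $\lambda=(\lambda_1\ge\lambda_2\ge\cdots)$ let $l(\lambda)$ be its number of nonzero parts, $|\lambda|$ its size, $\lambda'$ its conjugate. For $n,k\ge 1$ let $\Pi^{(n,k)}$ be the set of partitions with $l(\lambda)\le n$ and $\lambda_1-\lambda_n\le k$. The fusion algebra of $sl(n)$ at level $k$ is $\mathcal F^{(n,k)}=\mathbb Q[x_1,\dots,x_n]^{S_n}/\mathcal I^{(n,k)}$, where $\mathcal I^{(n,k)}$ is generated by the Schur polynomials $s_\lambda$ with $l(\lambda)\le n$, $\lambda_1-\lambda_n=k+1$, and by $s_{(1^n)}-1$. The fusion coefficients $N_{\lambda\mu}^{(k)\nu}$ of rank $n$ ($\lambda,\mu,\nu\in\Pi^{(n,k)}$) are defined by the expansion in $\mathcal F^{(n,k)}$ $$s_\lambda s_\mu=\sum_{\nu\in\Pi^{(n,k)},\ |\nu|=|\lambda|+|\mu|}N_{\lambda\mu}^{(k)\nu}s_\nu ,$$ and $N_{\lambda\mu}^{(k)\nu}=0$ if $|\nu|\ne|\lambda|+|\mu|$. For $\lambda\in\Pi^{(n,k)}$ let $\tilde\lambda$ be the partition with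 at most $k$ parts obtained by cutting the diagram of $\lambda$ into vertical strips of width $k$, conjugating each strip and putting the results side by side: $\tilde\lambda_i=\sum_{j\ge0}\lambda'_{jk+i}$ for $1\le i\le k$. Paths and tableaux (rank $n$, level $k$). The label of a box in row $r$ and column $c$ is $c-r$. Let $\mu$ have at most two columns, with $p=\mu'_1\ge q=\mu'_2$. Let $\mathcal P^{(n,k)}_{(\mu')}(\lambda,\nu)$ be the set of chains of partitions from $\lambda$ to $\nu$ of length $p+q$, each obtained from the previous one by adding one box, such that the labels of the first $p$ added boxes (the part $P_1$) are decreasing, the labels of the last $q$ added boxes (the part $P_2$) are decreasing, and the partition reached after $p$ steps and $\nu$ are in $\Pi^{(n,k)}$. Such a path $P=P_1*P_2$ fits $\mu$ if for each $j\le q$ the $j$-th smallest label of $P_1$ is at most the $j$-th smallest label of $P_2$. Write all labels of $P$ in increasing order, a label that occurs in both parts being written first for $P_1$ and then for $P_2$, replace labels of $P_1$ by left and labels of $P_2$ by right parentheses, and pair parentheses in the usual way. Let $\mathcal D_2$ be the set of paths $P$ that fit $\mu$ and satisfy: (i) $\nu_1-\nu_n=k$; (ii) $P_1$ adds a box in row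 $n$, $P_2$ does not, and exactly one of $P_1,P_2$ adds a box in row $1$; (iii) the last column of $\nu$ contains boxes of $P_2$, and if $a_0$ is the largest label of these boxes and $a_1$ the smallest label of the boxes of $\nu/\lambda$ in the last column of $\nu$, then the right parenthesis $a_0$ is not paired with a left parenthesis with label $a_1-1$; (iv) the left parenthesis of the box of $P_1$ in row $n$ is unpaired or is paired with $a_0$. The paths that fit $\mu$ and are not in $\mathcal D_2$ are called $k$-fusion. Theorem. Let $n\ge3$, $k\ge1$, $\lambda,\mu,\nu\in\Pi^{(n,k)}$, and let $\mu$ have at most two rows. The expansions defining the fusion coefficients with lower indices $\lambda,\mu$ (rank $n$, level $k$) and $\tilde\lambda,\tilde\mu$ (rank $k$, level $n$) exist and are unique, $\tilde\mu$ has at most two columns, and $$N_{\lambda\mu}^{(k)\nu}=N_{\tilde\lambda\tilde\mu}^{(n)\tilde\nu}=\#\{P\in\mathcal P^{(k,n)}_{(\tilde\mu')}(\tilde\lambda,\tilde\nu)\ :\ P \text{ fits } \tilde\mu \text{ and is } n\text{-fusion}\},$$ where on the right the rank is $k$ and the level is $n$ in all definitions above (and the set is finite). -/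

import Mathlib

open MvPolynomial

namespace Fusion

/-! Partitions are Young diagrams; `lam.rowLen i` is the part `λ_{i+1}`, `lam.colLen j` the part
`λ'_{j+1}` of the conjugate, `lam.card` the size, and a box is a pair (row, column), both counted
from zero. -/

/-! ### Schur polynomials in `n` variables -/

section Schur

variable {n : ℕ}

/-- The substitution `x_i ↦ x_j`. -/
noncomputable def identify (i j : Fin n) : MvPolynomial (Fin n) ℚ →ₐ[ℚ] MvPolynomial (Fin n) ℚ :=
  aeval (Function.update X i (X j))

theorem sub_dvd_of_identify {i j : Fin n} {p : MvPolynomial (Fin n) ℚ}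
    (h : identify i j p = 0) : (X i - X j : MvPolynomial (Fin n) ℚ) ∣ p := by
  rw [← Ideal.mem_span_singleton, ← Ideal.Quotient.eq_zero_iff_mem]
  have key : (Ideal.Quotient.mkₐ ℚ (Ideal.span {(X i - X j : MvPolynomial (Fin n) ℚ)})).comp
      (identify i j) = Ideal.Quotient.mkₐ ℚ _ := by
    apply MvPolynomial.algHom_ext
    intro a
    by_cases ha : a = i
    · subst ha
      simp only [identify, AlgHom.comp_apply, aeval_X, Function.update_self,
        Ideal.Quotient.mkₐ_eq_mk]
      rw [eq_comm, Ideal.Quotient.eq]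
      exact Ideal.mem_span_singleton_self _
    · simp [identify, Function.update_of_ne ha]
  have := DFunLike.congr_fun key p
  simpa [h] using this.symm

theorem prime_sub {i j : Fin n} (hij : i ≠ j) :
    Prime (X i - X j : MvPolynomial (Fin n) ℚ) := by
  have hne : (X i - X j : MvPolynomial (Fin n) ℚ) ≠ 0 :=
    sub_ne_zero.2 fun h => hij (X_injective h)
  rw [← Ideal.span_singleton_prime hne]
  have : Ideal.span {(X i - X j : MvPolynomial (Fin n) ℚ)}
      = RingHom.ker (identify i j).toRingHom := by
    ext p
    rw [Ideal.mem_span_singleton, RingHom.mem_ker]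
    constructor
    · rintro ⟨q, rfl⟩
      simp [identify, Function.update_of_ne hij.symm]
    · exact fun h => sub_dvd_of_identify h
  rw [this]
  exact RingHom.ker_isPrime _

/-- The alternant `det (x_i ^ α_j)`. -/
noncomputable def alternant (α : Fin n → ℕ) : MvPolynomial (Fin n) ℚ :=
  Matrix.det (Matrix.of fun i j => X i ^ α j)

theorem sub_dvd_alternant {i j : Fin n} (hij : i ≠ j) (α : Fin n → ℕ) :
    (X i - X j : MvPolynomial (Fin n) ℚ) ∣ alternant α := by
  apply sub_dvd_of_identify
  rw [alternant, AlgHom.map_det]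
  apply Matrix.det_zero_of_row_eq hij
  funext c
  simp [identify, Function.update_of_ne hij.symm]

theorem vandermonde_dvd_alternant (α : Fin n → ℕ) :
    (alternant fun j : Fin n => (j : ℕ)) ∣ alternant α := by
  have hv : (alternant fun j : Fin n => (j : ℕ)) =
      ∏ i : Fin n, ∏ j ∈ Finset.Ioi i, (X j - X i : MvPolynomial (Fin n) ℚ) :=
    Matrix.det_vandermonde _
  rw [hv, Finset.prod_sigma']
  apply Finset.prod_dvd_of_isRelPrime
  · rintro ⟨a, b⟩ hab ⟨c, d⟩ hcd hne
    simp only [Finset.coe_sigma, Set.mem_sigma_iff, Finset.coe_univ, Set.mem_univ, true_and,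
      Finset.coe_Ioi, Set.mem_Ioi] at hab hcd
    simp only [Function.onFun]
    rw [(prime_sub hab.ne').irreducible.isRelPrime_iff_not_dvd]
    rintro ⟨q, hq⟩
    have h := congrArg (identify b a) hq
    simp only [identify, map_sub, map_mul, aeval_X, Function.update_self,
      Function.update_of_ne hab.ne, sub_self, zero_mul] at h
    rw [sub_eq_zero] at h
    by_cases h1 : d = b
    · subst h1
      by_cases h2 : c = d
      · exact absurd h2 hcd.ne
      · rw [Function.update_self, Function.update_of_ne h2] at h
        exact hne (by rw [X_injective h])
    · rw [Function.update_of_ne h1] at h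
      by_cases h2 : c = b
      · subst h2
        rw [Function.update_self] at h
        have := X_injective h
        subst this
        exact absurd (hab.trans hcd) (lt_irrefl _)
      · rw [Function.update_of_ne h2] at h
        exact absurd (X_injective h) hcd.ne'
  · rintro ⟨a, b⟩ hab
    simp only [Finset.mem_sigma, Finset.mem_univ, Finset.mem_Ioi, true_and] at hab
    exact sub_dvd_alternant hab.ne' α

theorem vandermonde_ne_zero : (alternant fun j : Fin n => (j : ℕ)) ≠ 0 :=
  Matrix.det_vandermonde_ne_zero_iff.2 X_injective

theorem rename_alternant (σ : Equiv.Perm (Fin n)) (α : Fin n → ℕ) :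
    rename σ (alternant α) = (Equiv.Perm.sign σ : ℤ) • alternant α := by
  rw [alternant, AlgHom.map_det]
  have : (rename (R := ℚ) σ).mapMatrix (Matrix.of fun i j : Fin n => X i ^ α j) =
      (Matrix.of fun i j : Fin n => (X i ^ α j : MvPolynomial (Fin n) ℚ)).submatrix σ id := by
    ext1 i j
    simp
  rw [this, Matrix.det_permute, zsmul_eq_mul]

theorem exists_schur (α : Fin n → ℕ) : ∃ s : symmetricSubalgebra (Fin n) ℚ,
    (s : MvPolynomial (Fin n) ℚ) * (alternant fun j : Fin n => (j : ℕ)) = alternant α := by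
  obtain ⟨s, hs⟩ := vandermonde_dvd_alternant α
  refine ⟨⟨s, ?_⟩, by rw [hs, mul_comm]⟩
  rw [mem_symmetricSubalgebra]
  intro σ
  have h := congrArg (rename (R := ℚ) σ) hs
  rw [map_mul, rename_alternant, rename_alternant, hs, smul_mul_assoc] at h
  have h' : (Equiv.Perm.sign σ : ℤ) • ((alternant fun j : Fin n => (j : ℕ)) * s)
      = (Equiv.Perm.sign σ : ℤ) • ((alternant fun j : Fin n => (j : ℕ)) * rename σ s) := h
  rcases Int.units_eq_one_or (Equiv.Perm.sign σ) with h1 | h1 <;>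
  · simp only [h1, Units.val_one, Units.val_neg, one_smul, neg_smul, neg_inj] at h'
    exact (mul_left_cancel₀ vandermonde_ne_zero h').symm

end Schur

/-- The Schur polynomial `s_λ(x_1, …, x_n)` of a partition with at most `n` parts, i.e. the
quotient of the alternants `det (x_i ^ (λ_j + n - j))` and `det (x_i ^ (n - j))`; the columns of
both determinants are written in the reverse order here. -/
noncomputable def schur (n : ℕ) (lam : YoungDiagram) : symmetricSubalgebra (Fin n) ℚ :=
  Classical.choose (exists_schur fun j : Fin n => lam.rowLen (j.rev : ℕ) + j)

theorem schur_mul_vandermonde (n : ℕ) (lam : YoungDiagram) :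
    (schur n lam : MvPolynomial (Fin n) ℚ) * (alternant fun j : Fin n => (j : ℕ)) =
      alternant fun j : Fin n => lam.rowLen (j.rev : ℕ) + j :=
  Classical.choose_spec (exists_schur fun j : Fin n => lam.rowLen (j.rev : ℕ) + j)

/-! ### The fusion algebra and its structure constants -/

/-- The partition `(1^n)`. -/
def column (n : ℕ) : YoungDiagram where
  cells := Finset.range n ×ˢ {0}
  isLowerSet := by
    rintro ⟨a, b⟩ ⟨c, d⟩ ⟨h1, h2⟩ h
    simp only [Finset.coe_product, Finset.coe_range, Finset.coe_singleton, Set.mem_prod,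
      Set.mem_Iio, Set.mem_singleton_iff] at h ⊢
    simp only at h1 h2
    omega

/-- `λ` is `(n,k)`-restricted: at most `n` parts, and `λ_1 - λ_n ≤ k`. -/
def IsRestricted (n k : ℕ) (lam : YoungDiagram) : Prop :=
  lam.colLen 0 ≤ n ∧ lam.rowLen 0 ≤ lam.rowLen (n - 1) + k

/-- The ideal generated by the `s_λ` with `λ_1 - λ_n = k + 1` and by `s_{(1^n)} - 1`. -/
noncomputable def fusionIdeal (n k : ℕ) : Ideal (symmetricSubalgebra (Fin n) ℚ) :=
  Ideal.span ({f | ∃ lam : YoungDiagram, lam.colLen 0 ≤ n ∧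
      lam.rowLen 0 = lam.rowLen (n - 1) + (k + 1) ∧ f = schur n lam} ∪ {schur n (column n) - 1})

/-- The fusion algebra of `sl(n)` at level `k`. -/
abbrev FusionAlgebra (n k : ℕ) : Type :=
  symmetricSubalgebra (Fin n) ℚ ⧸ fusionIdeal n k

/-- The class of `s_λ` in the fusion algebra. -/
noncomputable def schurClass (n k : ℕ) (lam : YoungDiagram) : FusionAlgebra n k :=
  Ideal.Quotient.mk (fusionIdeal n k) (schur n lam)

/-- `N` is an expansion `s_λ s_μ = ∑_ν N_ν s_ν` in the fusion algebra, the sum being over the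
`(n,k)`-restricted partitions `ν` with `|ν| = |λ| + |μ|`. The size is prescribed because
`s_{(1^n)} = 1` identifies `s_ν` with `s_{ν + (1^n)}`. -/
def IsFusionExpansion (n k : ℕ) (lam mu : YoungDiagram) (N : YoungDiagram →₀ ℚ) : Prop :=
  (∀ nu ∈ N.support, IsRestricted n k nu ∧ nu.card = lam.card + mu.card) ∧
    schurClass n k lam * schurClass n k mu = N.sum fun nu c => c • schurClass n k nu

open Classical in
/-- The fusion coefficient `N_{λμ}^{(k)ν}` of `sl(n)` at level `k`, meaningful when the expansion
of `s_λ s_μ` exists and is unique. -/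
noncomputable def fusionCoeff (n k : ℕ) (lam mu nu : YoungDiagram) : ℚ :=
  if h : ∃ N, IsFusionExpansion n k lam mu N then h.choose nu else 0

/-! ### Rank-level duality -/

/-- Cut `λ` into vertical strips of width `k`, conjugate each strip, and put the conjugates side by
side: the `i`-th row of the conjugate of the `j`-th strip is the column `j * k + i` of `λ`. There
are fewer than `λ_1 + 1` nonempty strips. -/
def dualRow (k : ℕ) (lam : YoungDiagram) (i : ℕ) : ℕ :=
  ∑ j ∈ Finset.range (lam.rowLen 0 + 1), lam.colLen (j * k + i)

theorem dualRow_antitone (k : ℕ) (lam : YoungDiagram) : Antitone (dualRow k lam) := fun _ _ hab =>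
  Finset.sum_le_sum fun _ _ => lam.colLen_anti _ _ (Nat.add_le_add_left hab _)

/-- The partition `λ~` with `k` rows that is dual to the `(n,k)`-restricted partition `λ`. -/
def dual (k : ℕ) (lam : YoungDiagram) : YoungDiagram :=
  YoungDiagram.ofRowLens (List.ofFn fun i : Fin k => dualRow k lam i)
    (List.sortedGE_ofFn_iff.2 fun _ _ h => dualRow_antitone k lam h)

/-! ### Paths in Young's lattice -/

/-- A path of length `m`: a chain of partitions, each obtained from the previous one by adding one
box. -/
structure YoungPath (m : ℕ) where
  diag : Fin (m + 1) → YoungDiagram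
  le_step : ∀ i : Fin m, diag i.castSucc ≤ diag i.succ
  card_step : ∀ i : Fin m, (diag i.succ).card = (diag i.castSucc).card + 1

/-- The label of a box is the index (column minus row) of its diagonal. -/
def content (c : ℕ × ℕ) : ℤ := (c.2 : ℤ) - (c.1 : ℤ)

/-- The label of the `i`-th step: the label of the one box that is added. -/
def YoungPath.label {m : ℕ} (P : YoungPath m) (i : Fin m) : ℤ :=
  ∑ c ∈ (P.diag i.succ).cells \ (P.diag i.castSucc).cells, content c

/-- Labels of the first part `P_1` of `P = P_1 * P_2`, where `|P_1| = p` and `|P_2| = q`. -/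
def YoungPath.label₁ {p q : ℕ} (P : YoungPath (p + q)) (i : Fin p) : ℤ := P.label (i.castAdd q)

/-- Labels of the second part `P_2` of `P = P_1 * P_2`. -/
def YoungPath.label₂ {p q : ℕ} (P : YoungPath (p + q)) (i : Fin q) : ℤ := P.label (i.natAdd p)

/-- The first partition `λ` of a path `P = P_1 * P_2`. -/
def YoungPath.first {p q : ℕ} (P : YoungPath (p + q)) : YoungDiagram := P.diag 0

/-- The intermediate partition `η` of a path `P = P_1 * P_2`. -/
def YoungPath.middle {p q : ℕ} (P : YoungPath (p + q)) : YoungDiagram :=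
  P.diag ⟨p, by omega⟩

/-- The last partition `ν` of a path `P = P_1 * P_2`. -/
def YoungPath.final {p q : ℕ} (P : YoungPath (p + q)) : YoungDiagram := P.diag (Fin.last (p + q))

/-- `P` has ascents included in positions `(p, q)`: `P_1` and `P_2` are decreasing; and the
partitions at these positions are `(n,k)`-restricted. -/
def IsRestrictedPath (n k : ℕ) {p q : ℕ} (P : YoungPath (p + q)) : Prop :=
  StrictAnti P.label₁ ∧ StrictAnti P.label₂ ∧ IsRestricted n k P.middle ∧ IsRestricted n k P.final

/-- The tableau `T_P` with columns `l(P_1)`, `l(P_2)` written top-to-bottom and aligned at the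
bottom is a tableau of partition shape with weakly increasing rows (rows are counted from the
bottom; strict increase upwards in the columns is the decrease of `P_1` and `P_2`). -/
def IsColumnStrict {p q : ℕ} (P : YoungPath (p + q)) : Prop :=
  StrictAnti P.label₁ ∧ StrictAnti P.label₂ ∧
    ∃ h : q ≤ p, ∀ i : Fin q, P.label₁ (i.castLE h).rev ≤ P.label₂ i.rev

/-- The word of the labels `L ∪ R` in increasing order, a label in both being written first for
`L` and then for `R`, with left parentheses for `L` and right ones for `R`: the left parenthesis
`a` is matched with the right parenthesis `b`, i.e. it precedes `b` and the word strictly between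
them, which consists of `L ∩ (a, b]` and `R ∩ [a, b)`, is balanced. -/
def Paired (L R : Finset ℤ) (a b : ℤ) : Prop :=
  a ∈ L ∧ b ∈ R ∧ a ≤ b ∧
    {x ∈ R | a ≤ x ∧ x < b}.card = {x ∈ L | a < x ∧ x ≤ b}.card ∧
    ∀ c ∈ R, a ≤ c → c < b → {x ∈ R | a ≤ x ∧ x ≤ c}.card ≤ {x ∈ L | a < x ∧ x ≤ c}.card

/-- The boxes added by `P_1`. -/
def YoungPath.boxes₁ {p q : ℕ} (P : YoungPath (p + q)) : Finset (ℕ × ℕ) :=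
  P.middle.cells \ P.first.cells

/-- The boxes added by `P_2`. -/
def YoungPath.boxes₂ {p q : ℕ} (P : YoungPath (p + q)) : Finset (ℕ × ℕ) :=
  P.final.cells \ P.middle.cells

/-- The left parenthesis `a` (a label of `P_1`) is paired with the right parenthesis `b` (a label
of `P_2`) in the word of `P`. -/
def YoungPath.Paired {p q : ℕ} (P : YoungPath (p + q)) (a b : ℤ) : Prop :=
  Fusion.Paired (Finset.univ.image P.label₁) (Finset.univ.image P.label₂) a b

/-- There is a box in the first row (a label `⊥`). -/
def HasBot (B : Finset (ℕ × ℕ)) : Prop := ∃ c ∈ B, c.1 = 0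

/-- There is a box in the `n`-th row (a label `⊤`). -/
def HasTop (n : ℕ) (B : Finset (ℕ × ℕ)) : Prop := ∃ c ∈ B, c.1 + 1 = n

/-- The boxes of `B` in the last column of `nu`. -/
def lastColumn (nu : YoungDiagram) (B : Finset (ℕ × ℕ)) : Finset (ℕ × ℕ) :=
  {c ∈ B | c.2 + 1 = nu.rowLen 0}

/-- The column-strict `T_P` which are not `k`-fusion: `ν` is an edge diagram; `⊤` is in `P_1` and
not in `P_2`, and `⊥` is in exactly one of them; the last column of `ν` has labels from `P_2`, and
the largest of them, `a₀`, is not paired with `a₁ - 1`, where `a₁` is the smallest label of that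
column; `⊤` is unpaired or paired with `a₀`. -/
def IsExceptional (n k : ℕ) {p q : ℕ} (P : YoungPath (p + q)) : Prop :=
  IsColumnStrict P ∧
  P.final.rowLen 0 = P.final.rowLen (n - 1) + k ∧
  HasTop n P.boxes₁ ∧ ¬ HasTop n P.boxes₂ ∧ Xor (HasBot P.boxes₁) (HasBot P.boxes₂) ∧
  ∃ a₀ a₁ : ℤ,
    IsGreatest (content '' (lastColumn P.final P.boxes₂ : Set (ℕ × ℕ))) a₀ ∧
    IsLeast (content '' (lastColumn P.final (P.boxes₁ ∪ P.boxes₂) : Set (ℕ × ℕ))) a₁ ∧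
    ¬ P.Paired (a₁ - 1) a₀ ∧
    ∀ c ∈ P.boxes₁, c.1 + 1 = n → ∀ b, P.Paired (content c) b → b = a₀

/-- For `μ` with at most two columns: the paths from `λ` to `ν` with ascents included in positions
`μ' = (μ'_1, μ'_2)`, passing through `(n,k)`-restricted partitions at these positions, that fit `μ`
and whose tableau is `k`-fusion. -/
def fusionPaths (n k : ℕ) (lam mu nu : YoungDiagram) :
    Set (YoungPath (mu.colLen 0 + mu.colLen 1)) :=
  {P | P.first = lam ∧ P.final = nu ∧ IsRestrictedPath n k P ∧ IsColumnStrict P ∧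
    ¬ IsExceptional n k P}

end Fusion

/-! Both coefficients are differences of numbers of chains of strips, and the paths count such a
difference.

In the fusion algebra, adding at most one box per row to a restricted partition gives either a
restricted partition or a sequence on a wall, where the Schur class vanishes. So multiplication by
an elementary symmetric polynomial sums over the restricted vertical strips
(`PieriSystem.e_mul_c_eq_sum_vstrips`). A sign-reversing involution yields the companion rule for
the complete symmetric elements: multiplication by h_a, for a < n + k, sums over horizontal strips
on the cylinder (`PieriSystem.h_mul_c`). By the Jacobi–Trudi identity s_(a,b) = h_a h_b - h_(a+1)
h_(b-1) and its analogue for two columns, the coefficient of s_ν in s_λ s_μ is the number of chains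
λ, η, ν with |η| = |λ| + a minus the number with |η| = |λ| + a + 1. This shows that the expansions
exist. They are unique because functionals that are antisymmetric under the affine Weyl group kill
the fusion ideal and separate the Schur classes of a given size (`isFusionExpansion_unique`).

The map λ ↦ λ~ preserves sizes, is inverted by the same construction with n and k exchanged, and
turns cylindric horizontal strips into vertical strips (`vStrip_dualFn_iff`). Hence it matches the
chains on both sides, and the two coefficients agree.

For vertical strips, η is recorded by the set of rows that receive their box first. Rows with two
boxes of ν/λ are forced. The rows with one box, read from the bottom, form a word: a left
parenthesis if the box belongs to the first strip, a right one otherwise. Turning the last unpaired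
right parenthesis into a left one cancels words against words with one more left parenthesis
(`card_lowestWords_succ`); without the cylinder, the words with all right parentheses paired remain.
The level condition on η matters only if the first and last rows have one box each and λ is at
maximal width (`Wraps`). Then the single rows at the two extreme levels join into one cyclic chain,
on which the left parentheses form an initial segment. Summing over its length telescopes, and what
remains is counted by the paired words that are not exceptional (`IsWrap.card_wrapWords_sub`).

Finally, a decreasing path is the same thing as a vertical strip, fitting means that every right
parenthesis is paired, and the conditions that define the exceptional paths single out exactly the
exceptional words (`IsStripPair.exceptional_iff`). -/

namespace Fusion

/-! ### Partitions with at most `n` parts as functions on `Fin n` -/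

section Rows

variable {n : ℕ}

/-- The row lengths of a partition, as a function on `Fin n`. -/
def rows (n : ℕ) (lam : YoungDiagram) (i : Fin n) : ℕ := lam.rowLen i

/-- The partition with row lengths `f`, if `f` is antitone. -/
def toDiagram (f : Fin n → ℕ) : YoungDiagram where
  cells := {c ∈ Finset.range n ×ˢ Finset.range (∑ i, f i) | ∀ i : Fin n, (i : ℕ) ≤ c.1 → c.2 < f i}
  isLowerSet := by
    rintro ⟨a, b⟩ ⟨c, d⟩ ⟨h1, h2⟩ h
    simp only [Finset.coe_filter, Finset.mem_product, Finset.mem_range, Set.mem_ofPred_eq] at h ⊢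
    simp only at h1 h2
    refine ⟨⟨by omega, by omega⟩, fun i hi => ?_⟩
    have := h.2 i (hi.trans h1)
    omega

theorem mem_toDiagram {f : Fin n → ℕ} {a b : ℕ} :
    (a, b) ∈ toDiagram f ↔ a < n ∧ ∀ i : Fin n, (i : ℕ) ≤ a → b < f i := by
  rw [← YoungDiagram.mem_cells]
  simp only [toDiagram, Finset.mem_filter, Finset.mem_product, Finset.mem_range]
  constructor
  · exact fun h => ⟨h.1.1, h.2⟩
  · refine fun h => ⟨⟨h.1, ?_⟩, h.2⟩
    exact (h.2 ⟨a, h.1⟩ le_rfl).trans_le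
      (Finset.single_le_sum (f := f) (fun _ _ => Nat.zero_le _) (Finset.mem_univ _))

theorem rowLen_toDiagram {f : Fin n → ℕ} (hf : Antitone f) (i : Fin n) :
    (toDiagram f).rowLen i = f i := by
  apply eq_of_forall_lt_iff
  intro b
  rw [← YoungDiagram.mem_iff_lt_rowLen, mem_toDiagram]
  exact ⟨fun h => h.2 i le_rfl, fun h => ⟨i.2, fun j hj => h.trans_le (hf hj)⟩⟩

theorem rows_toDiagram {f : Fin n → ℕ} (hf : Antitone f) : rows n (toDiagram f) = f :=
  funext (rowLen_toDiagram hf)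

theorem colLen_zero_le_iff {lam : YoungDiagram} {n : ℕ} :
    lam.colLen 0 ≤ n ↔ ∀ i, n ≤ i → lam.rowLen i = 0 := by
  constructor
  · intro h i hi
    by_contra h0
    have := YoungDiagram.mem_iff_lt_rowLen.2 (Nat.pos_of_ne_zero h0)
    have := YoungDiagram.mem_iff_lt_colLen.1 this
    omega
  · intro h
    by_contra h0
    have := YoungDiagram.mem_iff_lt_colLen.2 (not_le.1 h0)
    have := YoungDiagram.mem_iff_lt_rowLen.1 this
    have := h n le_rfl
    omega

theorem colLen_toDiagram_le (f : Fin n → ℕ) : (toDiagram f).colLen 0 ≤ n := by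
  rw [colLen_zero_le_iff]
  intro i hi
  by_contra h0
  have := YoungDiagram.mem_iff_lt_rowLen.2 (Nat.pos_of_ne_zero h0)
  have := (mem_toDiagram.1 this).1
  omega

theorem diagram_ext {lam mu : YoungDiagram} (h : ∀ i, lam.rowLen i = mu.rowLen i) : lam = mu := by
  ext ⟨a, b⟩
  simp only [YoungDiagram.mem_cells, YoungDiagram.mem_iff_lt_rowLen, h]

theorem rows_antitone (n : ℕ) (lam : YoungDiagram) : Antitone (rows n lam) :=
  fun i j h => lam.rowLen_anti i j h

theorem toDiagram_rows {lam : YoungDiagram} (h : lam.colLen 0 ≤ n) :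
    toDiagram (rows n lam) = lam := by
  apply diagram_ext
  intro i
  by_cases hi : i < n
  · exact rowLen_toDiagram (rows_antitone n lam) ⟨i, hi⟩
  · rw [colLen_zero_le_iff.1 h i (not_lt.1 hi),
      colLen_zero_le_iff.1 (colLen_toDiagram_le _) i (not_lt.1 hi)]

theorem rows_injective {lam mu : YoungDiagram} (h : lam.colLen 0 ≤ n) (h' : mu.colLen 0 ≤ n)
    (e : rows n lam = rows n mu) : lam = mu := by
  rw [← toDiagram_rows h, e, toDiagram_rows h']

theorem card_eq_sum_rows {lam : YoungDiagram} (h : lam.colLen 0 ≤ n) :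
    lam.card = ∑ i, rows n lam i := by
  have h1 : lam.card = ∑ i ∈ Finset.range n, (lam.row i).card := by
    rw [YoungDiagram.card, Finset.card_eq_sum_card_fiberwise (f := Prod.fst) (t := Finset.range n)]
    · rfl
    · rintro ⟨a, b⟩ hab
      have : a < lam.colLen 0 := YoungDiagram.mem_iff_lt_colLen.1
        (lam.up_left_mem le_rfl (Nat.zero_le b) ((YoungDiagram.mem_cells _).1 hab))
      simp only [Finset.coe_range, Set.mem_Iio]
      omega
  rw [h1, Finset.sum_range]
  exact Finset.sum_congr rfl fun i _ => (YoungDiagram.rowLen_eq_card lam).symm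

/-- `f` is a partition with `f i - f j ≤ k` for all `i`, `j`. -/
def Restr (k : ℕ) (f : Fin n → ℕ) : Prop := Antitone f ∧ ∀ i j, f i ≤ f j + k

theorem isRestricted_iff {k : ℕ} (hn : 0 < n) {lam : YoungDiagram} :
    IsRestricted n k lam ↔ lam.colLen 0 ≤ n ∧ Restr k (rows n lam) := by
  refine and_congr_right fun _ => ⟨fun h => ⟨rows_antitone n lam, fun i j => ?_⟩, fun h => ?_⟩
  · have h1 := lam.rowLen_anti 0 i (Nat.zero_le _)
    have h2 := lam.rowLen_anti j (n - 1) (by omega)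
    simp only [rows]
    omega
  · exact h.2 ⟨0, hn⟩ ⟨n - 1, by omega⟩

theorem isRestricted_toDiagram {k : ℕ} (hn : 0 < n) {f : Fin n → ℕ} (hf : Restr k f) :
    IsRestricted n k (toDiagram f) := by
  rw [isRestricted_iff hn, rows_toDiagram hf.1]
  exact ⟨colLen_toDiagram_le f, hf⟩

theorem card_toDiagram {f : Fin n → ℕ} (hf : Antitone f) : (toDiagram f).card = ∑ i, f i := by
  rw [card_eq_sum_rows (colLen_toDiagram_le f), rows_toDiagram hf]

end Rows

/-! ### The Pieri rule -/

section Pieri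

variable {n : ℕ}

/-- The Schur polynomial `det (x_i ^ (f_j + n - j)) / det (x_i ^ (n - j))` of any sequence `f`. -/
noncomputable def schurFun (f : Fin n → ℕ) : symmetricSubalgebra (Fin n) ℚ :=
  Classical.choose (exists_schur fun j : Fin n => f j.rev + j)

theorem schurFun_mul_vandermonde (f : Fin n → ℕ) :
    (schurFun f : MvPolynomial (Fin n) ℚ) * (alternant fun j : Fin n => (j : ℕ)) =
      alternant fun j : Fin n => f j.rev + j :=
  Classical.choose_spec (exists_schur fun j : Fin n => f j.rev + j)

theorem schur_eq_schurFun (n : ℕ) (lam : YoungDiagram) : schur n lam = schurFun (rows n lam) := rfl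

theorem symmetric_ext_mul_vandermonde {s t : symmetricSubalgebra (Fin n) ℚ}
    (h : (s : MvPolynomial (Fin n) ℚ) * (alternant fun j : Fin n => (j : ℕ)) =
      t * (alternant fun j : Fin n => (j : ℕ))) : s = t :=
  Subtype.ext (mul_right_cancel₀ vandermonde_ne_zero h)

theorem alternant_eq_sum (α : Fin n → ℕ) :
    alternant α = ∑ σ : Equiv.Perm (Fin n), Equiv.Perm.sign σ •
      ∏ i, (X (σ i) ^ α i : MvPolynomial (Fin n) ℚ) := by
  rw [alternant, Matrix.det_apply]
  rfl

/-- The numerator alternant has two equal columns. This disposes of the non-partitions in the Pieri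
sum below, which runs over all sets of rows. -/
theorem schurFun_eq_zero {f : Fin n → ℕ} {i j : Fin n} (hij : i ≠ j)
    (h : (f i : ℤ) - i = f j - j) : schurFun f = 0 := by
  apply symmetric_ext_mul_vandermonde
  rw [schurFun_mul_vandermonde]
  simp only [ZeroMemClass.coe_zero, zero_mul]
  apply Matrix.det_zero_of_column_eq (i := i.rev) (j := j.rev)
  · simpa using hij
  · intro c
    have : f i + (i.rev : ℕ) = f j + (j.rev : ℕ) := by
      rw [Fin.val_rev, Fin.val_rev]
      omega
    simp only [Matrix.of_apply, Fin.rev_rev, this]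

theorem schurFun_zero : schurFun (0 : Fin n → ℕ) = 1 := by
  apply symmetric_ext_mul_vandermonde
  rw [schurFun_mul_vandermonde]
  simp

/-- The elementary symmetric polynomial as an element of the symmetric subalgebra. -/
noncomputable def elem (n p : ℕ) : symmetricSubalgebra (Fin n) ℚ :=
  ⟨esymm (Fin n) ℚ p, esymm_isSymmetric _ _ _⟩

/-- `f` with one box added in each row of `T`. -/
def addRows (f : Fin n → ℕ) (T : Finset (Fin n)) (i : Fin n) : ℕ := f i + if i ∈ T then 1 else 0

theorem esymm_eq_sum_perm (p : ℕ) (σ : Equiv.Perm (Fin n)) :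
    esymm (Fin n) ℚ p = ∑ T ∈ Finset.powersetCard p Finset.univ, ∏ i ∈ T, X (σ i) := by
  conv_lhs => rw [← rename_esymm (Fin n) ℚ p σ]
  simp [esymm]

/-- By symmetry the elementary polynomial can be written in the variables permuted by σ before it
multiplies the σ-th term of the determinant; each of its monomials then raises the exponents in a
set of positions that does not depend on σ. -/
theorem esymm_mul_alternant (p : ℕ) (α : Fin n → ℕ) :
    esymm (Fin n) ℚ p * alternant α =
      ∑ T ∈ Finset.powersetCard p Finset.univ, alternant (addRows α T) := by
  simp only [alternant_eq_sum]
  rw [Finset.sum_comm, Finset.mul_sum]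
  refine Finset.sum_congr rfl fun σ _ => ?_
  rw [esymm_eq_sum_perm p σ, Finset.sum_mul]
  refine Finset.sum_congr rfl fun T _ => ?_
  rw [mul_smul_comm]
  congr 1
  simp only [addRows, pow_add, Finset.prod_mul_distrib]
  rw [mul_comm]
  congr 1
  simp only [pow_ite, pow_one, pow_zero, Finset.prod_ite_mem, Finset.univ_inter]

theorem elem_mul_schurFun (p : ℕ) (f : Fin n → ℕ) :
    elem n p * schurFun f = ∑ T ∈ Finset.powersetCard p Finset.univ, schurFun (addRows f T) := by
  apply symmetric_ext_mul_vandermonde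
  simp only [MulMemClass.coe_mul, AddSubmonoidClass.coe_finsetSum, Finset.sum_mul, mul_assoc,
    schurFun_mul_vandermonde]
  rw [elem, esymm_mul_alternant]
  -- The columns of the alternants list the rows in reverse order, so sets of columns and sets of
  -- rows correspond under reversal.
  refine Finset.sum_nbij' (fun T => T.map Fin.revPerm.toEmbedding)
    (fun T => T.map Fin.revPerm.toEmbedding) ?_ ?_ ?_ ?_ ?_
  · simp [Finset.mem_powersetCard]
  · simp [Finset.mem_powersetCard]
  · intro T _
    ext; simp
  · intro T _
    ext; simp
  · intro T _
    congr 1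
    funext j
    simp only [addRows]
    have : j.rev ∈ T.map Fin.revPerm.toEmbedding ↔ j ∈ T := by simp
    simp only [this]
    ring

end Pieri

/-! ### The Pieri rules on the cylinder -/

section FusionPieri

variable {n : ℕ}

/-- Elements `c f` and `e p` of a ring that satisfy the Pieri rule, where `c f` vanishes when `f` lies
on a wall of the fundamental alcove of level `k`. -/
structure PieriSystem (R : Type*) [CommRing R] (m k : ℕ) where
  c : (Fin (m + 1) → ℕ) → R
  e : ℕ → R
  c_zero : c 0 = 1
  e_zero : e 0 = 1
  e_mul_c : ∀ p f, e p * c f = ∑ T ∈ Finset.powersetCard p Finset.univ, c (addRows f T)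
  c_eq_zero_of_succ : ∀ f, ∀ i : Fin m, f i.succ = f i.castSucc + 1 → c f = 0
  c_eq_zero_of_gap : ∀ f, Antitone f → f 0 = f (Fin.last m) + (k + 1) → c f = 0

/-- `g / f` is a vertical strip and `g` is restricted. -/
def VStrip (k : ℕ) (f g : Fin n → ℕ) : Prop := (∀ i, f i ≤ g i ∧ g i ≤ f i + 1) ∧ Restr k g

/-- `g / f` is a horizontal strip on the cylinder: it is a horizontal strip, and the largest part
of `g` exceeds the smallest part of `f` by at most `k`. -/
def HStrip (k : ℕ) (f g : Fin n → ℕ) : Prop :=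
  (∀ i, f i ≤ g i) ∧ (∀ i j, i < j → g j ≤ f i) ∧ ∀ i j, g i ≤ f j + k

theorem HStrip.restr {k : ℕ} {f g : Fin n → ℕ} (h : HStrip k f g) : Restr k g := by
  refine ⟨fun i j hij => ?_, fun i j => (h.2.2 i j).trans (Nat.add_le_add_right (h.1 j) k)⟩
  rcases hij.eq_or_lt with rfl | hij
  · exact le_rfl
  · exact (h.2.1 i j hij).trans (h.1 i)

open Classical in
/-- The sequences of size `|f| + a` that are related to `f` by `R`. -/
noncomputable def strips (R : (Fin n → ℕ) → (Fin n → ℕ) → Prop) (f : Fin n → ℕ) (a : ℕ) :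
    Finset (Fin n → ℕ) :=
  {g ∈ Fintype.piFinset fun i => Finset.Icc (f i) (f i + a) | R f g ∧ ∑ i, g i = ∑ i, f i + a}

theorem mem_strips {R : (Fin n → ℕ) → (Fin n → ℕ) → Prop} {f g : Fin n → ℕ} {a : ℕ}
    (hR : R f g → ∀ i, f i ≤ g i) : g ∈ strips R f a ↔ R f g ∧ ∑ i, g i = ∑ i, f i + a := by
  simp only [strips, Finset.mem_filter, and_iff_right_iff_imp]
  rintro ⟨h1, h2⟩
  simp only [Fintype.mem_piFinset, Finset.mem_Icc]
  refine fun i => ⟨hR h1 i, ?_⟩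
  have h3 := Finset.add_sum_erase Finset.univ g (Finset.mem_univ i)
  have h4 := Finset.add_sum_erase Finset.univ f (Finset.mem_univ i)
  have h5 : ∑ j ∈ Finset.univ.erase i, f j ≤ ∑ j ∈ Finset.univ.erase i, g j :=
    Finset.sum_le_sum fun j _ => hR h1 j
  omega

theorem mem_vstrips {k : ℕ} {f g : Fin n → ℕ} {a : ℕ} :
    g ∈ strips (VStrip k) f a ↔ VStrip k f g ∧ ∑ i, g i = ∑ i, f i + a :=
  mem_strips fun h i => (h.1 i).1

theorem mem_hstrips {k : ℕ} {f g : Fin n → ℕ} {a : ℕ} :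
    g ∈ strips (HStrip k) f a ↔ HStrip k f g ∧ ∑ i, g i = ∑ i, f i + a :=
  mem_strips fun h i => h.1 i

theorem sum_addRows (f : Fin n → ℕ) (T : Finset (Fin n)) :
    ∑ i, addRows f T i = ∑ i, f i + T.card := by
  simp [addRows, Finset.sum_add_distrib]

theorem addRows_injective (f : Fin n → ℕ) : Function.Injective (addRows f) := by
  intro T T' h
  ext i
  have := congrFun h i
  simp only [addRows] at this
  by_cases h1 : i ∈ T <;> by_cases h2 : i ∈ T' <;> simp_all

/-- One box per row cannot jump over a wall of the alcove: if the result is not restricted, then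
some row exceeds the previous one by exactly one, or the width is exactly k + 1. -/
theorem PieriSystem.c_addRows_eq_zero {R : Type*} [CommRing R] {m k : ℕ} (Q : PieriSystem R m k)
    {f : Fin (m + 1) → ℕ} (hf : Restr k f)
    {T : Finset (Fin (m + 1))} (h : ¬ Restr k (addRows f T)) : Q.c (addRows f T) = 0 := by
  have hle : ∀ i, f i ≤ addRows f T i ∧ addRows f T i ≤ f i + 1 := by
    intro i
    simp only [addRows]
    split_ifs <;> omega
  by_cases ha : Antitone (addRows f T)
  · apply Q.c_eq_zero_of_gap _ ha
    have : ∃ i j, addRows f T j + k < addRows f T i := by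
      by_contra! h'
      exact h ⟨ha, h'⟩
    obtain ⟨i, j, hij⟩ := this
    have h1 := ha (Fin.zero_le i)
    have h2 := ha (Fin.le_last j)
    have h3 := hf.2 0 (Fin.last m)
    have h4 := hle 0
    have h5 := hle (Fin.last m)
    omega
  · rw [Fin.antitone_iff_succ_le] at ha
    push Not at ha
    obtain ⟨i, hi⟩ := ha
    apply Q.c_eq_zero_of_succ _ i
    have h1 := hle i.succ
    have h2 := hle i.castSucc
    have h3 := hf.1 i.castSucc_lt_succ.le
    omega

theorem PieriSystem.e_mul_c_eq_sum_vstrips {R : Type*} [CommRing R] {m k : ℕ} (Q : PieriSystem R m k)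
    (p : ℕ) {f : Fin (m + 1) → ℕ} (hf : Restr k f) :
    Q.e p * Q.c f = ∑ g ∈ strips (VStrip k) f p, Q.c g := by
  classical
  rw [Q.e_mul_c, ← Finset.sum_filter_of_ne (p := fun T => Restr k (addRows f T))]
  · refine Finset.sum_bij (fun T _ => addRows f T) ?_ ?_ ?_ ?_
    · intro T hT
      rw [Finset.mem_filter, Finset.mem_powersetCard] at hT
      rw [mem_vstrips, sum_addRows, hT.1.2]
      refine ⟨⟨fun i => ?_, hT.2⟩, rfl⟩
      simp only [addRows]
      split_ifs <;> omega
    · exact fun T _ T' _ h => addRows_injective f h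
    · intro g hg
      rw [mem_vstrips] at hg
      have hg' : addRows f {i | g i = f i + 1} = g := by
        funext i
        have := hg.1.1 i
        simp only [addRows, Finset.mem_filter, Finset.mem_univ, true_and]
        split_ifs <;> omega
      refine ⟨({i | g i = f i + 1} : Finset (Fin (m + 1))), ?_, hg'⟩
      rw [Finset.mem_filter, Finset.mem_powersetCard, hg']
      refine ⟨⟨Finset.subset_univ _, ?_⟩, hg.1.2⟩
      have := sum_addRows f ({i | g i = f i + 1} : Finset (Fin (m + 1)))
      rw [hg', hg.2] at this
      omega
    · exact fun _ _ => rfl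
  · intro T _ h
    by_contra h'
    exact h (Q.c_addRows_eq_zero hf h')

/-- The upper bounds for the parts of `g` when `g / f` is a cylindric horizontal strip. -/
def stripBound {m : ℕ} (k : ℕ) (f : Fin (m + 1) → ℕ) : Fin (m + 1) → ℕ :=
  Fin.cons (f (Fin.last m) + k) fun j => f j.castSucc

/-- Since f is restricted, only cyclically neighbouring rows matter. The strips over f form a
product of intervals, so the rows of g can be changed independently; the involution below rests on
this. -/
theorem hStrip_iff {m k : ℕ} {f g : Fin (m + 1) → ℕ} (hf : Restr k f) :
    HStrip k f g ↔ ∀ i, f i ≤ g i ∧ g i ≤ stripBound k f i := by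
  constructor
  · intro h i
    refine ⟨h.1 i, ?_⟩
    refine Fin.cases ?_ (fun j => ?_) i
    · exact h.2.2 0 (Fin.last m)
    · exact h.2.1 j.castSucc j.succ j.castSucc_lt_succ
  · intro h
    refine ⟨fun i => (h i).1, fun i j hij => ?_, fun i j => (h i).2.trans ?_⟩
    · obtain ⟨j, rfl⟩ := Fin.exists_succ_eq.2 (Fin.ne_zero_of_lt hij)
      refine (h j.succ).2.trans (hf.1 ?_)
      exact Fin.le_castSucc_iff.2 hij
    · refine Fin.cases ?_ (fun i => ?_) i
      · exact Nat.add_le_add_right (hf.1 (Fin.le_last j)) k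
      · exact hf.2 _ _

theorem le_stripBound {m k : ℕ} {f : Fin (m + 1) → ℕ} (hf : Restr k f) (i : Fin (m + 1)) :
    f i ≤ stripBound k f i := by
  refine Fin.cases ?_ (fun i => ?_) i
  · exact hf.2 _ _
  · exact hf.1 i.castSucc_lt_succ.le

theorem sum_stripBound {m : ℕ} (k : ℕ) (f : Fin (m + 1) → ℕ) :
    ∑ i, stripBound k f i = ∑ i, f i + k := by
  rw [Fin.sum_univ_succ, Fin.sum_univ_castSucc]
  simp only [stripBound, Fin.cons_zero, Fin.cons_succ]
  ring

/-- These γ are the fixed points of the involution below. If an untouched row is followed by a row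
beyond its bound, then γ lies on a wall between neighbours. Otherwise the rows beyond their bounds
form an initial segment, and the bounds on a make it nonempty and proper, which puts γ on the affine
wall. -/
theorem PieriSystem.c_eq_zero_of_extremal {R : Type*} [CommRing R] {m k : ℕ} (Q : PieriSystem R m k)
    {a : ℕ} {f γ : Fin (m + 1) → ℕ} (hf : Restr k f) (ha : 0 < a)
    (ha' : a < m + 1 + k) (hsum : ∑ i, γ i = ∑ i, f i + a)
    (hγ : ∀ i, γ i = f i ∨ γ i = stripBound k f i + 1) : Q.c γ = 0 := by
  by_cases hadj : ∃ i : Fin m, γ i.succ = γ i.castSucc + 1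
  · obtain ⟨i, hi⟩ := hadj
    exact Q.c_eq_zero_of_succ _ i hi
  push Not at hadj
  have hstep : ∀ i : Fin m, γ i.succ = stripBound k f i.succ + 1 →
      γ i.castSucc = stripBound k f i.castSucc + 1 := by
    intro i hi
    refine (hγ i.castSucc).resolve_left fun h => hadj i ?_
    rw [hi, h]
    rfl
  have h0 : γ 0 = stripBound k f 0 + 1 := by
    refine (hγ 0).resolve_left fun h => ?_
    have : ∀ i, γ i = f i := by
      intro i
      induction i using Fin.induction with
      | zero => exact h
      | succ i ih =>
        refine (hγ i.succ).resolve_right fun h' => ?_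
        have := hstep i h'
        have := le_stripBound hf i.castSucc
        omega
    simp only [this] at hsum
    omega
  -- If all rows were beyond their bounds, the number of added boxes would be k + (m + 1), which
  -- `ha'` excludes.
  have hlast : γ (Fin.last m) = f (Fin.last m) := by
    refine (hγ _).resolve_right fun h => ?_
    have : ∀ i, γ i = stripBound k f i + 1 := by
      intro i
      induction i using Fin.reverseInduction with
      | last => exact h
      | cast i ih => exact hstep i ih
    simp only [this, Finset.sum_add_distrib, sum_stripBound] at hsum
    simp at hsum
    omega
  refine Q.c_eq_zero_of_gap _ ?_ (by rw [h0, hlast]; rfl)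
  rw [Fin.antitone_iff_succ_le]
  intro i
  have h1 := le_stripBound hf i.castSucc
  have h2 : f i.succ ≤ f i.castSucc := hf.1 i.castSucc_lt_succ.le
  have h4 : stripBound k f i.succ = f i.castSucc := rfl
  rcases hγ i.succ with h | h
  · rcases hγ i.castSucc with h' | h' <;> omega
  · have h3 := hstep i h
    omega

/-- Moving a box of row `j` from `T` to `g` or back. -/
def toggle (j : Fin n) (x : (Fin n → ℕ) × Finset (Fin n)) : (Fin n → ℕ) × Finset (Fin n) :=
  if j ∈ x.2 then (Function.update x.1 j (x.1 j + 1), x.2.erase j)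
  else (Function.update x.1 j (x.1 j - 1), insert j x.2)

theorem addRows_toggle {j : Fin n} {x : (Fin n → ℕ) × Finset (Fin n)}
    (h : 0 < addRows x.1 x.2 j) :
    addRows (toggle j x).1 (toggle j x).2 = addRows x.1 x.2 := by
  funext i
  by_cases hj : j ∈ x.2
  · simp only [toggle, hj, if_true, addRows, Finset.mem_erase]
    by_cases hi : i = j
    · subst hi; simp [hj]
    · simp [hi]
  · simp only [addRows, hj, if_false] at h
    simp only [toggle, hj, if_false, addRows, Finset.mem_insert]
    by_cases hi : i = j
    · subst hi; simp [hj]; omega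
    · simp [hi]

theorem toggle_toggle {j : Fin n} {x : (Fin n → ℕ) × Finset (Fin n)}
    (h : 0 < addRows x.1 x.2 j) : toggle j (toggle j x) = x := by
  by_cases hj : j ∈ x.2
  · simp [toggle, hj, Finset.insert_erase]
  · simp only [addRows, hj, if_false, add_zero] at h
    have : x.1 j - 1 + 1 = x.1 j := by omega
    rw [toggle, toggle, if_neg hj]
    simp [this, hj]

theorem neg_one_pow_card_toggle {R : Type*} [CommRing R] (j : Fin n)
    (x : (Fin n → ℕ) × Finset (Fin n)) :
    (-1 : R) ^ (toggle j x).2.card = -(-1) ^ x.2.card := by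
  by_cases hj : j ∈ x.2
  · have : x.2.card = (x.2.erase j).card + 1 := (Finset.card_erase_add_one hj).symm
    rw [this, pow_succ, toggle, if_pos hj]
    simp
  · simp [toggle, hj, pow_succ]

theorem toggle_ne (j : Fin n) (x : (Fin n → ℕ) × Finset (Fin n)) : toggle j x ≠ x := by
  intro h
  have := congrArg (fun y : (Fin n → ℕ) × Finset (Fin n) => j ∈ y.2) h
  by_cases hj : j ∈ x.2 <;> simp [toggle, hj] at this

theorem toggle_apply_of_ne {i j : Fin n} (h : i ≠ j) (x : (Fin n → ℕ) × Finset (Fin n)) :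
    (toggle j x).1 i = x.1 i := by
  by_cases hj : j ∈ x.2 <;> simp [toggle, hj, h]

-- The analogue of Σ (-1)^i e_i h_(a-i) = 0, applied to c f. After expansion the terms are pairs of
-- a horizontal strip g and a row set T; moving one box between g and T preserves the sum γ of both
-- and changes the sign.
open Classical in
theorem PieriSystem.sum_e_mul_sum_hstrips {R : Type*} [CommRing R] {m k : ℕ} (Q : PieriSystem R m k)
    {a : ℕ} {f : Fin (m + 1) → ℕ} (hf : Restr k f)
    (ha : 0 < a) (ha' : a < m + 1 + k) :
    ∑ i ∈ Finset.range (a + 1), (-1) ^ i * (Q.e i *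
      ∑ g ∈ strips (HStrip k) f (a - i), Q.c g) = 0 := by
  let pairs : Finset ((Fin (m + 1) → ℕ) × Finset (Fin (m + 1))) :=
    {x ∈ (Fintype.piFinset fun i => Finset.Icc (f i) (f i + a)) ×ˢ Finset.univ |
      HStrip k f x.1 ∧ ∑ i, x.1 i + x.2.card = ∑ i, f i + a}
  have hpairs : ∀ x, x ∈ pairs ↔ HStrip k f x.1 ∧ ∑ i, x.1 i + x.2.card = ∑ i, f i + a := by
    rintro ⟨g, T⟩
    simp only [pairs, Finset.mem_filter, Finset.mem_product, Finset.mem_univ, and_true,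
      and_iff_right_iff_imp, Fintype.mem_piFinset, Finset.mem_Icc]
    rintro ⟨h1, h2⟩ i
    refine ⟨h1.1 i, ?_⟩
    have h3 := Finset.add_sum_erase Finset.univ g (Finset.mem_univ i)
    have h4 := Finset.add_sum_erase Finset.univ f (Finset.mem_univ i)
    have h5 : ∑ j ∈ Finset.univ.erase i, f j ≤ ∑ j ∈ Finset.univ.erase i, g j :=
      Finset.sum_le_sum fun j _ => h1.1 j
    omega
  have hlhs : ∑ i ∈ Finset.range (a + 1), (-1) ^ i * (Q.e i *
      ∑ g ∈ strips (HStrip k) f (a - i), Q.c g) =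
      ∑ x ∈ pairs, (-1) ^ x.2.card * Q.c (addRows x.1 x.2) := by
    have h1 : ∀ x ∈ pairs, x.2.card ∈ Finset.range (a + 1) := by
      intro x hx
      rw [hpairs] at hx
      have : ∑ i, f i ≤ ∑ i, x.1 i := Finset.sum_le_sum fun i _ => hx.1.1 i
      rw [Finset.mem_range]
      omega
    rw [← Finset.sum_fiberwise_of_maps_to h1]
    refine Finset.sum_congr rfl fun i hi => ?_
    rw [Finset.mem_range] at hi
    simp only [Finset.mul_sum, Q.e_mul_c]
    rw [Finset.sum_sigma']
    refine Finset.sum_bij (fun x _ => (x.1, x.2)) ?_ ?_ ?_ ?_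
    · rintro ⟨g, T⟩ hx
      simp only [Finset.mem_sigma, mem_hstrips, Finset.mem_powersetCard] at hx
      simp only [Finset.mem_filter, hpairs]
      exact ⟨⟨hx.1.1, by omega⟩, hx.2.2⟩
    · rintro ⟨g, T⟩ _ ⟨g', T'⟩ _ h
      simp only [Prod.mk.injEq] at h
      rw [h.1, h.2]
    · rintro ⟨g, T⟩ hx
      simp only [Finset.mem_filter, hpairs] at hx
      refine ⟨⟨g, T⟩, ?_, rfl⟩
      simp only [Finset.mem_sigma, mem_hstrips, Finset.mem_powersetCard]
      exact ⟨⟨hx.1.1, by omega⟩, Finset.subset_univ _, hx.2⟩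
    · rintro ⟨g, T⟩ hx
      simp only [Finset.mem_sigma, Finset.mem_powersetCard] at hx
      simp only [hx.2.2]
  rw [hlhs]
  -- In such a row the last box of γ may belong to either g or T. The row is chosen from γ alone, so
  -- that toggling twice returns to the start.
  let good : (Fin (m + 1) → ℕ) → Fin (m + 1) → Prop := fun γ j =>
    f j < γ j ∧ γ j ≤ stripBound k f j
  let pick : (Fin (m + 1) → ℕ) → Fin (m + 1) := fun γ =>
    if h : ∃ j, good γ j then h.choose else 0
  have hpick : ∀ γ, (∃ j, good γ j) → good γ (pick γ) := by
    intro γ h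
    simp only [pick, h, dif_pos]
    exact h.choose_spec
  rw [← Finset.sum_filter_of_ne (p := fun x => ∃ j, good (addRows x.1 x.2) j)]
  · have hpos : ∀ x ∈ pairs.filter (fun x => ∃ j, good (addRows x.1 x.2) j),
        0 < addRows x.1 x.2 (pick (addRows x.1 x.2)) := by
      intro x hx
      exact (Nat.zero_le _).trans_lt (hpick _ (Finset.mem_filter.1 hx).2).1
    refine Finset.sum_involution (fun x _ => toggle (pick (addRows x.1 x.2)) x) ?_ ?_ ?_ ?_
    · intro x hx
      rw [neg_one_pow_card_toggle, addRows_toggle (hpos x hx)]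
      ring
    · exact fun x _ _ => toggle_ne _ x
    · intro x hx
      have hx' := Finset.mem_filter.1 hx
      have hg := hpick _ hx'.2
      rw [Finset.mem_filter, addRows_toggle (hpos x hx)]
      refine ⟨?_, hx'.2⟩
      have h1 := (hpairs x).1 hx'.1
      rw [hpairs, hStrip_iff hf, ← sum_addRows, addRows_toggle (hpos x hx), sum_addRows]
      refine ⟨fun i => ?_, h1.2⟩
      have h2 := (hStrip_iff hf).1 h1.1 i
      by_cases hi : i = pick (addRows x.1 x.2)
      · rw [← hi] at hg ⊢
        simp only [good, addRows] at hg
        by_cases hj : i ∈ x.2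
        · simp only [toggle, hj, if_true, Function.update_self] at hg ⊢
          omega
        · simp only [toggle, hj, if_false, Function.update_self] at hg ⊢
          omega
      · rw [toggle_apply_of_ne hi]
        exact h2
    · intro x hx
      simp only [addRows_toggle (hpos x hx)]
      exact toggle_toggle (hpos x hx)
  · intro x hx h
    by_contra hne
    push Not at hne
    apply h
    rw [hpairs, hStrip_iff hf] at hx
    rw [Q.c_eq_zero_of_extremal hf ha ha' (by rw [sum_addRows, hx.2]), mul_zero]
    intro i
    have h1 := hne i
    have h2 := hx.1 i
    simp only [good, addRows, not_and, not_le] at h1 ⊢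
    split_ifs at h1 ⊢ <;> omega

/-- The analogue of the complete homogeneous symmetric polynomial. -/
noncomputable def PieriSystem.h {R : Type*} [CommRing R] {m k : ℕ} (Q : PieriSystem R m k) (a : ℕ) :
    R :=
  ∑ g ∈ strips (HStrip k) (0 : Fin (m + 1) → ℕ) a, Q.c g

theorem restr_zero (k : ℕ) : Restr k (0 : Fin n → ℕ) :=
  ⟨fun _ _ _ => le_rfl, fun _ _ => Nat.zero_le _⟩

theorem strips_hStrip_zero {k : ℕ} {f : Fin n → ℕ} (hf : Restr k f) :
    strips (HStrip k) f 0 = {f} := by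
  ext g
  rw [mem_hstrips, Finset.mem_singleton]
  constructor
  · rintro ⟨h1, h2⟩
    have := (Finset.sum_eq_sum_iff_of_le fun i _ => h1.1 i).1 (h2.trans (add_zero _)).symm
    exact funext fun i => (this i (Finset.mem_univ i)).symm
  · rintro rfl
    exact ⟨⟨fun _ => le_rfl, fun i j h => hf.1 h.le, hf.2⟩, rfl⟩

/-- The alternating identity determines the sum over strips of size a recursively from the smaller
sizes. The recursions over f and over the empty partition agree up to the factor c f. -/
theorem PieriSystem.h_mul_c {R : Type*} [CommRing R] {m k : ℕ} (Q : PieriSystem R m k)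
    (a : ℕ) (ha : a < m + 1 + k) {f : Fin (m + 1) → ℕ}
    (hf : Restr k f) :
    Q.h a * Q.c f = ∑ g ∈ strips (HStrip k) f a, Q.c g := by
  induction a using Nat.strong_induction_on with
  | _ a ih =>
    rcases Nat.eq_zero_or_pos a with rfl | hpos
    · rw [PieriSystem.h, strips_hStrip_zero hf, strips_hStrip_zero (restr_zero k)]
      simp [Q.c_zero]
    · have h1 := Q.sum_e_mul_sum_hstrips hf hpos ha
      have h2 := Q.sum_e_mul_sum_hstrips (restr_zero (n := m + 1) k) hpos ha
      rw [Finset.sum_range_succ'] at h1 h2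
      simp only [Q.e_zero, pow_zero, one_mul, Nat.sub_zero] at h1 h2
      rw [eq_neg_of_add_eq_zero_right h1, PieriSystem.h, eq_neg_of_add_eq_zero_right h2, neg_mul,
        Finset.sum_mul]
      congr 1
      refine Finset.sum_congr rfl fun i hi => ?_
      rw [Finset.mem_range] at hi
      rw [← ih (a - (i + 1)) (by omega) (by omega), PieriSystem.h]
      ring

end FusionPieri

/-! ### Two rows and two columns -/

section TwoRows

variable {m k : ℕ}

/-- The partition with parts `a`, `b`. -/
def twoRow (m a b : ℕ) (i : Fin (m + 1)) : ℕ :=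
  if (i : ℕ) = 0 then a else if (i : ℕ) = 1 then b else 0

theorem sum_eq_of_support_le_one (hm : 1 ≤ m) {g : Fin (m + 1) → ℕ}
    (hg : ∀ i : Fin (m + 1), 2 ≤ (i : ℕ) → g i = 0) :
    ∑ i, g i = g 0 + g ⟨1, by omega⟩ := by
  obtain ⟨m, rfl⟩ : ∃ m', m = m' + 1 := ⟨m - 1, by omega⟩
  rw [Fin.sum_univ_succ, Fin.sum_univ_succ, Finset.sum_eq_zero]
  · rfl
  · exact fun i _ => hg _ (by simp)

theorem sum_twoRow (hm : 1 ≤ m) (a b : ℕ) : ∑ i, twoRow m a b i = a + b := by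
  rw [sum_eq_of_support_le_one hm]
  · simp [twoRow]
  · intro i hi
    simp only [twoRow]
    split_ifs <;> omega

theorem strips_hStrip_of_zero {b : ℕ} (hb : b ≤ k) :
    strips (HStrip k) (0 : Fin (m + 1) → ℕ) b = {twoRow m b 0} := by
  ext g
  rw [mem_hstrips, Finset.mem_singleton]
  constructor
  · rintro ⟨h, hs⟩
    have h0 : ∀ i, i ≠ 0 → g i = 0 := fun i hi =>
      Nat.le_zero.1 (h.2.1 0 i (Fin.pos_of_ne_zero hi))
    rw [Fintype.sum_eq_single 0 h0] at hs
    simp only [Pi.zero_apply, Finset.sum_const_zero, zero_add] at hs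
    funext i
    by_cases hi : i = 0
    · subst hi; simp [twoRow, hs]
    · have : (i : ℕ) ≠ 0 := fun h => hi (Fin.ext h)
      simp [twoRow, this, h0 i hi]
  · rintro rfl
    refine ⟨⟨fun i => Nat.zero_le _, fun i j hij => ?_, fun i j => ?_⟩, ?_⟩
    · have : (j : ℕ) ≠ 0 := by have : (i : ℕ) < j := hij; omega
      simp [twoRow, this]
    · simp only [twoRow, Pi.zero_apply]
      split_ifs <;> omega
    · rw [Fintype.sum_eq_single 0]
      · simp [twoRow]
      · intro i hi
        have : (i : ℕ) ≠ 0 := fun h => hi (Fin.ext h)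
        simp [twoRow, this]

theorem mem_strips_hStrip_twoRow (hm : 1 ≤ m) {a b : ℕ} {g : Fin (m + 1) → ℕ} :
    g ∈ strips (HStrip k) (twoRow m b 0) a ↔
      ∃ x y, b ≤ x ∧ x ≤ k ∧ y ≤ b ∧ x + y = a + b ∧ g = twoRow m x y := by
  rw [mem_hstrips, sum_twoRow hm]
  constructor
  · rintro ⟨h, hs⟩
    have h2 : ∀ i : Fin (m + 1), 2 ≤ (i : ℕ) → g i = 0 := by
      intro i hi
      have := h.2.1 ⟨1, by omega⟩ i (Fin.lt_def.2 hi)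
      simpa [twoRow] using this
    have hg : g = twoRow m (g 0) (g ⟨1, by omega⟩) := by
      funext i
      by_cases hi : (i : ℕ) = 0
      · obtain rfl : i = 0 := Fin.ext hi
        simp [twoRow]
      · by_cases hi' : (i : ℕ) = 1
        · have : i = ⟨1, by omega⟩ := Fin.ext hi'
          rw [this]
          simp [twoRow]
        · simp [twoRow, hi, hi', h2 i (by omega)]
    rw [sum_eq_of_support_le_one hm h2] at hs
    refine ⟨g 0, g ⟨1, by omega⟩, ?_, ?_, ?_, by omega, hg⟩
    · simpa [twoRow] using h.1 0
    · simpa [twoRow] using h.2.2 0 ⟨1, by omega⟩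
    · have := h.2.1 0 ⟨1, by omega⟩ (Fin.lt_def.2 (by simp))
      simpa [twoRow] using this
  · rintro ⟨x, y, h1, h2, h3, h4, rfl⟩
    refine ⟨⟨fun i => ?_, fun i j hij => ?_, fun i j => ?_⟩, ?_⟩
    · simp only [twoRow]; split_ifs <;> omega
    · have : (i : ℕ) < j := hij
      simp only [twoRow]; split_ifs <;> omega
    · simp only [twoRow]; split_ifs <;> omega
    · rw [sum_twoRow hm]; omega

/-- The supports of the two products in the Jacobi–Trudi identity: they differ only in the shape
whose second row is as long as possible. -/
theorem strips_hStrip_twoRow (hm : 1 ≤ m) {a b : ℕ} (hba : b + 1 ≤ a) (hak : a ≤ k) :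
    twoRow m a (b + 1) ∉ strips (HStrip k) (twoRow m b 0) (a + 1) ∧
    strips (HStrip k) (twoRow m (b + 1) 0) a =
      insert (twoRow m a (b + 1)) (strips (HStrip k) (twoRow m b 0) (a + 1)) := by
  constructor
  · rw [mem_strips_hStrip_twoRow hm]
    rintro ⟨x, y, h1, h2, h3, h4, h⟩
    have := congrFun h ⟨1, by omega⟩
    simp [twoRow] at this
    omega
  · ext g
    rw [Finset.mem_insert, mem_strips_hStrip_twoRow hm, mem_strips_hStrip_twoRow hm]
    constructor
    · rintro ⟨x, y, h1, h2, h3, h4, rfl⟩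
      rcases Nat.lt_or_ge b y with h | h
      · left
        rw [show x = a by omega, show y = b + 1 by omega]
      · exact Or.inr ⟨x, y, by omega, h2, h, by omega, rfl⟩
    · rintro (rfl | ⟨x, y, h1, h2, h3, h4, rfl⟩)
      · exact ⟨a, b + 1, hba, hak, le_rfl, rfl, rfl⟩
      · exact ⟨x, y, by omega, h2, by omega, by omega, rfl⟩

/-- The partition with columns of lengths `p`, `q`. -/
def twoCol (m p q : ℕ) (i : Fin (m + 1)) : ℕ :=
  (if (i : ℕ) < p then 1 else 0) + if (i : ℕ) < q then 1 else 0

theorem sum_ite_lt {p : ℕ} (hp : p ≤ m + 1) :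
    ∑ i : Fin (m + 1), (if (i : ℕ) < p then 1 else 0) = p := by
  rw [Fin.sum_univ_eq_sum_range (fun i => if i < p then 1 else 0), Finset.sum_boole]
  have : {x ∈ Finset.range (m + 1) | x < p} = Finset.range p := by
    ext x
    simp only [Finset.mem_filter, Finset.mem_range]
    omega
  simp [this]

theorem sum_twoCol {p q : ℕ} (hp : p ≤ m + 1) (hq : q ≤ m + 1) :
    ∑ i, twoCol m p q i = p + q := by
  simp only [twoCol, Finset.sum_add_distrib, sum_ite_lt hp, sum_ite_lt hq]

theorem eq_twoCol_of_le_one {g : Fin (m + 1) → ℕ} (hg : Antitone g) (h1 : ∀ i, g i ≤ 1) {p : ℕ}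
    (hs : ∑ i, g i = p) : g = twoCol m p 0 := by
  funext i
  simp only [twoCol, Nat.not_lt_zero, if_false, add_zero]
  split_ifs with hi
  · by_contra h
    have h0 : g i = 0 := by have := h1 i; omega
    have : ∑ j, g j = ∑ j ∈ Finset.Iio i, g j := by
      symm
      apply Finset.sum_subset (Finset.subset_univ _)
      intro j _ hj
      rw [Finset.mem_Iio, not_lt] at hj
      have := hg hj
      omega
    have h2 : ∑ j ∈ Finset.Iio i, g j ≤ ∑ j ∈ Finset.Iio i, 1 := Finset.sum_le_sum fun j _ => h1 j
    simp at h2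
    omega
  · by_contra h
    have h2 : ∑ j ∈ Finset.Iic i, 1 ≤ ∑ j ∈ Finset.Iic i, g j := by
      refine Finset.sum_le_sum fun j hj => ?_
      have := hg (Finset.mem_Iic.1 hj)
      omega
    have h3 : ∑ j ∈ Finset.Iic i, g j ≤ ∑ j, g j :=
      Finset.sum_le_sum_of_subset (Finset.subset_univ _)
    simp at h2
    omega

theorem twoCol_antitone (p q : ℕ) : Antitone (twoCol m p q) := by
  intro i j hij
  have : (i : ℕ) ≤ j := hij
  simp only [twoCol]
  split_ifs <;> omega

theorem restr_twoCol (hk : 2 ≤ k) (p q : ℕ) : Restr k (twoCol m p q) := by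
  refine ⟨twoCol_antitone p q, fun i j => ?_⟩
  simp only [twoCol]
  split_ifs <;> omega

theorem strips_vStrip_of_zero (hk : 1 ≤ k) {b : ℕ} (hb : b ≤ m + 1) :
    strips (VStrip k) (0 : Fin (m + 1) → ℕ) b = {twoCol m b 0} := by
  ext g
  rw [mem_vstrips, Finset.mem_singleton]
  constructor
  · rintro ⟨h, hs⟩
    refine eq_twoCol_of_le_one h.2.1 (fun i => ?_) (by simpa using hs)
    simpa using (h.1 i).2
  · rintro rfl
    refine ⟨⟨fun i => ⟨Nat.zero_le _, ?_⟩, twoCol_antitone b 0, fun i j => ?_⟩, ?_⟩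
    · simp only [twoCol, Pi.zero_apply]; split_ifs <;> omega
    · simp only [twoCol]; split_ifs <;> omega
    · rw [sum_twoCol hb (Nat.zero_le _)]; simp

theorem strips_vStrip_twoCol (hk : 2 ≤ k) {p q : ℕ} (hqp : q + 1 ≤ p) (hp : p ≤ m + 1) :
    twoCol m p (q + 1) ∉ strips (VStrip k) (twoCol m q 0) (p + 1) ∧
    strips (VStrip k) (twoCol m (q + 1) 0) p =
      insert (twoCol m p (q + 1)) (strips (VStrip k) (twoCol m q 0) (p + 1)) := by
  have hq : q < m + 1 := by omega
  constructor
  · rw [mem_vstrips]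
    rintro ⟨h, -⟩
    have := (h.1 ⟨q, hq⟩).2
    simp only [twoCol] at this
    split_ifs at this <;> omega
  · ext g
    rw [Finset.mem_insert, mem_vstrips, mem_vstrips, sum_twoCol (by omega) (Nat.zero_le _),
      sum_twoCol (by omega) (Nat.zero_le _)]
    constructor
    · rintro ⟨⟨h1, h2⟩, h3⟩
      have hgq := (h1 ⟨q, hq⟩).2
      simp only [twoCol] at hgq
      by_cases hg2 : g ⟨q, hq⟩ = 2
      · left
        have h4 : ∀ i : Fin (m + 1), (i : ℕ) < q + 1 → g i = 2 := by
          intro i hi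
          have h5 := (h1 i).2
          have h6 := h2.1 (show i ≤ ⟨q, hq⟩ from Fin.le_def.2 (by simp; omega))
          simp only [twoCol] at h5
          split_ifs at h5 <;> omega
        have h5 : ∀ i : Fin (m + 1), ¬ (i : ℕ) < q + 1 → g i ≤ 1 := by
          intro i hi
          have h5 := (h1 i).2
          simp only [twoCol] at h5
          split_ifs at h5 <;> omega
        -- The rows up to q have length two and the others at most one, so removing a column of
        -- length q + 1 leaves a single column, whose length is fixed by the size.
        have h6 : (fun i => g i - if (i : ℕ) < q + 1 then 1 else 0) = twoCol m p 0 := by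
          apply eq_twoCol_of_le_one
          · intro i j hij
            have h7 : (i : ℕ) ≤ j := hij
            have h8 := h2.1 hij
            have h9 := h4 i
            have h10 := h5 j
            have h11 := h4 j
            simp only
            split_ifs with h12 h13 h13
            · omega
            · omega
            · have := h10 h12
              have := h9 h13
              omega
            · omega
          · intro i
            have h9 := h4 i
            have h10 := h5 i
            split_ifs with h11
            · have := h9 h11; omega
            · have := h10 h11; omega
          · have h7 : ∑ i, g i = ∑ i : Fin (m + 1), (g i - if (i : ℕ) < q + 1 then 1 else 0) +
                ∑ i : Fin (m + 1), if (i : ℕ) < q + 1 then 1 else 0 := by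
              rw [← Finset.sum_add_distrib]
              refine Finset.sum_congr rfl fun i _ => ?_
              have := h4 i
              split_ifs with h11
              · have := this h11; omega
              · omega
            rw [sum_ite_lt (by omega)] at h7
            omega
        funext i
        have h7 := congrFun h6 i
        have h8 := h4 i
        simp only [twoCol, Nat.not_lt_zero, if_false, add_zero] at h7 ⊢
        by_cases h9 : (i : ℕ) < q + 1
        · have := h8 h9
          split_ifs <;> omega
        · split_ifs at h7 ⊢; omega
          omega
      · refine Or.inr ⟨⟨fun i => ?_, h2⟩, by omega⟩
        have h5 := h1 i
        by_cases hi : (i : ℕ) = q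
        · obtain rfl : i = ⟨q, hq⟩ := Fin.ext hi
          simp only [twoCol] at h5 ⊢
          split_ifs at h5 hgq ⊢ <;> omega
        · simp only [twoCol] at h5 ⊢
          split_ifs at h5 ⊢ <;> omega
    · rintro (rfl | ⟨⟨h1, h2⟩, h3⟩)
      · refine ⟨⟨fun i => ?_, restr_twoCol hk _ _⟩, ?_⟩
        · simp only [twoCol]
          split_ifs <;> omega
        · rw [sum_twoCol hp (by omega)]; omega
      · refine ⟨⟨fun i => ?_, h2⟩, by omega⟩
        have h5 := h1 i
        by_cases hi : (i : ℕ) = q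
        · obtain rfl : i = ⟨q, hq⟩ := Fin.ext hi
          -- With row q empty, g would have at most 2q boxes, fewer than the required p + q + 1.
          have h6 : g ⟨q, hq⟩ ≠ 0 := by
            intro h0
            have h7 : ∑ j, g j ≤ ∑ j : Fin (m + 1), 2 * (if (j : ℕ) < q then 1 else 0) := by
              refine Finset.sum_le_sum fun j _ => ?_
              by_cases hj : (j : ℕ) < q
              · have := (h1 j).2
                simp only [twoCol] at this
                split_ifs at this ⊢ <;> omega
              · have := h2.1 (show ⟨q, hq⟩ ≤ j from Fin.le_def.2 (by simp; omega))
                omega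
            rw [← Finset.mul_sum, sum_ite_lt hq.le] at h7
            omega
          simp only [twoCol] at h5 ⊢
          split_ifs at h5 ⊢ <;> omega
        · simp only [twoCol] at h5 ⊢
          split_ifs at h5 ⊢ <;> omega

end TwoRows

/-! ### Jacobi–Trudi identities of size two and products as sums over chains -/

namespace PieriSystem

variable {R : Type*} [CommRing R] {m k : ℕ} (Q : PieriSystem R m k)

theorem c_twoRow_zero {b : ℕ} (hb : b ≤ k) : Q.c (twoRow m b 0) = Q.h b := by
  rw [PieriSystem.h, strips_hStrip_of_zero hb, Finset.sum_singleton]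

theorem c_twoCol_zero (hk : 1 ≤ k) {b : ℕ} (hb : b ≤ m + 1) : Q.c (twoCol m b 0) = Q.e b := by
  rw [← mul_one (Q.e b), ← Q.c_zero, Q.e_mul_c_eq_sum_vstrips b (restr_zero k),
    strips_vStrip_of_zero hk hb, Finset.sum_singleton]

theorem restr_twoRow_zero {b : ℕ} (hb : b ≤ k) : Restr k (twoRow m b 0) := by
  have : twoRow m b 0 ∈ strips (HStrip k) (0 : Fin (m + 1) → ℕ) b := by
    rw [strips_hStrip_of_zero hb, Finset.mem_singleton]
  exact (mem_hstrips.1 this).1.restr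

theorem c_twoRow_succ (hm : 1 ≤ m) {a b : ℕ} (hba : b + 1 ≤ a) (hak : a ≤ k) :
    Q.c (twoRow m a (b + 1)) + Q.h (a + 1) * Q.h b = Q.h a * Q.h (b + 1) := by
  rw [← Q.c_twoRow_zero (b := b + 1) (by omega), ← Q.c_twoRow_zero (b := b) (by omega),
    Q.h_mul_c _ (by omega) (restr_twoRow_zero (by omega)),
    Q.h_mul_c _ (by omega) (restr_twoRow_zero (by omega)), (strips_hStrip_twoRow hm hba hak).2,
    Finset.sum_insert (strips_hStrip_twoRow hm hba hak).1]

theorem c_twoCol_succ (hk : 2 ≤ k) {p q : ℕ} (hqp : q + 1 ≤ p) (hp : p ≤ m + 1) :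
    Q.c (twoCol m p (q + 1)) + Q.e (p + 1) * Q.e q = Q.e p * Q.e (q + 1) := by
  rw [← Q.c_twoCol_zero (b := q + 1) (by omega) (by omega),
    ← Q.c_twoCol_zero (b := q) (by omega) (by omega),
    Q.e_mul_c_eq_sum_vstrips _ (restr_twoCol hk _ _),
    Q.e_mul_c_eq_sum_vstrips _ (restr_twoCol hk _ _), (strips_vStrip_twoCol hk hqp hp).2,
    Finset.sum_insert (strips_vStrip_twoCol hk hqp hp).1]

/-- The sum of `c g` over the chains `f, η, g` with `|η| = |f| + a` and `|g| = |η| + b`. -/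
noncomputable def chainSum (S : (Fin (m + 1) → ℕ) → (Fin (m + 1) → ℕ) → Prop)
    (f : Fin (m + 1) → ℕ) (a b : ℕ) : R :=
  ∑ η ∈ strips S f a, ∑ g ∈ strips S η b, Q.c g

theorem h_mul_h_mul_c {a b : ℕ} (ha : a < m + 1 + k) (hb : b < m + 1 + k) {f : Fin (m + 1) → ℕ}
    (hf : Restr k f) : Q.h a * Q.h b * Q.c f = Q.chainSum (HStrip k) f a b := by
  rw [mul_right_comm, Q.h_mul_c a ha hf, Finset.sum_mul, chainSum]
  refine Finset.sum_congr rfl fun g hg => ?_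
  rw [mul_comm, Q.h_mul_c b hb (mem_hstrips.1 hg).1.restr]

theorem e_mul_e_mul_c (a b : ℕ) {f : Fin (m + 1) → ℕ} (hf : Restr k f) :
    Q.e a * Q.e b * Q.c f = Q.chainSum (VStrip k) f a b := by
  rw [mul_right_comm, Q.e_mul_c_eq_sum_vstrips a hf, Finset.sum_mul, chainSum]
  refine Finset.sum_congr rfl fun g hg => ?_
  rw [mul_comm, Q.e_mul_c_eq_sum_vstrips b (mem_vstrips.1 hg).1.2]

/-- The subtracted product of Jacobi–Trudi is moved to the left. It has to be switched off for b =
0, where h_(b-1) should be zero but `b - 1` truncates to 0. -/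
theorem c_twoRow_mul_c (hm : 1 ≤ m) {a b : ℕ} (hba : b ≤ a) (hak : a ≤ k)
    {f : Fin (m + 1) → ℕ} (hf : Restr k f) :
    Q.c f * Q.c (twoRow m a b) + (if b = 0 then 0 else Q.chainSum (HStrip k) f (a + 1) (b - 1)) =
      Q.chainSum (HStrip k) f a b := by
  rw [← Q.h_mul_h_mul_c (a := a) (b := b) (by omega) (by omega) hf]
  rcases b with _ | b
  · have h0 : Q.h 0 = 1 := by
      rw [PieriSystem.h, strips_hStrip_zero (restr_zero k), Finset.sum_singleton, Q.c_zero]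
    rw [if_pos rfl, Q.c_twoRow_zero hak, h0]
    ring
  · rw [if_neg (Nat.succ_ne_zero b), Nat.add_sub_cancel,
      ← Q.h_mul_h_mul_c (by omega) (by omega) hf, ← Q.c_twoRow_succ hm hba hak]
    ring

theorem c_twoCol_mul_c (hk : 2 ≤ k) {p q : ℕ} (hqp : q ≤ p) (hp : p ≤ m + 1)
    {f : Fin (m + 1) → ℕ} (hf : Restr k f) :
    Q.c f * Q.c (twoCol m p q) + (if q = 0 then 0 else Q.chainSum (VStrip k) f (p + 1) (q - 1)) =
      Q.chainSum (VStrip k) f p q := by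
  rw [← Q.e_mul_e_mul_c p q hf]
  rcases q with _ | q
  · rw [if_pos rfl, Q.c_twoCol_zero (by omega) hp, Q.e_zero]
    ring
  · rw [if_neg (Nat.succ_ne_zero q), Nat.add_sub_cancel, ← Q.e_mul_e_mul_c _ _ hf,
      ← Q.c_twoCol_succ hk hqp hp]
    ring

end PieriSystem

/-! ### Linear independence in the fusion algebra -/

section Functional

variable {n : ℕ}

/-- The indicator, with sign, of the orbit of the exponent `β` under the affine Weyl group of level
`n + k` and the translations by `(1, …, 1)`. -/
noncomputable def orbitSign (k : ℕ) (β α : Fin n → ℕ) : ℚ :=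
  Matrix.det (Matrix.of fun i j : Fin n =>
    if ((n * (n + k) : ℕ) : ℤ) ∣ n * ((α i : ℤ) - β j) + (∑ l, (β l : ℤ) - ∑ l, (α l : ℤ))
      then (1 : ℚ) else 0)

theorem orbitSign_perm (k : ℕ) (β α : Fin n → ℕ) (σ : Equiv.Perm (Fin n)) :
    orbitSign k β (fun i => α (σ i)) = (Equiv.Perm.sign σ : ℤ) * orbitSign k β α := by
  have h : ∑ l, (α (σ l) : ℤ) = ∑ l, (α l : ℤ) := Equiv.sum_comp σ fun l => (α l : ℤ)
  simp only [orbitSign, h]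
  rw [← Matrix.det_permute]
  rfl

theorem orbitSign_add_one (k : ℕ) (β α : Fin n → ℕ) :
    orbitSign k β (fun i => α i + 1) = orbitSign k β α := by
  simp only [orbitSign]
  congr 2
  funext i j
  congr 1
  push_cast
  rw [Finset.sum_add_distrib]
  simp only [Finset.sum_const, Finset.card_univ, Fintype.card_fin, nsmul_eq_mul, mul_one]
  rw [eq_iff_iff]
  apply iff_of_eq
  congr 1
  ring

/-- An affine reflection is a transposition followed by shifts of two entries by ±(n + k). The
shifts keep the total and do not change the divisibility conditions, so only the sign of the
transposition remains. -/
theorem orbitSign_reflection (k : ℕ) (β α α' : Fin n → ℕ) {a b : Fin n} (hab : a ≠ b)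
    (ha : (α' a : ℤ) = α b + (n + k)) (hb : (α' b : ℤ) = α a - (n + k))
    (h : ∀ i, i ≠ a → i ≠ b → α' i = α i) : orbitSign k β α' = -orbitSign k β α := by
  have hz : ∀ i, (α' i : ℤ) = α (Equiv.swap a b i) +
      (if i = a then (n + k : ℤ) else 0) - if i = b then (n + k : ℤ) else 0 := by
    intro i
    by_cases h1 : i = a
    · subst h1; simp [hab, ha]
    · by_cases h2 : i = b
      · subst h2; simp [h1, hb]
      · simp [h1, h2, Equiv.swap_apply_of_ne_of_ne h1 h2, h i h1 h2]
  have hsum : ∑ l, (α' l : ℤ) = ∑ l, (α l : ℤ) := by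
    simp only [hz, Finset.sum_sub_distrib, Finset.sum_add_distrib]
    rw [Equiv.sum_comp (Equiv.swap a b) fun l => (α l : ℤ)]
    simp
  have h1 := orbitSign_perm k β α (Equiv.swap a b)
  rw [Equiv.Perm.sign_swap hab] at h1
  simp only [Units.val_neg, Units.val_one, Int.cast_neg, Int.cast_one, neg_mul, one_mul] at h1
  rw [← h1]
  simp only [orbitSign]
  rw [hsum, Equiv.sum_comp (Equiv.swap a b) fun l => (α l : ℤ)]
  congr 2
  funext i j
  congr 1
  have : (n : ℤ) * ((α' i : ℤ) - β j) + (∑ l, (β l : ℤ) - ∑ l, (α l : ℤ)) =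
      (n * ((α (Equiv.swap a b i) : ℤ) - β j) + (∑ l, (β l : ℤ) - ∑ l, (α l : ℤ))) +
      ((n * (n + k) : ℕ) : ℤ) * ((if i = a then 1 else 0) - if i = b then 1 else 0) := by
    rw [hz]
    push_cast
    split_ifs <;> ring
  rw [this, eq_iff_iff, Int.dvd_add_left (dvd_mul_right _ _)]

/-- The exponent of the alternant that belongs to `f`. -/
def shifted (f : Fin n → ℕ) (j : Fin n) : ℕ := f j.rev + j

theorem shifted_strictMono {f : Fin n → ℕ} (hf : Antitone f) : StrictMono (shifted f) := by
  intro i j hij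
  have h1 := hf (Fin.rev_le_rev.2 hij.le)
  have h2 : (i : ℕ) < j := hij
  simp only [shifted]
  omega

theorem shifted_sub_lt {k : ℕ} {f : Fin n → ℕ} (hf : Restr k f) (i j : Fin n) :
    shifted f i < shifted f j + (n + k) := by
  have := hf.2 i.rev j.rev
  have := i.2
  simp only [shifted]
  omega

theorem sum_shifted (f : Fin n → ℕ) : ∑ j, shifted f j = ∑ i, f i + ∑ j : Fin n, (j : ℕ) := by
  simp only [shifted, Finset.sum_add_distrib]
  congr 1
  exact Equiv.sum_comp Fin.revPerm f

theorem shifted_injective : Function.Injective (shifted : (Fin n → ℕ) → Fin n → ℕ) := by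
  intro f g h
  funext i
  have := congrFun h i.rev
  simpa [shifted] using this

/-- An alcove is a fundamental domain: each orbit meets it at most once. The multiples of N that
relate α to β add up to zero. If they were not all zero, a positive and a negative one would force
two entries to be more than N apart. -/
theorem eq_of_perm_modEq {N : ℕ} {α β : Fin n → ℕ} (hα : StrictMono α) (hβ : StrictMono β)
    (hα' : ∀ i j, α i < α j + N) (hβ' : ∀ i j, β i < β j + N)
    (hsum : ∑ i, α i = ∑ i, β i) (σ : Equiv.Perm (Fin n))
    (h : ∀ i, (N : ℤ) ∣ (α (σ i) : ℤ) - β i) : α = β := by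
  choose v hv using h
  have hv0 : (N : ℤ) * ∑ i, v i = 0 := by
    rw [Finset.mul_sum, ← Finset.sum_congr rfl fun i _ => hv i, Finset.sum_sub_distrib,
      Equiv.sum_comp σ fun i => (α i : ℤ)]
    have : (∑ i, (α i : ℤ)) = ∑ i, (β i : ℤ) := by exact_mod_cast hsum
    rw [this, sub_self]
  have hz : ∀ i, v i = 0 := by
    intro i₀
    have hN : 0 < N := by have := hα' i₀ i₀; omega
    have hs : ∑ i, v i = 0 := by
      rcases mul_eq_zero.1 hv0 with h | h
      · omega
      · exact h
    by_contra hne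
    have hpos : ∃ i, 0 < v i := by
      by_contra! hle
      exact hne ((Finset.sum_eq_zero_iff_of_nonpos fun i _ => hle i).1 hs i₀ (Finset.mem_univ _))
    have hneg : ∃ i, v i < 0 := by
      by_contra! hle
      exact hne ((Finset.sum_eq_zero_iff_of_nonneg fun i _ => hle i).1 hs i₀ (Finset.mem_univ _))
    obtain ⟨i, hi⟩ := hpos
    obtain ⟨j, hj⟩ := hneg
    have h1 := hv i
    have h2 := hv j
    have h3 := hα' (σ i) (σ j)
    have h4 := hβ' j i
    have h5 : (N : ℤ) * 1 ≤ N * v i := mul_le_mul_of_nonneg_left hi (by positivity)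
    have h6 : (N : ℤ) * v j ≤ N * (-1) := mul_le_mul_of_nonneg_left (by omega) (by positivity)
    omega
  have h1 : ∀ i, α (σ i) = β i := by
    intro i
    have := hv i
    rw [hz i, mul_zero, sub_eq_zero] at this
    exact_mod_cast this
  apply (hα.range_inj hβ).1
  ext x
  simp only [Set.mem_range]
  constructor
  · rintro ⟨i, rfl⟩
    exact ⟨σ.symm i, by rw [← h1, Equiv.apply_symm_apply]⟩
  · rintro ⟨i, rfl⟩
    exact ⟨σ i, h1 i⟩

theorem orbitSign_shifted {k : ℕ} {f g : Fin n → ℕ} (hf : Restr k f) (hg : Restr k g)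
    (hsum : ∑ i, f i = ∑ i, g i) :
    orbitSign k (shifted f) (shifted g) = if f = g then 1 else 0 := by
  rcases Nat.eq_zero_or_pos n with rfl | hn
  · rw [if_pos (Subsingleton.elim _ _), orbitSign, Matrix.det_isEmpty]
  have hs : ∑ i, shifted g i = ∑ i, shifted f i := by rw [sum_shifted, sum_shifted, hsum]
  have hs' : ∑ i, (shifted f i : ℤ) - ∑ i, (shifted g i : ℤ) = 0 := by
    rw [sub_eq_zero]
    exact_mod_cast hs.symm
  have hdvd : ∀ x : ℤ, ((n * (n + k) : ℕ) : ℤ) ∣ n * x + 0 ↔ ((n + k : ℕ) : ℤ) ∣ x := by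
    intro x
    rw [add_zero, Nat.cast_mul]
    exact mul_dvd_mul_iff_left (by exact_mod_cast hn.ne')
  simp only [orbitSign, hs', hdvd]
  split_ifs with hfg
  · subst hfg
    refine Eq.trans (congrArg Matrix.det ?_) (Matrix.det_one (n := Fin n) (R := ℚ))
    ext i j
    simp only [Matrix.of_apply, Matrix.one_apply]
    congr 1
    rw [eq_iff_iff]
    constructor
    · intro h
      have h1 := shifted_sub_lt hf i j
      have h2 := shifted_sub_lt hf j i
      apply (shifted_strictMono hf.1).injective
      have := Int.eq_zero_of_abs_lt_dvd h (by rw [abs_lt]; push_cast; constructor <;> omega)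
      omega
    · rintro rfl
      simp
  · rw [Matrix.det_apply]
    refine Finset.sum_eq_zero fun σ _ => ?_
    by_cases h : ∀ i, ((n + k : ℕ) : ℤ) ∣ (shifted g (σ i) : ℤ) - shifted f i
    · exact absurd (shifted_injective (eq_of_perm_modEq (shifted_strictMono hg.1)
        (shifted_strictMono hf.1) (shifted_sub_lt hg) (shifted_sub_lt hf) hs σ h)).symm hfg
    · push Not at h
      obtain ⟨i, hi⟩ := h
      rw [Finset.prod_eq_zero (Finset.mem_univ i), smul_zero]
      rw [Matrix.of_apply, if_neg hi]

/-- The linear extension of `orbitSign` to polynomials. -/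
noncomputable def orbitFunctional (k : ℕ) (β : Fin n → ℕ) : MvPolynomial (Fin n) ℚ →ₗ[ℚ] ℚ :=
  (basisMonomials (Fin n) ℚ).constr ℚ fun s => orbitSign k β s

theorem orbitFunctional_monomial (k : ℕ) (β : Fin n → ℕ) (s : Fin n →₀ ℕ) :
    orbitFunctional k β (monomial s 1) = orbitSign k β s := by
  have := (basisMonomials (Fin n) ℚ).constr_basis ℚ (fun s => orbitSign k β s) s
  rwa [coe_basisMonomials] at this

theorem linearMap_ext_monomial {φ ψ : MvPolynomial (Fin n) ℚ →ₗ[ℚ] ℚ}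
    (h : ∀ s, φ (monomial s 1) = ψ (monomial s 1)) : φ = ψ := by
  apply (basisMonomials (Fin n) ℚ).ext
  intro s
  rw [coe_basisMonomials]
  exact h s

theorem orbitFunctional_rename (k : ℕ) (β : Fin n → ℕ) (σ : Equiv.Perm (Fin n))
    (p : MvPolynomial (Fin n) ℚ) :
    orbitFunctional k β (rename σ p) = (Equiv.Perm.sign σ : ℤ) * orbitFunctional k β p := by
  have : (orbitFunctional k β).comp (rename (R := ℚ) σ).toLinearMap =
      ((Equiv.Perm.sign σ : ℤ) : ℚ) • orbitFunctional k β := by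
    apply linearMap_ext_monomial
    intro s
    simp only [LinearMap.comp_apply, AlgHom.toLinearMap_apply, rename_monomial,
      orbitFunctional_monomial, LinearMap.smul_apply, smul_eq_mul]
    have h1 : ⇑(Finsupp.mapDomain σ s) = fun i => s (σ.symm i) := by
      funext i
      rw [Finsupp.mapDomain_equiv_apply]
    rw [h1, orbitSign_perm, Equiv.Perm.sign_symm]
  exact DFunLike.congr_fun this p

theorem orbitFunctional_mul_prod (k : ℕ) (β : Fin n → ℕ) (p : MvPolynomial (Fin n) ℚ) :
    orbitFunctional k β (p * ∏ i, X i) = orbitFunctional k β p := by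
  have : (orbitFunctional k β).comp (LinearMap.mulRight ℚ (∏ i, X i)) = orbitFunctional k β := by
    apply linearMap_ext_monomial
    intro s
    have h1 : (∏ i, X i : MvPolynomial (Fin n) ℚ) =
        monomial (Finsupp.equivFunOnFinite.symm fun _ => 1) 1 := by
      rw [monomial_eq, Finsupp.prod_fintype _ _ (fun i => pow_zero _)]
      simp
    rw [LinearMap.comp_apply, LinearMap.mulRight_apply, h1, monomial_mul, one_mul,
      orbitFunctional_monomial, orbitFunctional_monomial, ← orbitSign_add_one k β s]
    rfl
  exact DFunLike.congr_fun this p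

/-- The monomial with exponent `α`. -/
noncomputable def mono (α : Fin n → ℕ) : MvPolynomial (Fin n) ℚ := ∏ i, X i ^ α i

theorem mono_eq_monomial (α : Fin n → ℕ) :
    mono α = monomial (Finsupp.equivFunOnFinite.symm α) 1 := by
  rw [monomial_eq, Finsupp.prod_fintype _ _ (fun i => pow_zero _)]
  simp [mono]

/-- The sign of a permutation in the determinant cancels the sign picked up by the functional, so
all n! terms contribute equally. -/
theorem orbitFunctional_mul_alternant (k : ℕ) (β : Fin n → ℕ)
    (g : symmetricSubalgebra (Fin n) ℚ) (α : Fin n → ℕ) :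
    orbitFunctional k β (g * alternant α) = n.factorial * orbitFunctional k β (g * mono α) := by
  have h : ∀ σ : Equiv.Perm (Fin n), (g : MvPolynomial (Fin n) ℚ) *
      (Equiv.Perm.sign σ • ∏ i, (X (σ i) ^ α i : MvPolynomial (Fin n) ℚ)) =
      ((Equiv.Perm.sign σ : ℤ) : ℚ) • rename σ ((g : MvPolynomial (Fin n) ℚ) * mono α) := by
    intro σ
    rw [map_mul, (mem_symmetricSubalgebra _).1 g.2 σ, mul_smul_comm, mono, map_prod]
    simp only [map_pow, rename_X, Units.smul_def]
    rw [Int.cast_smul_eq_zsmul]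
  rw [alternant_eq_sum, Finset.mul_sum, map_sum]
  simp only [h, map_smul, orbitFunctional_rename, smul_eq_mul, ← mul_assoc]
  have h2 : ∀ σ : Equiv.Perm (Fin n),
      ((Equiv.Perm.sign σ : ℤ) : ℚ) * ((Equiv.Perm.sign σ : ℤ) : ℚ) = 1 := by
    intro σ
    rw [← Int.cast_mul, ← Units.val_mul, Int.units_mul_self]
    simp
  simp only [h2, one_mul, Finset.sum_const, Finset.card_univ, Fintype.card_perm, Fintype.card_fin,
    nsmul_eq_mul]

/-- The exponent α is fixed by an affine reflection. Applying the underlying transposition to g,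
which is symmetric, therefore shows that the value equals its own negative. -/
theorem orbitFunctional_mul_mono_eq_zero (k : ℕ) (β : Fin n → ℕ)
    (g : symmetricSubalgebra (Fin n) ℚ) {α : Fin n → ℕ} {a b : Fin n} (hab : a ≠ b)
    (h : α a = α b + (n + k)) : orbitFunctional k β (g * mono α) = 0 := by
  have : (orbitFunctional k β).comp ((LinearMap.mulRight ℚ (mono α)).comp
      (rename (R := ℚ) (Equiv.swap a b)).toLinearMap) =
      -(orbitFunctional k β).comp (LinearMap.mulRight ℚ (mono α)) := by
    apply linearMap_ext_monomial
    intro s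
    simp only [LinearMap.comp_apply, AlgHom.toLinearMap_apply, rename_monomial,
      LinearMap.mulRight_apply, LinearMap.neg_apply, mono_eq_monomial, monomial_mul, one_mul,
      orbitFunctional_monomial]
    have h1 : ∀ i, Finsupp.mapDomain (Equiv.swap a b) s i = s (Equiv.swap a b i) := by
      intro i
      rw [Finsupp.mapDomain_equiv_apply, Equiv.symm_swap]
    apply orbitSign_reflection k β _ _ hab
    · simp only [Finsupp.add_apply, h1, Equiv.swap_apply_left, Finsupp.equivFunOnFinite_symm_apply_apply]
      push_cast [h]
      ring
    · simp only [Finsupp.add_apply, h1, Equiv.swap_apply_right, Finsupp.equivFunOnFinite_symm_apply_apply]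
      push_cast [h]
      ring
    · intro i hi hi'
      simp only [Finsupp.add_apply, h1, Equiv.swap_apply_of_ne_of_ne hi hi']
  have h2 := DFunLike.congr_fun this (g : MvPolynomial (Fin n) ℚ)
  simp only [LinearMap.comp_apply, AlgHom.toLinearMap_apply, LinearMap.mulRight_apply,
    LinearMap.neg_apply, (mem_symmetricSubalgebra _).1 g.2 (Equiv.swap a b)] at h2
  linarith

theorem schur_column_mul_vandermonde (n : ℕ) :
    (schur n (column n) : MvPolynomial (Fin n) ℚ) * (alternant fun j : Fin n => (j : ℕ)) =
      (alternant fun j : Fin n => (j : ℕ)) * ∏ i, X i := by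
  have hrow : ∀ i : Fin n, (column n).rowLen i = 1 := by
    intro i
    apply eq_of_forall_lt_iff
    intro b
    rw [← YoungDiagram.mem_iff_lt_rowLen, ← YoungDiagram.mem_cells]
    simp [column, eq_comm]
  rw [schur_mul_vandermonde]
  simp only [hrow, alternant_eq_sum, Finset.sum_mul]
  refine Finset.sum_congr rfl fun σ _ => ?_
  rw [smul_mul_assoc, ← Equiv.prod_comp σ (fun i => X i), ← Finset.prod_mul_distrib]
  congr 1
  refine Finset.prod_congr rfl fun i _ => ?_
  rw [pow_add, pow_one, mul_comm]

/-- For λ_1 - λ_n = k + 1 the extreme exponents of the alternant differ by (k + 1) + (n - 1) = n +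
k, so it lies on the affine wall; s_(1^n) acts as the product of the variables, to which the
functional is blind. The factor g is carried along so that the induction over the ideal closes under
multiplication. -/
theorem orbitFunctional_eq_zero (hn : 0 < n) (k : ℕ) (β : Fin n → ℕ)
    {f : symmetricSubalgebra (Fin n) ℚ} (hf : f ∈ fusionIdeal n k) :
    ∀ g : symmetricSubalgebra (Fin n) ℚ, orbitFunctional k β
      ((g : MvPolynomial (Fin n) ℚ) * f * alternant fun j : Fin n => (j : ℕ)) = 0 := by
  refine Submodule.span_induction ?_ ?_ ?_ ?_ hf
  · rintro f (⟨lam, h1, h2, rfl⟩ | rfl) g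
    · rw [mul_assoc, schur_mul_vandermonde, orbitFunctional_mul_alternant,
        orbitFunctional_mul_mono_eq_zero (a := ⟨n - 1, by omega⟩) (b := ⟨0, hn⟩), mul_zero]
      -- The first and last rows coincide only for n = 1, and then λ_1 - λ_n = k + 1 is impossible.
      · intro h
        have : n = 1 := by have := Fin.ext_iff.1 h; simp at this; omega
        subst this
        simp at h2
      · simp only [Fin.val_rev]
        rw [show n - (n - 1 + 1) = 0 by omega, show n - (0 + 1) = n - 1 by omega, h2]
        omega
    · rw [AddSubgroupClass.coe_sub, OneMemClass.coe_one, mul_sub, sub_mul, mul_one, map_sub,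
        mul_assoc, schur_column_mul_vandermonde, ← mul_assoc, orbitFunctional_mul_prod, sub_self]
  · intro g
    simp
  · intro x y _ _ hx hy g
    rw [AddMemClass.coe_add, mul_add, add_mul, map_add, hx, hy, add_zero]
  · intro r x _ hx g
    have := hx (g * r)
    rw [MulMemClass.coe_mul] at this
    rw [smul_eq_mul, MulMemClass.coe_mul, ← mul_assoc]
    exact this

end Functional

/-- The difference of two expansions is a combination of Schur polynomials of one fixed size in the
ideal. Multiplied by the Vandermonde determinant, it is sent by the functional of ν to n! times the
coefficient at ν. -/
theorem isFusionExpansion_unique {n k : ℕ} (hn : 0 < n) {lam mu : YoungDiagram}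
    {N N' : YoungDiagram →₀ ℚ} (h : IsFusionExpansion n k lam mu N)
    (h' : IsFusionExpansion n k lam mu N') : N = N' := by
  classical
  rw [← sub_eq_zero]
  set M := N - N' with hM
  have hsupp : ∀ nu ∈ M.support, IsRestricted n k nu ∧ nu.card = lam.card + mu.card := by
    intro nu hnu
    rcases Finset.mem_union.1 (Finsupp.support_sub hnu) with h1 | h1
    · exact h.1 nu h1
    · exact h'.1 nu h1
  have hmem : M.linearCombination ℚ (schur n) ∈ fusionIdeal n k := by
    rw [← Ideal.Quotient.eq_zero_iff_mem, ← Ideal.Quotient.mkₐ_eq_mk ℚ]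
    have h1 : ∀ L : YoungDiagram →₀ ℚ, Ideal.Quotient.mkₐ ℚ (fusionIdeal n k)
        (Finsupp.linearCombination ℚ (schur n) L) = L.sum fun nu c => c • schurClass n k nu := by
      intro L
      rw [Finsupp.linearCombination_apply, map_finsuppSum]
      simp only [map_smul]
      rfl
    rw [hM, map_sub, map_sub, h1, h1, ← h.2, ← h'.2, sub_self]
  ext nu
  by_contra hne
  have hnu := hsupp nu (Finsupp.mem_support_iff.2 hne)
  have hr := (isRestricted_iff hn).1 hnu.1
  have h2 := orbitFunctional_eq_zero hn k (shifted (rows n nu)) hmem 1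
  rw [OneMemClass.coe_one, one_mul, Finsupp.linearCombination_apply, Finsupp.sum] at h2
  rw [AddSubmonoidClass.coe_finsetSum, Finset.sum_mul, map_sum, Finset.sum_eq_single nu] at h2
  · have h3 := orbitFunctional_mul_alternant k (shifted (rows n nu)) 1 (shifted (rows n nu))
    rw [OneMemClass.coe_one, one_mul, one_mul, mono_eq_monomial, orbitFunctional_monomial] at h3
    have h4 := orbitSign_shifted hr.2 hr.2 rfl
    rw [if_pos rfl] at h4
    rw [SetLike.val_smul, smul_mul_assoc, schur_mul_vandermonde, map_smul] at h2
    change _ • orbitFunctional k _ (alternant (shifted (rows n nu))) = 0 at h2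
    rw [h3] at h2
    change _ • ((n.factorial : ℚ) * orbitSign k _ (shifted (rows n nu))) = 0 at h2
    rw [h4, mul_one, smul_eq_mul] at h2
    rcases mul_eq_zero.1 h2 with h5 | h5
    · exact hne h5
    · exact absurd (by exact_mod_cast h5) (Nat.factorial_ne_zero n)
  · intro mu' hmu' hne'
    have hmu := hsupp mu' hmu'
    have hr' := (isRestricted_iff hn).1 hmu.1
    have h3 := orbitFunctional_mul_alternant k (shifted (rows n nu)) 1 (shifted (rows n mu'))
    rw [OneMemClass.coe_one, one_mul, one_mul, mono_eq_monomial, orbitFunctional_monomial] at h3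
    have h4 := orbitSign_shifted hr.2 hr'.2 (by
      rw [← card_eq_sum_rows hr.1, ← card_eq_sum_rows hr'.1, hnu.2, hmu.2])
    rw [if_neg fun e => hne' (rows_injective hr.1 hr'.1 e).symm] at h4
    rw [SetLike.val_smul, smul_mul_assoc, schur_mul_vandermonde, map_smul]
    change _ • orbitFunctional k _ (alternant (shifted (rows n mu'))) = 0
    rw [h3]
    change _ • ((n.factorial : ℚ) * orbitSign k _ (shifted (rows n mu'))) = 0
    rw [h4, mul_zero, smul_zero]
  · exact fun h => absurd (Finsupp.mem_support_iff.2 hne) h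

/-! ### Fusion coefficients as differences of numbers of chains -/

theorem schurFun_eq_zero_of_succ {m : ℕ} {f : Fin (m + 1) → ℕ} {i : Fin m}
    (h : f i.succ = f i.castSucc + 1) : schurFun f = 0 := by
  apply schurFun_eq_zero (i := i.castSucc) (j := i.succ) i.castSucc_lt_succ.ne
  rw [h]
  simp

/-- The classes of the Schur polynomials and of the elementary symmetric polynomials in the fusion
algebra. -/
noncomputable def fusionSystem (m k : ℕ) : PieriSystem (FusionAlgebra (m + 1) k) m k where
  c f := Ideal.Quotient.mk (fusionIdeal (m + 1) k) (schurFun f)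
  e p := Ideal.Quotient.mk (fusionIdeal (m + 1) k) (elem (m + 1) p)
  c_zero := by rw [schurFun_zero, map_one]
  e_zero := by
    have : elem (m + 1) 0 = 1 := by
      apply Subtype.ext
      rw [OneMemClass.coe_one]
      exact esymm_zero (Fin (m + 1)) ℚ
    rw [this, map_one]
  e_mul_c p f := by rw [← map_mul, elem_mul_schurFun, map_sum]
  c_eq_zero_of_succ f i h := by rw [schurFun_eq_zero_of_succ h, map_zero]
  c_eq_zero_of_gap f hf h := by
    rw [Ideal.Quotient.eq_zero_iff_mem]
    refine Ideal.subset_span (Or.inl ⟨toDiagram f, colLen_toDiagram_le f, ?_, ?_⟩)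
    · have h0 := rowLen_toDiagram hf 0
      have h1 := rowLen_toDiagram hf (Fin.last m)
      simp only [Fin.val_zero, Fin.val_last, Nat.add_sub_cancel] at h0 h1 ⊢
      rw [h0, h1, h]
    · rw [schur_eq_schurFun, rows_toDiagram hf]

theorem schurClass_eq (m k : ℕ) (lam : YoungDiagram) :
    schurClass (m + 1) k lam = (fusionSystem m k).c (rows (m + 1) lam) := rfl

open Classical in
/-- The intermediate terms `η` of the chains `f, η, g` with `|η| = |f| + a`. -/
noncomputable def chains {n : ℕ} (S : (Fin n → ℕ) → (Fin n → ℕ) → Prop) (f g : Fin n → ℕ) (a : ℕ) :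
    Finset (Fin n → ℕ) :=
  {η ∈ strips S f a | S η g}

/-- The expansion of `chainSum`. -/
noncomputable def chainExpansion {n : ℕ} (S : (Fin n → ℕ) → (Fin n → ℕ) → Prop) (f : Fin n → ℕ)
    (a b : ℕ) : YoungDiagram →₀ ℚ :=
  ∑ η ∈ strips S f a, ∑ g ∈ strips S η b, Finsupp.single (toDiagram g) 1

/-! ### Existence of the expansions and their coefficients as differences of chain counts -/

section Expansion

variable {m k : ℕ} {S : (Fin (m + 1) → ℕ) → (Fin (m + 1) → ℕ) → Prop}

theorem chainExpansion_apply (hS : ∀ f g, S f g → ∀ i, f i ≤ g i)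
    (hS' : ∀ f g, S f g → Restr k g) {f : Fin (m + 1) → ℕ} {a b : ℕ} {nu : YoungDiagram}
    (hnu : nu.colLen 0 ≤ m + 1) :
    chainExpansion S f a b nu = if nu.card = ∑ i, f i + (a + b) then
      ((chains S f (rows (m + 1) nu) a).card : ℚ) else 0 := by
  classical
  have h1 : ∀ η ∈ strips S f a, (∑ g ∈ strips S η b, Finsupp.single (toDiagram g) (1 : ℚ)) nu =
      if S η (rows (m + 1) nu) ∧ nu.card = ∑ i, f i + (a + b) then 1 else 0 := by
    intro η hη
    rw [mem_strips (hS _ _)] at hη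
    have h2 : ∀ g ∈ strips S η b, Finsupp.single (toDiagram g) (1 : ℚ) nu =
        if rows (m + 1) nu = g then 1 else 0 := by
      intro g hg
      rw [mem_strips (hS _ _)] at hg
      rw [Finsupp.single_apply]
      congr 1
      rw [eq_iff_iff]
      constructor
      · rintro rfl
        exact rows_toDiagram (hS' _ _ hg.1).1
      · rintro rfl
        exact toDiagram_rows hnu
    rw [Finsupp.finsetSum_apply, Finset.sum_congr rfl h2, Finset.sum_ite_eq]
    simp only [mem_strips (hS _ _), ← card_eq_sum_rows hnu, hη.2, add_assoc]
  rw [chainExpansion, Finsupp.finsetSum_apply, Finset.sum_congr rfl h1]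
  by_cases hc : nu.card = ∑ i, f i + (a + b)
  · simp only [hc, and_true, if_true]
    rw [Finset.sum_boole, chains]
  · simp [hc]

theorem chainExpansion_support (hS : ∀ f g, S f g → ∀ i, f i ≤ g i)
    (hS' : ∀ f g, S f g → Restr k g) {f : Fin (m + 1) → ℕ} {a b : ℕ} {nu : YoungDiagram}
    (hnu : chainExpansion S f a b nu ≠ 0) :
    IsRestricted (m + 1) k nu ∧ nu.card = ∑ i, f i + (a + b) := by
  rw [chainExpansion, Finsupp.finsetSum_apply] at hnu
  obtain ⟨η, hη, h1⟩ := Finset.exists_ne_zero_of_sum_ne_zero hnu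
  rw [Finsupp.finsetSum_apply] at h1
  obtain ⟨g, hg, h2⟩ := Finset.exists_ne_zero_of_sum_ne_zero h1
  rw [mem_strips (hS _ _)] at hη hg
  have hr := hS' _ _ hg.1
  have h3 : toDiagram g = nu := by
    by_contra h
    exact h2 (Finsupp.single_eq_of_ne (Ne.symm h))
  rw [← h3]
  exact ⟨isRestricted_toDiagram (Nat.succ_pos m) hr, by rw [card_toDiagram hr.1]; omega⟩

theorem linearCombination_chainExpansion (hS : ∀ f g, S f g → ∀ i, f i ≤ g i)
    (hS' : ∀ f g, S f g → Restr k g) (f : Fin (m + 1) → ℕ) (a b : ℕ) :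
    Finsupp.linearCombination ℚ (schurClass (m + 1) k) (chainExpansion S f a b) =
      (fusionSystem m k).chainSum S f a b := by
  rw [chainExpansion, map_sum, PieriSystem.chainSum]
  refine Finset.sum_congr rfl fun η _ => ?_
  rw [map_sum]
  refine Finset.sum_congr rfl fun g hg => ?_
  rw [mem_strips (hS _ _)] at hg
  rw [Finsupp.linearCombination_single, one_smul, schurClass_eq,
    rows_toDiagram (hS' _ _ hg.1).1]

theorem chains_eq_empty (hS : ∀ f g, S f g → ∀ i, f i ≤ g i) {f g : Fin (m + 1) → ℕ} {a : ℕ}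
    (h : ∑ i, g i < ∑ i, f i + a) : chains S f g a = ∅ := by
  rw [Finset.eq_empty_iff_forall_notMem]
  intro η hη
  simp only [chains, Finset.mem_filter, mem_strips (hS _ _)] at hη
  have : ∑ i, η i ≤ ∑ i, g i := Finset.sum_le_sum fun i _ => hS _ _ hη.2 i
  omega

theorem exists_expansion (hS : ∀ f g, S f g → ∀ i, f i ≤ g i)
    (hS' : ∀ f g, S f g → Restr k g) {lam mu : YoungDiagram} {a b : ℕ}
    (hlam : IsRestricted (m + 1) k lam) (hmu : mu.card = a + b)
    (h : (fusionSystem m k).c (rows (m + 1) lam) * (fusionSystem m k).c (rows (m + 1) mu) +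
      (if b = 0 then 0 else (fusionSystem m k).chainSum S (rows (m + 1) lam) (a + 1) (b - 1)) =
      (fusionSystem m k).chainSum S (rows (m + 1) lam) a b) :
    ∃ N, IsFusionExpansion (m + 1) k lam mu N ∧ ∀ nu, nu.colLen 0 ≤ m + 1 →
      N nu = if nu.card = lam.card + mu.card then
        ((chains S (rows (m + 1) lam) (rows (m + 1) nu) a).card : ℚ) -
          (chains S (rows (m + 1) lam) (rows (m + 1) nu) (a + 1)).card else 0 := by
  set f := rows (m + 1) lam with hf
  have hfc : lam.card = ∑ i, f i := card_eq_sum_rows hlam.1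
  refine ⟨chainExpansion S f a b - if b = 0 then 0 else chainExpansion S f (a + 1) (b - 1),
    ⟨?_, ?_⟩, ?_⟩
  · intro nu hnu
    rw [Finsupp.mem_support_iff, Finsupp.sub_apply] at hnu
    rw [hmu, hfc]
    by_cases h1 : chainExpansion S f a b nu = 0
    · by_cases hb : b = 0
      · simp [hb] at hnu
        simp [hb] at h1
        exact absurd h1 hnu
      · rw [if_neg hb, h1, zero_sub, neg_ne_zero] at hnu
        have := chainExpansion_support hS hS' hnu
        exact ⟨this.1, by omega⟩
    · exact chainExpansion_support hS hS' h1
  · have h1 : ∀ N : YoungDiagram →₀ ℚ, (N.sum fun nu c => c • schurClass (m + 1) k nu) =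
        Finsupp.linearCombination ℚ (schurClass (m + 1) k) N := fun N => rfl
    rw [h1, map_sub, linearCombination_chainExpansion hS hS', ← h, schurClass_eq, schurClass_eq]
    by_cases hb : b = 0
    · simp [hb, hf]
    · rw [if_neg hb, if_neg hb, linearCombination_chainExpansion hS hS', add_sub_cancel_right]
  · intro nu hnu
    rw [Finsupp.sub_apply, chainExpansion_apply hS hS' hnu, hmu, hfc]
    by_cases hb : b = 0
    · subst hb
      by_cases hc : nu.card = ∑ i, f i + (a + 0)
      -- For b = 0 the second count needs no switch: an intermediate term of size |λ| + a + 1 would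
      -- be larger than ν.
      · rw [if_pos hc, if_pos hc, chains_eq_empty hS (a := a + 1)]
        · simp
        · rw [← card_eq_sum_rows hnu]
          omega
      · rw [if_neg hc, if_neg hc]
        simp
    · rw [if_neg hb, chainExpansion_apply hS hS' hnu, show a + 1 + (b - 1) = a + b by omega]
      split_ifs <;> simp

theorem fusionCoeff_eq_of_isFusionExpansion {n k : ℕ} (hn : 0 < n) {lam mu : YoungDiagram}
    {N : YoungDiagram →₀ ℚ} (h : IsFusionExpansion n k lam mu N) (nu : YoungDiagram) :
    fusionCoeff n k lam mu nu = N nu := by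
  have he : ∃ N, IsFusionExpansion n k lam mu N := ⟨N, h⟩
  rw [fusionCoeff, dif_pos he, isFusionExpansion_unique hn he.choose_spec h]

theorem fusionCoeff_eq_chains (hS : ∀ f g, S f g → ∀ i, f i ≤ g i)
    (hS' : ∀ f g, S f g → Restr k g) {lam mu : YoungDiagram} {a b : ℕ}
    (hlam : IsRestricted (m + 1) k lam) (hmu : mu.card = a + b)
    (h : (fusionSystem m k).c (rows (m + 1) lam) * (fusionSystem m k).c (rows (m + 1) mu) +
      (if b = 0 then 0 else (fusionSystem m k).chainSum S (rows (m + 1) lam) (a + 1) (b - 1)) =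
      (fusionSystem m k).chainSum S (rows (m + 1) lam) a b) :
    (∃! N, IsFusionExpansion (m + 1) k lam mu N) ∧ ∀ nu, nu.colLen 0 ≤ m + 1 →
      fusionCoeff (m + 1) k lam mu nu = if nu.card = lam.card + mu.card then
        ((chains S (rows (m + 1) lam) (rows (m + 1) nu) a).card : ℚ) -
          (chains S (rows (m + 1) lam) (rows (m + 1) nu) (a + 1)).card else 0 := by
  obtain ⟨N, h1, h2⟩ := exists_expansion hS hS' hlam hmu h
  refine ⟨⟨N, h1, fun N' h' => isFusionExpansion_unique (Nat.succ_pos m) h' h1⟩, fun nu hnu => ?_⟩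
  rw [fusionCoeff_eq_of_isFusionExpansion (Nat.succ_pos m) h1, h2 nu hnu]

end Expansion

/-- Fusion coefficients for a partition with at most two rows. -/
theorem fusionCoeff_twoRow {m k a b : ℕ} (hm : 1 ≤ m) (hba : b ≤ a) (hak : a ≤ k)
    {lam mu : YoungDiagram} (hlam : IsRestricted (m + 1) k lam) (hmu : mu.colLen 0 ≤ m + 1)
    (hmu' : rows (m + 1) mu = twoRow m a b) :
    (∃! N, IsFusionExpansion (m + 1) k lam mu N) ∧ ∀ nu, nu.colLen 0 ≤ m + 1 →
      fusionCoeff (m + 1) k lam mu nu = if nu.card = lam.card + mu.card then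
        ((chains (HStrip k) (rows (m + 1) lam) (rows (m + 1) nu) a).card : ℚ) -
          (chains (HStrip k) (rows (m + 1) lam) (rows (m + 1) nu) (a + 1)).card else 0 := by
  apply fusionCoeff_eq_chains (b := b) (fun f g h => h.1) (fun f g h => h.restr) hlam
  · rw [card_eq_sum_rows hmu, hmu', sum_twoRow hm]
  · rw [hmu']
    exact (fusionSystem m k).c_twoRow_mul_c hm hba hak ((isRestricted_iff (Nat.succ_pos m)).1 hlam).2

/-- Fusion coefficients for a partition with at most two columns. -/
theorem fusionCoeff_twoCol {m k p q : ℕ} (hk : 2 ≤ k) (hqp : q ≤ p) (hp : p ≤ m + 1)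
    {lam mu : YoungDiagram} (hlam : IsRestricted (m + 1) k lam) (hmu : mu.colLen 0 ≤ m + 1)
    (hmu' : rows (m + 1) mu = twoCol m p q) :
    (∃! N, IsFusionExpansion (m + 1) k lam mu N) ∧ ∀ nu, nu.colLen 0 ≤ m + 1 →
      fusionCoeff (m + 1) k lam mu nu = if nu.card = lam.card + mu.card then
        ((chains (VStrip k) (rows (m + 1) lam) (rows (m + 1) nu) p).card : ℚ) -
          (chains (VStrip k) (rows (m + 1) lam) (rows (m + 1) nu) (p + 1)).card else 0 := by
  apply fusionCoeff_eq_chains (b := q) (fun f g h i => (h.1 i).1) (fun f g h => h.2) hlam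
  · rw [card_eq_sum_rows hmu, hmu', sum_twoCol hp (hqp.trans hp)]
  · rw [hmu']
    exact (fusionSystem m k).c_twoCol_mul_c hk hqp hp ((isRestricted_iff (Nat.succ_pos m)).1 hlam).2

/-! ### Rank-level duality -/

section Duality

variable {n k : ℕ}

/-- The row lengths of the dual of the partition with row lengths `f`. -/
def dualFn (k : ℕ) (f : Fin n → ℕ) (i : Fin k) : ℕ := ∑ r, (f r + (k - 1 - i)) / k

/-- Hermite's identity. The i-th summand counts the columns congruent to i modulo k in a row of
length x, so this says that dualising keeps the size. -/
theorem sum_add_div (hk : 0 < k) (x : ℕ) : ∑ i : Fin k, (x + (k - 1 - i)) / k = x := by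
  rw [Fin.sum_univ_eq_sum_range (fun i => (x + (k - 1 - i)) / k),
    Finset.sum_range_reflect (fun i => (x + i) / k)]
  induction x with
  | zero =>
    refine Finset.sum_eq_zero fun i hi => ?_
    rw [zero_add, Nat.div_eq_of_lt (Finset.mem_range.1 hi)]
  | succ x ih =>
    have h1 := Finset.sum_range_succ (fun i => (x + i) / k) k
    rw [Finset.sum_range_succ', ih, Nat.add_div_right _ hk, add_zero] at h1
    have h2 : ∑ i ∈ Finset.range k, (x + 1 + i) / k = ∑ i ∈ Finset.range k, (x + (i + 1)) / k :=
      Finset.sum_congr rfl fun i _ => by rw [add_assoc, add_comm 1 i]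
    rw [h2]
    omega

theorem sum_dualFn (hk : 0 < k) (f : Fin n → ℕ) : ∑ i, dualFn k f i = ∑ r, f r := by
  simp only [dualFn]
  rw [Finset.sum_comm]
  exact Finset.sum_congr rfl fun r _ => sum_add_div hk (f r)

theorem restr_dualFn (hk : 0 < k) (f : Fin n → ℕ) : Restr n (dualFn k f) := by
  constructor
  · intro i j hij
    have : (i : ℕ) ≤ j := hij
    exact Finset.sum_le_sum fun r _ => Nat.div_le_div_right (by omega)
  · intro i j
    have h1 : ∑ r, ((f r + (k - 1 - j)) / k + 1) = dualFn k f j + n := by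
      simp [dualFn, Finset.sum_add_distrib]
    rw [← h1]
    refine Finset.sum_le_sum fun r _ => ?_
    rw [← Nat.add_div_right _ hk]
    exact Nat.div_le_div_right (by omega)

/-- A weakly decreasing sequence of n integers that takes at most two consecutive values is
determined by its sum, and rounded division recovers each entry. This is the mechanism behind the
inversion of duality. -/
theorem sum_add_div_eq {a : Fin n → ℕ} (ha : Antitone a) (ha' : ∀ r s, a r ≤ a s + 1)
    (r : Fin n) : (∑ s, a s + (n - 1 - r)) / n = a r := by
  have hr := r.2
  have h1 : ∑ s : Fin n, (if r < s then 1 else 0) = n - 1 - r := by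
    rw [Finset.sum_boole]
    have : ({s | r < s} : Finset (Fin n)) = Finset.Ioi r := by ext; simp
    rw [this]
    simp
  have h2 : ∑ s : Fin n, (if s < r then 1 else 0) = (r : ℕ) := by
    rw [Finset.sum_boole]
    have : ({s | s < r} : Finset (Fin n)) = Finset.Iio r := by ext; simp
    rw [this]
    simp
  have h3 : ∑ s : Fin n, a r ≤ ∑ s, (a s + if r < s then 1 else 0) := by
    refine Finset.sum_le_sum fun s _ => ?_
    split_ifs with h
    · exact ha' r s
    · exact ha (not_lt.1 h)
  have h4 : ∑ s, a s ≤ ∑ s : Fin n, (a r + if s < r then 1 else 0) := by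
    refine Finset.sum_le_sum fun s _ => ?_
    split_ifs with h
    · exact ha' s r
    · exact ha (not_lt.1 h)
  rw [Finset.sum_add_distrib, h1] at h3
  rw [Finset.sum_add_distrib, h2] at h4
  simp only [Finset.sum_const, Finset.card_univ, Fintype.card_fin, smul_eq_mul] at h3 h4
  apply Nat.div_eq_of_lt_le
  · rw [mul_comm]
    exact h3
  · rw [add_mul, mul_comm, one_mul]
    omega

/-- Restrictedness makes the contributions of the rows of f to one dual row differ by at most one.
Thus the contribution of row r to dual row i equals that of dual row i to row r of the double dual.
-/
theorem dualFn_add_div (hk : 0 < k) {f : Fin n → ℕ} (hf : Restr k f) (r : Fin n) (i : Fin k) :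
    (dualFn k f i + (n - 1 - r)) / n = (f r + (k - 1 - i)) / k := by
  apply sum_add_div_eq
  · exact fun s t hst => Nat.div_le_div_right (Nat.add_le_add_right (hf.1 hst) _)
  · intro s t
    rw [← Nat.add_div_right _ hk]
    exact Nat.div_le_div_right (by have := hf.2 s t; omega)

theorem dualFn_dualFn (hk : 0 < k) {f : Fin n → ℕ} (hf : Restr k f) :
    dualFn n (dualFn k f) = f := by
  funext r
  rw [dualFn, Finset.sum_congr rfl fun i _ => dualFn_add_div hk hf r i, sum_add_div hk]

/-- Both directions compare sums of rounded quotients term by term. For the forward one, f and g are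
recovered from their duals; one extra box in a dual row is absorbed by the shift to an earlier row,
or by adding n when the comparison goes around the cylinder. For the converse, each row of g is
compared with the preceding row of f, and the first row of g with the last row of f. -/
theorem vStrip_dualFn_iff (hk : 0 < k) {f g : Fin n → ℕ} (hf : Restr k f) (hg : Restr k g) :
    VStrip n (dualFn k f) (dualFn k g) ↔ HStrip k f g := by
  constructor
  · rintro ⟨h, -⟩
    have hfe : ∀ r, f r = ∑ i, (dualFn k f i + (n - 1 - r)) / n := fun r =>
      (congrFun (dualFn_dualFn hk hf) r).symm
    have hge : ∀ r, g r = ∑ i, (dualFn k g i + (n - 1 - r)) / n := fun r =>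
      (congrFun (dualFn_dualFn hk hg) r).symm
    refine ⟨fun r => ?_, fun r s hrs => ?_, fun r s => ?_⟩
    · rw [hfe, hge]
      exact Finset.sum_le_sum fun i _ => Nat.div_le_div_right (by have := h i; omega)
    · have : (r : ℕ) < s := hrs
      rw [hfe r, hge s]
      exact Finset.sum_le_sum fun i _ => Nat.div_le_div_right (by have := h i; omega)
    · have h1 : ∑ i, ((dualFn k f i + (n - 1 - s)) / n + 1) = f s + k := by
        simp [Finset.sum_add_distrib, ← hfe]
      have hn : 0 < n := r.pos
      rw [← h1, hge r]
      refine Finset.sum_le_sum fun i _ => ?_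
      rw [← Nat.add_div_right _ hn]
      exact Nat.div_le_div_right (by have := h i; omega)
  · intro h
    refine ⟨fun i => ⟨?_, ?_⟩, restr_dualFn hk g⟩
    · exact Finset.sum_le_sum fun r _ => Nat.div_le_div_right (Nat.add_le_add_right (h.1 r) _)
    · rcases n with _ | n
      · simp [dualFn]
      · rw [dualFn, dualFn, Fin.sum_univ_succ, Fin.sum_univ_castSucc (f := fun r : Fin (n + 1) =>
          (f r + (k - 1 - i)) / k)]
        have h1 : (g 0 + (k - 1 - i)) / k ≤ (f (Fin.last n) + (k - 1 - i)) / k + 1 := by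
          rw [← Nat.add_div_right _ hk]
          exact Nat.div_le_div_right (by have := h.2.2 0 (Fin.last n); omega)
        have h2 : ∑ r : Fin n, (g r.succ + (k - 1 - i)) / k ≤
            ∑ r : Fin n, (f r.castSucc + (k - 1 - i)) / k :=
          Finset.sum_le_sum fun r _ => Nat.div_le_div_right
            (Nat.add_le_add_right (h.2.1 _ _ r.castSucc_lt_succ) _)
        omega

theorem card_chains_dualFn (hn : 0 < n) (hk : 0 < k) {f g : Fin n → ℕ} (hf : Restr k f)
    (hg : Restr k g) (a : ℕ) :
    (chains (VStrip n) (dualFn k f) (dualFn k g) a).card = (chains (HStrip k) f g a).card := by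
  symm
  refine Finset.card_bij (fun η _ => dualFn k η) ?_ ?_ ?_
  · intro η hη
    simp only [chains, Finset.mem_filter, mem_hstrips, mem_vstrips] at hη ⊢
    have hr := hη.1.1.restr
    rw [vStrip_dualFn_iff hk hf hr, vStrip_dualFn_iff hk hr hg, sum_dualFn hk, sum_dualFn hk]
    exact hη
  · intro η hη ξ hξ h
    simp only [chains, Finset.mem_filter, mem_hstrips] at hη hξ
    rw [← dualFn_dualFn hk hη.1.1.restr, h, dualFn_dualFn hk hξ.1.1.restr]
  · intro ξ hξ
    simp only [chains, Finset.mem_filter, mem_vstrips] at hξ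
    have hr := restr_dualFn (k := n) hn ξ
    have he := dualFn_dualFn hn hξ.1.1.2
    refine ⟨dualFn n ξ, ?_, he⟩
    simp only [chains, Finset.mem_filter, mem_hstrips]
    rw [← vStrip_dualFn_iff hk hf hr, ← vStrip_dualFn_iff hk hr hg, he, sum_dualFn hn, hξ.1.2,
      sum_dualFn hk]
    exact ⟨⟨hξ.1.1, rfl⟩, hξ.2⟩

theorem colLen_eq_sum {lam : YoungDiagram} (h : lam.colLen 0 ≤ n) (c : ℕ) :
    lam.colLen c = ∑ r : Fin n, if c < rows n lam r then 1 else 0 := by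
  rw [Finset.sum_boole, Nat.cast_id]
  have h1 : lam.colLen c ≤ n := (lam.colLen_anti 0 c (Nat.zero_le _)).trans h
  have : ({r | c < rows n lam r} : Finset (Fin n)) =
      ({r | (r : ℕ) < lam.colLen c} : Finset (Fin n)) := by
    ext r
    simp only [Finset.mem_filter, Finset.mem_univ, true_and]
    rw [rows, ← YoungDiagram.mem_iff_lt_rowLen, YoungDiagram.mem_iff_lt_colLen]
  rw [this, Fin.card_filter_val_lt]
  exact (min_eq_right h1).symm

theorem card_filter_mul_add_lt (hk : 0 < k) {i x B : ℕ} (hi : i < k) (hB : x ≤ B) :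
    ∑ j ∈ Finset.range B, (if j * k + i < x then 1 else 0) = (x + (k - 1 - i)) / k := by
  have hle : (x + (k - 1 - i)) / k ≤ x := by
    rw [← Nat.lt_succ_iff, Nat.div_lt_iff_lt_mul hk, Nat.succ_mul]
    have := Nat.le_mul_of_pos_right x hk
    omega
  rw [Finset.sum_boole, Nat.cast_id]
  have : {j ∈ Finset.range B | j * k + i < x} = Finset.range ((x + (k - 1 - i)) / k) := by
    ext j
    rw [Finset.mem_filter, Finset.mem_range, Finset.mem_range,
      ← Nat.succ_le_iff (n := (x + (k - 1 - i)) / k), Nat.le_div_iff_mul_le hk, Nat.succ_mul]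
    constructor
    · omega
    · intro h
      have : j + 1 ≤ x := by
        refine le_trans ?_ hle
        rw [Nat.le_div_iff_mul_le hk, Nat.succ_mul]
        exact h
      omega
  rw [this, Finset.card_range]

theorem colLen_dual_le (k : ℕ) (lam : YoungDiagram) : (dual k lam).colLen 0 ≤ k := by
  by_contra h
  have := YoungDiagram.mem_iff_lt_colLen.2 (not_le.1 h)
  rw [dual, YoungDiagram.mem_ofRowLens] at this
  obtain ⟨h1, -⟩ := this
  simp at h1

theorem rows_dual (hk : 0 < k) {lam : YoungDiagram} (h : lam.colLen 0 ≤ n) :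
    rows k (dual k lam) = dualFn k (rows n lam) := by
  funext i
  have h1 : rows k (dual k lam) i = dualRow k lam i := by
    apply eq_of_forall_lt_iff
    intro b
    rw [rows, ← YoungDiagram.mem_iff_lt_rowLen, dual, YoungDiagram.mem_ofRowLens]
    simp
  rw [h1, dualRow, dualFn, Finset.sum_congr rfl fun j _ => colLen_eq_sum h _, Finset.sum_comm]
  refine Finset.sum_congr rfl fun r _ => card_filter_mul_add_lt hk i.2 ?_
  exact (lam.rowLen_anti 0 r (Nat.zero_le _)).trans (Nat.le_succ _)

theorem dualFn_twoRow {m a b : ℕ} (hm : 1 ≤ m) (ha : a ≤ k + 1) (hb : b ≤ k + 1) :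
    dualFn (k + 1) (twoRow m a b) = twoCol k a b := by
  have h : ∀ x, x ≤ k + 1 → ∀ i : Fin (k + 1), (x + (k + 1 - 1 - i)) / (k + 1) =
      if (i : ℕ) < x then 1 else 0 := by
    intro x hx i
    have := i.2
    split_ifs
    · apply Nat.div_eq_of_lt_le <;> omega
    · exact Nat.div_eq_of_lt (by omega)
  funext i
  rw [dualFn, sum_eq_of_support_le_one hm]
  · simp only [twoRow, Fin.val_zero, if_true]
    rw [h a ha, if_neg one_ne_zero, h b hb, twoCol]
  · intro r hr
    rw [twoRow, if_neg (by omega), if_neg (by omega), h 0 (Nat.zero_le _), if_neg (Nat.not_lt_zero _)]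

end Duality

/-! ### Words in parentheses

A subset `S` of a finite set `V` of natural numbers is a word in parentheses that is read from the
largest to the smallest element of `V`: the elements of `S` are left parentheses, the other ones are
right parentheses. -/

section Words

variable {V : Finset ℕ} {C : ℕ → Prop} {S : Finset ℕ}

/-- The number of left minus the number of right parentheses in the part `[i, ∞)` of the word. -/
def height (V S : Finset ℕ) (i : ℕ) : ℤ := ∑ j ∈ V with i ≤ j, if j ∈ S then 1 else -1

theorem filter_le_eq_insert {V : Finset ℕ} {i : ℕ} (hi : i ∈ V) :
    {j ∈ V | i ≤ j} = insert i {j ∈ V | i + 1 ≤ j} := by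
  ext j
  simp only [Finset.mem_filter, Finset.mem_insert]
  constructor
  · rintro ⟨h1, h2⟩
    rcases h2.eq_or_lt with rfl | h2
    · exact Or.inl rfl
    · exact Or.inr ⟨h1, h2⟩
  · rintro (rfl | h)
    · exact ⟨hi, le_rfl⟩
    · exact ⟨h.1, by omega⟩

theorem height_eq_add (V S : Finset ℕ) (i : ℕ) :
    height V S i = height V S (i + 1) + if i ∈ V then (if i ∈ S then 1 else -1) else 0 := by
  simp only [height]
  split_ifs with hV hS
  · rw [filter_le_eq_insert hV, Finset.sum_insert (by simp), if_pos hS, add_comm]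
  · rw [filter_le_eq_insert hV, Finset.sum_insert (by simp), if_neg hS, add_comm]
  · rw [add_zero]
    refine Finset.sum_congr (Finset.filter_congr fun j hj => ?_) fun _ _ => rfl
    have : i ≠ j := fun h => hV (h ▸ hj)
    omega

theorem height_of_forall_lt {i : ℕ} (h : ∀ j ∈ V, j < i) : height V S i = 0 := by
  rw [height, Finset.filter_false_of_mem, Finset.sum_empty]
  intro j hj
  have := h j hj
  omega

theorem height_insert {j : ℕ} (hj : j ∈ V) (hjS : j ∉ S) (i : ℕ) :
    height V (insert j S) i = height V S i + if i ≤ j then 2 else 0 := by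
  have h : ∀ l, (if l ∈ insert j S then (1 : ℤ) else -1) =
      (if l ∈ S then 1 else -1) + if j = l then 2 else 0 := by
    intro l
    by_cases hl : j = l
    · subst hl; simp [hjS]
    · simp [Finset.mem_insert, hl, Ne.symm hl]
  simp only [height, h, Finset.sum_add_distrib, Finset.sum_ite_eq, Finset.mem_filter, hj, true_and]

theorem height_zero (hS : S ⊆ V) : height V S 0 = 2 * S.card - V.card := by
  simp only [height, Nat.zero_le, Finset.filter_true]
  have h : ∀ j, (if j ∈ S then (1 : ℤ) else -1) = 2 * (if j ∈ S then 1 else 0) - 1 := by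
    intro j
    split_ifs <;> norm_num
  simp only [h, Finset.sum_sub_distrib, ← Finset.mul_sum, Finset.sum_ite_mem,
    Finset.inter_eq_right.2 hS]
  simp

theorem neg_card_le_height (V S : Finset ℕ) (i : ℕ) : -(V.card : ℤ) ≤ height V S i := by
  have h1 : ∑ j ∈ V with i ≤ j, (-1 : ℤ) ≤ height V S i :=
    Finset.sum_le_sum fun j _ => by split_ifs <;> norm_num
  have h2 := Finset.card_filter_le V (fun j => i ≤ j)
  simp only [Finset.sum_const, smul_neg, nsmul_eq_mul, mul_one] at h1
  omega

/-- `ρ` is the number of unpaired right parentheses. -/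
def Lowest (V S : Finset ℕ) (ρ : ℕ) : Prop :=
  (∀ i, -(ρ : ℤ) ≤ height V S i) ∧ ∃ i, height V S i = -(ρ : ℤ)

theorem exists_lowest (V S : Finset ℕ) : ∃ ρ ≤ V.card, Lowest V S ρ := by
  classical
  have hex : ∃ ρ : ℕ, ∀ i, -(ρ : ℤ) ≤ height V S i := ⟨V.card, neg_card_le_height V S⟩
  refine ⟨Nat.find hex, Nat.find_min' hex (neg_card_le_height V S), Nat.find_spec hex, ?_⟩
  by_contra! hne
  rcases Nat.eq_zero_or_pos (Nat.find hex) with h0 | hpos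
  · apply hne (V.sup id + 1)
    rw [height_of_forall_lt, h0]
    · rfl
    · intro j hj
      exact Nat.lt_succ_of_le (Finset.le_sup (f := id) hj)
  · refine Nat.find_min hex (Nat.sub_lt hpos one_pos) fun i => ?_
    have h1 := Nat.find_spec hex i
    have h2 := hne i
    omega

theorem Lowest.unique {ρ ρ' : ℕ} (h : Lowest V S ρ) (h' : Lowest V S ρ') : ρ = ρ' := by
  obtain ⟨h1, i, hi⟩ := h
  obtain ⟨h2, j, hj⟩ := h'
  have := h1 j
  have := h2 i
  omega

/-- The words in which no right parenthesis follows a left one in two consecutive positions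
`i + 1`, `i` with `C i`. -/
def IsWord (V : Finset ℕ) (C : ℕ → Prop) (S : Finset ℕ) : Prop :=
  S ⊆ V ∧ ∀ i, C i → i ∈ V → i + 1 ∈ V → i + 1 ∈ S → i ∈ S

open Classical in
/-- The words with `s` left parentheses. -/
noncomputable def words (V : Finset ℕ) (C : ℕ → Prop) (s : ℤ) : Finset (Finset ℕ) :=
  {S ∈ V.powerset | IsWord V C S ∧ (S.card : ℤ) = s}

theorem mem_words {s : ℤ} : S ∈ words V C s ↔ IsWord V C S ∧ (S.card : ℤ) = s := by
  simp only [words, Finset.mem_filter, Finset.mem_powerset, and_iff_right_iff_imp]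
  exact fun h => h.1.1

open Classical in
/-- The words with `s` left parentheses and `ρ` unpaired right ones. -/
noncomputable def lowestWords (V : Finset ℕ) (C : ℕ → Prop) (s : ℤ) (ρ : ℕ) : Finset (Finset ℕ) :=
  {S ∈ words V C s | Lowest V S ρ}

theorem mem_lowestWords {s : ℤ} {ρ : ℕ} :
    S ∈ lowestWords V C s ρ ↔ (IsWord V C S ∧ (S.card : ℤ) = s) ∧ Lowest V S ρ := by
  simp only [lowestWords, Finset.mem_filter, mem_words]

/-- `j` is the position of the last unpaired right parenthesis. -/
def LastUnpaired (V S : Finset ℕ) (ρ j : ℕ) : Prop :=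
  height V S j = -(ρ + 1 : ℤ) ∧ ∀ i, j < i → -(ρ + 1 : ℤ) < height V S i

theorem LastUnpaired.unique {ρ j j' : ℕ} (h : LastUnpaired V S ρ j) (h' : LastUnpaired V S ρ j') :
    j = j' := by
  rcases lt_trichotomy j j' with hlt | heq | hlt
  · have := h.2 _ hlt
    have := h'.1
    omega
  · exact heq
  · have := h'.2 _ hlt
    have := h.1
    omega

theorem exists_lastUnpaired {ρ : ℕ} (h : Lowest V S (ρ + 1)) : ∃ j, LastUnpaired V S ρ j := by
  classical
  obtain ⟨h1, i, hi⟩ := h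
  set B := V.sup id + 1
  have hB : ∀ i, B ≤ i → height V S i = 0 := fun i hi => height_of_forall_lt fun j hj =>
    lt_of_lt_of_le (Nat.lt_succ_of_le (Finset.le_sup (f := id) hj)) hi
  have hiB : i ≤ B := by
    by_contra h
    have := hB i (by omega)
    push_cast at hi
    omega
  push_cast at hi h1
  refine ⟨Nat.findGreatest (fun i => height V S i = -(ρ + 1 : ℤ)) B, ?_, ?_⟩
  · exact Nat.findGreatest_spec (P := fun i => height V S i = -(ρ + 1 : ℤ)) hiB hi
  · intro l hl
    by_cases hlB : l ≤ B
    · have h2 := Nat.findGreatest_is_greatest hl hlB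
      have h3 := h1 l
      omega
    · rw [hB l (by omega)]
      omega

theorem LastUnpaired.mem {ρ j : ℕ} (hj : LastUnpaired V S ρ j) : j ∈ V ∧ j ∉ S := by
  have h1 := hj.1
  have h2 := hj.2 (j + 1) (Nat.lt_succ_self j)
  rw [height_eq_add] at h1
  split_ifs at h1 with h3 h4
  · omega
  · exact ⟨h3, h4⟩
  · omega

/-- A right parenthesis in the next position after j would lower the height below its minimum, so
the flip cannot create a forbidden left-right succession. -/
theorem LastUnpaired.isWord_insert {ρ j : ℕ} (hS : IsWord V C S) (h : Lowest V S (ρ + 1))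
    (hj : LastUnpaired V S ρ j) : IsWord V C (insert j S) := by
  refine ⟨Finset.insert_subset hj.mem.1 hS.1, fun i hi hiV hiV' hiS => ?_⟩
  rw [Finset.mem_insert] at hiS ⊢
  right
  rcases hiS with hij | hiS
  · by_contra hne
    have h1 := height_eq_add V S i
    rw [if_pos hiV, if_neg hne, hij, hj.1] at h1
    have h2 := h.1 i
    push_cast at h2
    omega
  · exact hS.2 i hi hiV hiV' hiS

/-- The flip raises the heights at and below j by two. The last two assertions locate j from the new
word, which makes the flip injective. -/
theorem LastUnpaired.lowest_insert {ρ j : ℕ} (h : Lowest V S (ρ + 1))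
    (hj : LastUnpaired V S ρ j) : Lowest V (insert j S) ρ ∧ height V (insert j S) (j + 1) = -ρ ∧
      ∀ i ≤ j, -(ρ : ℤ) < height V (insert j S) i := by
  obtain ⟨h1, -⟩ := h
  push_cast at h1
  have hh := height_insert hj.mem.1 hj.mem.2
  have h3 : height V (insert j S) (j + 1) = -ρ := by
    have h4 := height_eq_add V S j
    rw [hj.1, if_pos hj.mem.1, if_neg hj.mem.2] at h4
    rw [hh, if_neg (by omega)]
    omega
  have h4 : ∀ i ≤ j, -(ρ : ℤ) < height V (insert j S) i := by
    intro i hi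
    rw [hh, if_pos hi]
    have := h1 i
    omega
  refine ⟨⟨fun i => ?_, j + 1, h3⟩, h3, h4⟩
  by_cases hi : i ≤ j
  · exact (h4 i hi).le
  · rw [hh, if_neg hi]
    have := hj.2 i (by omega)
    omega

/-- The inverse move turns the first unpaired left parenthesis into a right one. It sits just below
the smallest position of minimal height, and `h0` says that it exists. -/
theorem exists_insert_lastUnpaired {ρ : ℕ} {S' : Finset ℕ} (hS' : IsWord V C S')
    (h : Lowest V S' ρ) (h0 : -(ρ : ℤ) < height V S' 0) :
    ∃ S j, IsWord V C S ∧ Lowest V S (ρ + 1) ∧ LastUnpaired V S ρ j ∧ insert j S = S' := by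
  classical
  obtain ⟨h1, hex⟩ := h
  have hspec := Nat.find_spec hex
  have hmin : ∀ i < Nat.find hex, height V S' i ≠ -ρ := fun i hi => Nat.find_min hex hi
  obtain ⟨j, hj⟩ : ∃ j, Nat.find hex = j + 1 := by
    refine ⟨Nat.find hex - 1, ?_⟩
    have : Nat.find hex ≠ 0 := fun h => by rw [h] at hspec; omega
    omega
  rw [hj] at hspec hmin
  have hbelow : ∀ i ≤ j, -(ρ : ℤ) < height V S' i := by
    intro i hi
    have h2 := hmin i (by omega)
    have h3 := h1 i
    omega
  have hjj := hbelow j le_rfl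
  rw [height_eq_add, hspec] at hjj
  have hjV : j ∈ V := by
    by_contra hne
    rw [if_neg hne] at hjj
    omega
  have hjS : j ∈ S' := by
    by_contra hne
    rw [if_pos hjV, if_neg hne] at hjj
    omega
  have hins : insert j (S'.erase j) = S' := Finset.insert_erase hjS
  have hh := height_insert hjV (Finset.notMem_erase j S')
  rw [hins] at hh
  have hhj := height_eq_add V S' j
  rw [if_pos hjV, if_pos hjS, hspec] at hhj
  have hlast : LastUnpaired V (S'.erase j) ρ j := by
    constructor
    · have := hh j
      rw [if_pos le_rfl] at this
      omega
    · intro i hi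
      have h2 := hh i
      rw [if_neg (by omega)] at h2
      have := h1 i
      omega
  refine ⟨S'.erase j, j, ⟨(Finset.erase_subset _ _).trans hS'.1, ?_⟩, ⟨?_, ?_⟩, hlast, hins⟩
  · intro i hi hiV hiV' hiS
    rw [Finset.mem_erase] at hiS ⊢
    refine ⟨?_, hS'.2 i hi hiV hiV' hiS.2⟩
    rintro rfl
    have h2 := height_eq_add V S' (i + 1)
    rw [if_pos hiV', if_pos hiS.2, hspec] at h2
    have := h1 (i + 1 + 1)
    omega
  · intro i
    push_cast
    by_cases hi : j < i
    · exact (hlast.2 i hi).le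
    · have h2 := hh i
      rw [if_pos (by omega)] at h2
      have := hbelow i (by omega)
      omega
  · exact ⟨j, by push_cast; exact hlast.1⟩

theorem card_lowestWords_succ {s : ℤ} {ρ : ℕ} (h : -(ρ : ℤ) < 2 * (s + 1) - V.card) :
    (lowestWords V C s (ρ + 1)).card = (lowestWords V C (s + 1) ρ).card := by
  classical
  have hex : ∀ S ∈ lowestWords V C s (ρ + 1), ∃ j, LastUnpaired V S ρ j := fun S hS =>
    exists_lastUnpaired (mem_lowestWords.1 hS).2
  choose j hj using hex
  refine Finset.card_bij (fun S hS => insert (j S hS) S) ?_ ?_ ?_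
  · intro S hS
    have h1 := mem_lowestWords.1 hS
    rw [mem_lowestWords]
    refine ⟨⟨(hj S hS).isWord_insert h1.1.1 h1.2, ?_⟩, ((hj S hS).lowest_insert h1.2).1⟩
    rw [Finset.card_insert_of_notMem (hj S hS).mem.2]
    push_cast
    rw [h1.1.2]
  · intro S hS T hT he
    have h1 := (hj S hS).lowest_insert (mem_lowestWords.1 hS).2
    have h2 := (hj T hT).lowest_insert (mem_lowestWords.1 hT).2
    have hjj : j S hS = j T hT := by
      rcases lt_trichotomy (j S hS) (j T hT) with hlt | heq | hlt
      · have h3 := h2.2.2 (j S hS + 1) hlt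
        rw [← he, h1.2.1] at h3
        omega
      · exact heq
      · have h3 := h1.2.2 (j T hT + 1) hlt
        rw [he, h2.2.1] at h3
        omega
    rw [← Finset.erase_insert (hj S hS).mem.2, he, hjj, Finset.erase_insert (hj T hT).mem.2]
  · intro S' hS'
    have h1 := mem_lowestWords.1 hS'
    obtain ⟨S, i, hS, hl, hi, he⟩ := exists_insert_lastUnpaired h1.1.1 h1.2
      (by rw [height_zero h1.1.1.1, h1.1.2]; exact h)
    have hmem : S ∈ lowestWords V C s (ρ + 1) := by
      rw [mem_lowestWords]
      refine ⟨⟨hS, ?_⟩, hl⟩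
      have h2 := h1.1.2
      rw [← he, Finset.card_insert_of_notMem hi.mem.2] at h2
      push_cast at h2
      omega
    refine ⟨S, hmem, ?_⟩
    rw [(hj S hmem).unique hi, he]

theorem card_lowestWords_add {s : ℤ} {ρ u : ℕ} (h : (V.card : ℤ) ≤ ρ + u + 2 * s) :
    (lowestWords V C s (ρ + u)).card = (lowestWords V C (s + u) ρ).card := by
  induction u generalizing s with
  | zero => simp
  | succ u ih =>
    push_cast at h
    rw [← add_assoc, card_lowestWords_succ (by push_cast; omega), ih (by omega)]
    push_cast
    rw [add_assoc, add_comm (1 : ℤ)]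

theorem card_words_eq_sum (V : Finset ℕ) (C : ℕ → Prop) (s : ℤ) {B : ℕ} (hB : V.card < B) :
    (words V C s).card = ∑ ρ ∈ Finset.range B, (lowestWords V C s ρ).card := by
  classical
  rw [← Finset.card_biUnion]
  · congr 1
    ext S
    simp only [Finset.mem_biUnion, Finset.mem_range, mem_lowestWords, mem_words]
    constructor
    · intro h
      obtain ⟨ρ, h1, h2⟩ := exists_lowest V S
      exact ⟨ρ, by omega, h, h2⟩
    · rintro ⟨ρ, _, h, _⟩
      exact h
  · intro ρ _ ρ' _ hne
    rw [Function.onFun, Finset.disjoint_left]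
    intro S hS hS'
    exact hne ((mem_lowestWords.1 hS).2.unique (mem_lowestWords.1 hS').2)

-- Words are sorted by the number ρ of unpaired right parentheses. Those with ρ ≤ x give the first
-- term. For ρ = x + 1 + u with u < y, flipping u + 1 parentheses leaves exactly x unpaired right
-- ones and at least u + 1 unpaired left ones. For larger ρ, flipping x + y + 1 of them gives all
-- words with P + 1 left parentheses, which cancel.
open Classical in
theorem card_words_sub_card_words (V : Finset ℕ) (C : ℕ → Prop) {P : ℤ} {x y : ℕ}
    (h : (V.card : ℤ) + (x + y) ≤ 2 * P + 1) :
    ((words V C (P - (x + y))).card : ℤ) - (words V C (P + 1)).card =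
      ({S ∈ words V C (P - (x + y)) | ∀ i, -(x : ℤ) ≤ height V S i} : Finset (Finset ℕ)).card +
      ∑ u ∈ Finset.range y, (({S ∈ words V C (P - (x + y) + (u + 1)) |
        Lowest V S x ∧ (u + 1 : ℤ) - x ≤ height V S 0} : Finset (Finset ℕ)).card : ℤ) := by
  have h1 := card_words_eq_sum V C (P - (x + y)) (B := x + 1 + y + (V.card + 1)) (by omega)
  rw [Finset.sum_range_add, Finset.sum_range_add] at h1
  have h2 : ∑ ρ ∈ Finset.range (V.card + 1), (lowestWords V C (P - (x + y)) (x + 1 + y + ρ)).card =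
      (words V C (P + 1)).card := by
    rw [card_words_eq_sum V C (P + 1) (Nat.lt_succ_self _)]
    refine Finset.sum_congr rfl fun ρ _ => ?_
    rw [add_comm (x + 1 + y), card_lowestWords_add (by push_cast; omega)]
    congr 2
    push_cast
    ring
  have h3 : ∑ ρ ∈ Finset.range (x + 1), (lowestWords V C (P - (x + y)) ρ).card =
      ({S ∈ words V C (P - (x + y)) | ∀ i, -(x : ℤ) ≤ height V S i} : Finset (Finset ℕ)).card := by
    rw [← Finset.card_biUnion]
    · congr 1
      ext S
      simp only [Finset.mem_biUnion, Finset.mem_range, lowestWords, Finset.mem_filter]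
      constructor
      · rintro ⟨ρ, h4, h5, h6⟩
        refine ⟨h5, fun i => ?_⟩
        have := h6.1 i
        omega
      · rintro ⟨h4, h5⟩
        obtain ⟨ρ, -, h6⟩ := exists_lowest V S
        refine ⟨ρ, ?_, h4, h6⟩
        obtain ⟨i, hi⟩ := h6.2
        have := h5 i
        omega
    · intro ρ _ ρ' _ hne
      rw [Function.onFun, Finset.disjoint_left]
      intro S hS hS'
      exact hne ((mem_lowestWords.1 hS).2.unique (mem_lowestWords.1 hS').2)
  -- When the flips are not available both sides are empty: the total height is too small for the
  -- minimum on the left and for the bound at 0 on the right.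
  have h4 : ∀ u, (lowestWords V C (P - (x + y)) (x + 1 + u)).card =
      ({S ∈ words V C (P - (x + y) + (u + 1)) |
        Lowest V S x ∧ (u + 1 : ℤ) - x ≤ height V S 0} : Finset (Finset ℕ)).card := by
    intro u
    by_cases hu : (V.card : ℤ) ≤ x + (u + 1 : ℕ) + 2 * (P - (x + y))
    · rw [show x + 1 + u = x + (u + 1) by ring, card_lowestWords_add hu]
      congr 1
      ext S
      simp only [lowestWords, Finset.mem_filter]
      push_cast
      refine and_congr_right fun hS => (and_iff_left ?_).symm
      rw [mem_words] at hS
      rw [height_zero hS.1.1, hS.2]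
      push_cast at hu
      omega
    · push_cast at hu
      rw [Finset.card_eq_zero.2, Finset.card_eq_zero.2]
      · rw [Finset.filter_eq_empty_iff]
        rintro S hS ⟨-, h5⟩
        rw [mem_words] at hS
        rw [height_zero hS.1.1, hS.2] at h5
        omega
      · rw [Finset.eq_empty_iff_forall_notMem]
        intro S hS
        rw [mem_lowestWords] at hS
        have h5 := hS.2.1 0
        rw [height_zero hS.1.1.1, hS.1.2] at h5
        push_cast at h5
        omega
  rw [h2, h3, Finset.sum_congr rfl fun u _ => h4 u] at h1
  rw [h1]
  push_cast
  ring

end Words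

/-! ### Words with a chain that wraps around -/

section Wrap

variable {n x y : ℕ} {U M : Finset ℕ} {C : ℕ → Prop}

/-- The positions `[0, y)` and `[n - x, n)` form the lowest and the highest chain of consecutive
positions in `U`, and `M` consists of the other positions. -/
structure IsWrap (n x y : ℕ) (U M : Finset ℕ) (C : ℕ → Prop) : Prop where
  x_pos : 0 < x
  y_pos : 0 < y
  le : y + x ≤ n
  mem_M : ∀ i ∈ M, y ≤ i ∧ i + x < n
  mem_U : ∀ i, i ∈ U ↔ i < y ∨ i ∈ M ∨ (n ≤ i + x ∧ i < n)
  chain_low : ∀ i, i + 1 < y → C i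
  chain_high : ∀ i, n ≤ i + x → i + 1 < n → C i
  not_chain_low : ∀ i, i + 1 = y → i + 1 ∈ U → ¬ C i
  not_chain_high : ∀ i, i + 1 + x = n → i ∈ U → ¬ C i

/-- The first `x + y - t` positions of the chain `n - x, …, n - 1, 0, …, y - 1`. -/
def wrapSet (n x y t : ℕ) : Finset ℕ :=
  {i ∈ Finset.Ico (n - x) n | i < n - x + (x + y - t)} ∪ Finset.range (y - t)

theorem mem_wrapSet {t i : ℕ} : i ∈ wrapSet n x y t ↔
    (n - x ≤ i ∧ i < n ∧ i < n - x + (x + y - t)) ∨ i < y - t := by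
  simp [wrapSet]

theorem IsWrap.card_wrapSet (h : IsWrap n x y U M C) {t : ℕ} (ht : t ≤ x + y) :
    (wrapSet n x y t).card = x + y - t := by
  have hle := h.le
  rw [wrapSet, Finset.card_union_of_disjoint]
  · have : {i ∈ Finset.Ico (n - x) n | i < n - x + (x + y - t)} =
        Finset.Ico (n - x) (min n (n - x + (x + y - t))) := by
      ext i
      simp only [Finset.mem_filter, Finset.mem_Ico, lt_min_iff]
      omega
    rw [this, Nat.card_Ico, Finset.card_range]
    omega
  · rw [Finset.disjoint_left]
    intro i hi
    simp only [Finset.mem_filter, Finset.mem_Ico, Finset.mem_range] at hi ⊢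
    omega

theorem IsWrap.disjoint (h : IsWrap n x y U M C) (t : ℕ) : Disjoint M (wrapSet n x y t) := by
  rw [Finset.disjoint_left]
  intro i hi
  have := h.mem_M i hi
  rw [mem_wrapSet]
  omega

theorem IsWrap.card_U (h : IsWrap n x y U M C) : U.card = M.card + (x + y) := by
  have : U = M ∪ wrapSet n x y 0 := by
    ext i
    have := h.le
    rw [h.mem_U, Finset.mem_union, mem_wrapSet]
    by_cases hi : i ∈ M
    · simp [hi]
    · simp only [hi, false_or]
      omega
  rw [this, Finset.card_union_of_disjoint (h.disjoint 0), h.card_wrapSet (Nat.zero_le _),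
    Nat.sub_zero]

/-- The constraint C does not link M to the two extreme chains, so a word on M and an initial
segment of the cyclic chain can be combined freely. -/
theorem IsWrap.isWord_union (h : IsWrap n x y U M C) {S : Finset ℕ} (hS : IsWord M C S) {t : ℕ}
    (ht : t ≤ x + y) : IsWord U C (S ∪ wrapSet n x y t) ∧
      (0 ∈ S ∪ wrapSet n x y t → n - 1 ∈ S ∪ wrapSet n x y t) := by
  have hle := h.le
  have hx := h.x_pos
  have hy := h.y_pos
  refine ⟨⟨fun i hi => ?_, fun i hC hi hi' hiS => ?_⟩, fun h0 => ?_⟩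
  · rw [Finset.mem_union, mem_wrapSet] at hi
    rw [h.mem_U]
    rcases hi with hi | hi
    · exact Or.inr (Or.inl (hS.1 hi))
    · omega
  · rw [Finset.mem_union, mem_wrapSet] at hiS ⊢
    rcases hiS with hiS | hiS
    · have h1 := h.mem_M _ (hS.1 hiS)
      rcases (h.mem_U i).1 hi with h2 | h2 | h2
      · exact absurd hC (h.not_chain_low i (by omega) hi')
      · exact Or.inl (hS.2 i hC h2 (hS.1 hiS) hiS)
      · omega
    · right
      rcases hiS with hiS | hiS
      · by_cases h3 : i + 1 + x = n
        · exact absurd hC (h.not_chain_high i h3 hi)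
        · omega
      · omega
  · rw [Finset.mem_union, mem_wrapSet] at h0 ⊢
    rcases h0 with h0 | h0
    · have := h.mem_M 0 (hS.1 h0)
      omega
    · omega

theorem eq_Ico_of_lower {a b : ℕ} {T : Finset ℕ} (hT : T ⊆ Finset.Ico a b)
    (h : ∀ i, a ≤ i → i + 1 ∈ T → i ∈ T) : T = Finset.Ico a (a + T.card) := by
  have hdown : ∀ d i, a ≤ i → i + d ∈ T → i ∈ T := by
    intro d
    induction d with
    | zero => exact fun i _ h => h
    | succ d ih =>
      intro i hi hd
      exact h i hi (ih (i + 1) (by omega) (by rwa [show i + 1 + d = i + (d + 1) by omega]))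
  symm
  have hsub : T ⊆ Finset.Ico a (a + T.card) := by
    intro i hi
    have h1 := Finset.mem_Ico.1 (hT hi)
    have h2 : Finset.Ico a (i + 1) ⊆ T := by
      intro j hj
      rw [Finset.mem_Ico] at hj
      apply hdown (i - j) j hj.1
      rwa [show j + (i - j) = i by omega]
    have h3 := Finset.card_le_card h2
    rw [Nat.card_Ico] at h3
    rw [Finset.mem_Ico]
    omega
  exact (Finset.eq_of_subset_of_card_le hsub (by simp)).symm

theorem IsWrap.exists_eq_union (h : IsWrap n x y U M C) {S : Finset ℕ} (hS : IsWord U C S)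
    (h0 : 0 ∈ S → n - 1 ∈ S) :
    IsWord M C (S ∩ M) ∧ ∃ t ≤ x + y, (S ∩ M) ∪ wrapSet n x y t = S := by
  have hle := h.le
  have hx := h.x_pos
  have hy := h.y_pos
  have hMU : M ⊆ U := fun i hi => (h.mem_U i).2 (Or.inr (Or.inl hi))
  refine ⟨⟨Finset.inter_subset_right, fun i hC hi hi' hiS => ?_⟩, ?_⟩
  · rw [Finset.mem_inter] at hiS ⊢
    exact ⟨hS.2 i hC (hMU hi) (hMU hi') hiS.1, hi⟩
  have h1 : S ∩ Finset.Ico (n - x) n =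
      Finset.Ico (n - x) (n - x + (S ∩ Finset.Ico (n - x) n).card) := by
    apply eq_Ico_of_lower Finset.inter_subset_right
    intro i hi hi'
    rw [Finset.mem_inter, Finset.mem_Ico] at hi' ⊢
    refine ⟨hS.2 i (h.chain_high i (by omega) (by omega)) ?_ (hS.1 hi'.1) hi'.1, by omega⟩
    rw [h.mem_U]
    omega
  have h2 : S ∩ Finset.Ico 0 y = Finset.Ico 0 (0 + (S ∩ Finset.Ico 0 y).card) := by
    apply eq_Ico_of_lower Finset.inter_subset_right
    intro i hi hi'
    rw [Finset.mem_inter, Finset.mem_Ico] at hi' ⊢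
    refine ⟨hS.2 i (h.chain_low i (by omega)) ?_ (hS.1 hi'.1) hi'.1, by omega⟩
    rw [h.mem_U]
    omega
  have h3 : (S ∩ Finset.Ico (n - x) n).card ≤ x := by
    refine (Finset.card_le_card Finset.inter_subset_right).trans ?_
    rw [Nat.card_Ico]
    omega
  have h4 : (S ∩ Finset.Ico 0 y).card ≤ y := by
    refine (Finset.card_le_card Finset.inter_subset_right).trans ?_
    rw [Nat.card_Ico]
    omega
  generalize (S ∩ Finset.Ico (n - x) n).card = c at h1 h3
  generalize (S ∩ Finset.Ico 0 y).card = d at h2 h4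
  have h5 : ∀ i, i ∈ S ∧ n - x ≤ i ∧ i < n ↔ n - x ≤ i ∧ i < n - x + c := by
    intro i
    have := Finset.ext_iff.1 h1 i
    simpa only [Finset.mem_inter, Finset.mem_Ico] using this
  have h6 : ∀ i, i ∈ S ∧ i < y ↔ i < d := by
    intro i
    have := Finset.ext_iff.1 h2 i
    simpa only [Finset.mem_inter, Finset.mem_Ico, Nat.zero_le, true_and, zero_add] using this
  -- The cyclic constraint: the low chain may begin only after the high chain is full, so the two
  -- initial segments form a single one.
  have h7 : 0 < d → c = x := by
    intro hd
    have h8 := h0 ((h6 0).2 hd).1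
    have h9 := (h5 (n - 1)).1 ⟨h8, by omega, by omega⟩
    omega
  refine ⟨x + y - (c + d), by omega, ?_⟩
  ext i
  rw [Finset.mem_union, Finset.mem_inter, mem_wrapSet]
  have h8 := h5 i
  have h9 := h6 i
  constructor
  · rintro (hi | hi)
    · exact hi.1
    · rcases hi with hi | hi
      · exact (h8.2 (by omega)).1
      · exact (h9.2 (by omega)).1
  · intro hi
    rcases (h.mem_U i).1 (hS.1 hi) with h10 | h10 | h10
    · have := h9.1 ⟨hi, h10⟩
      omega
    · exact Or.inl ⟨hi, h10⟩
    · have := h8.1 ⟨hi, by omega, by omega⟩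
      omega

open Classical in
/-- The words with `s` left parentheses on the cyclic chain. -/
noncomputable def wrapWords (n : ℕ) (U : Finset ℕ) (C : ℕ → Prop) (s : ℤ) : Finset (Finset ℕ) :=
  {S ∈ words U C s | 0 ∈ S → n - 1 ∈ S}

theorem mem_wrapWords {s : ℤ} {S : Finset ℕ} :
    S ∈ wrapWords n U C s ↔ (IsWord U C S ∧ (S.card : ℤ) = s) ∧ (0 ∈ S → n - 1 ∈ S) := by
  simp only [wrapWords, Finset.mem_filter, mem_words]

-- The parameter t is the number of right parentheses on the cyclic chain. Removing the chain leaves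
-- a word on M, whose number of left parentheses grows with t.
open Classical in
theorem IsWrap.card_filter_wrapWords (h : IsWrap n x y U M C) (P : ℤ) (Q : Finset ℕ → Prop) :
    ({S ∈ wrapWords n U C P | Q S} : Finset (Finset ℕ)).card =
      ∑ t ∈ Finset.range (x + y + 1), ({S ∈ words M C (P - (x + y) + t) |
        Q (S ∪ wrapSet n x y t)} : Finset (Finset ℕ)).card := by
  rw [← Finset.card_sigma]
  symm
  have hcard : ∀ {S : Finset ℕ}, S ⊆ M → ∀ {t}, t ≤ x + y →
      (S ∪ wrapSet n x y t).card = S.card + (x + y - t) := by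
    intro S hS t ht
    rw [Finset.card_union_of_disjoint ((h.disjoint t).mono_left hS), h.card_wrapSet ht]
  refine Finset.card_bij (fun z _ => z.2 ∪ wrapSet n x y z.1) ?_ ?_ ?_
  · rintro ⟨t, S⟩ hz
    simp only [Finset.mem_sigma, Finset.mem_range, Finset.mem_filter, mem_words] at hz
    obtain ⟨h1, ⟨h2, h3⟩, h4⟩ := hz
    have h5 := h.isWord_union h2 (t := t) (by omega)
    change S ∪ wrapSet n x y t ∈ _
    rw [Finset.mem_filter, mem_wrapWords]
    refine ⟨⟨⟨h5.1, ?_⟩, h5.2⟩, h4⟩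
    rw [hcard h2.1 (by omega)]
    push_cast [Nat.cast_sub (show t ≤ x + y by omega)]
    omega
  · rintro ⟨t, S⟩ hz ⟨t', S'⟩ hz' he
    simp only [Finset.mem_sigma, Finset.mem_range, Finset.mem_filter, mem_words] at hz hz'
    simp only at he
    have hS : ∀ {S : Finset ℕ}, S ⊆ M → ∀ t, (S ∪ wrapSet n x y t) ∩ M = S := by
      intro S hS t
      rw [Finset.union_inter_distrib_right, Finset.inter_eq_left.2 hS,
        Finset.disjoint_iff_inter_eq_empty.1 (h.disjoint t).symm, Finset.union_empty]
    have h1 : S = S' := by rw [← hS hz.2.1.1.1 t, he, hS hz'.2.1.1.1 t']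
    subst h1
    have h2 := congrArg Finset.card he
    rw [hcard hz.2.1.1.1 (by omega), hcard hz.2.1.1.1 (by omega)] at h2
    have : t = t' := by omega
    rw [this]
  · intro S hS
    rw [Finset.mem_filter, mem_wrapWords] at hS
    obtain ⟨h1, t, ht, h2⟩ := h.exists_eq_union hS.1.1.1 hS.1.2
    refine ⟨⟨t, S ∩ M⟩, ?_, h2⟩
    simp only [Finset.mem_sigma, Finset.mem_range, Finset.mem_filter, mem_words]
    refine ⟨by omega, ⟨h1, ?_⟩, by rw [h2]; exact hS.2⟩
    have h3 := hcard h1.1 ht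
    rw [h2] at h3
    have h4 := hS.1.1.2
    rw [h3] at h4
    push_cast [Nat.cast_sub ht] at h4
    omega

/-- All right parentheses are paired, and the word is not exceptional: if there is a right
parenthesis in `[0, y)`, then the first left parenthesis is paired with a right one outside. -/
def IsFusionWord (n y : ℕ) (U S : Finset ℕ) : Prop :=
  (∀ i, 0 ≤ height U S i) ∧
    ¬ ((∃ i < y, i ∉ S) ∧ ∀ i, y ≤ i → i < n → 0 < height U S i)

/-! ### Heights and fusion words in terms of the part outside the cyclic chain -/

section Heights

variable {S : Finset ℕ} {t : ℕ}

theorem IsWrap.height_high (h : IsWrap n x y U M C) (ht : t ≤ y) {i : ℕ} (hi : n ≤ i + x)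
    (hi' : i ≤ n) : height U (S ∪ wrapSet n x y t) i = n - i := by
  have hle := h.le
  induction hi' using Nat.decreasingInduction with
  | self =>
    rw [height_of_forall_lt, sub_self]
    intro j hj
    rw [h.mem_U] at hj
    rcases hj with hj | hj | hj
    · omega
    · have := h.mem_M j hj; omega
    · omega
  | of_succ j hj ih =>
    rw [height_eq_add, ih (by omega), if_pos, if_pos]
    · push_cast; ring
    · rw [Finset.mem_union, mem_wrapSet]
      omega
    · rw [h.mem_U]
      omega

theorem IsWrap.height_middle (h : IsWrap n x y U M C) (ht : t ≤ y) {i : ℕ}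
    (hi : y ≤ i) (hi' : i ≤ n - x) :
    height U (S ∪ wrapSet n x y t) i = x + height M S i := by
  have hle := h.le
  induction hi' using Nat.decreasingInduction with
  | self =>
    rw [h.height_high ht (by omega) (by omega), height_of_forall_lt]
    · omega
    · intro j hj
      have := h.mem_M j hj
      omega
  | of_succ j hj ih =>
    rw [height_eq_add, ih (by omega), height_eq_add M S j, add_assoc]
    congr 2
    have h1 : j ∈ U ↔ j ∈ M := by
      rw [h.mem_U]
      constructor
      · rintro (h1 | h1 | h1)
        · omega
        · exact h1
        · omega
      · exact fun h1 => Or.inr (Or.inl h1)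
    have h2 : j ∈ S ∪ wrapSet n x y t ↔ j ∈ S := by
      rw [Finset.mem_union, mem_wrapSet]
      constructor
      · rintro (h1 | h1)
        · exact h1
        · omega
      · exact fun h1 => Or.inl h1
    simp only [h1, h2]

theorem IsWrap.height_M_of_le (h : IsWrap n x y U M C) {i : ℕ} (hi : i ≤ y) :
    height M S i = height M S 0 := by
  rw [height, height]
  congr 1
  apply Finset.filter_congr
  intro j hj
  have := h.mem_M j hj
  omega

theorem IsWrap.height_low (h : IsWrap n x y U M C) (hS : S ⊆ M) (ht : t ≤ y) {i : ℕ}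
    (hi : y - t ≤ i) (hi' : i ≤ y) :
    height U (S ∪ wrapSet n x y t) i = x + height M S 0 - (y - i) := by
  have hle := h.le
  induction hi' using Nat.decreasingInduction with
  | self =>
    rw [h.height_middle ht le_rfl (by omega), h.height_M_of_le le_rfl]
    ring
  | of_succ j hj ih =>
    rw [height_eq_add, ih (by omega), if_pos, if_neg]
    · push_cast; ring
    · rw [Finset.mem_union, mem_wrapSet]
      rintro (h1 | h1)
      · have := h.mem_M _ (hS h1)
        omega
      · omega
    · rw [h.mem_U]
      omega

theorem IsWrap.height_lowest (h : IsWrap n x y U M C) (hS : S ⊆ M) (ht : t ≤ y) {i : ℕ}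
    (hi' : i ≤ y - t) :
    height U (S ∪ wrapSet n x y t) i = x + height M S 0 - t + (y - t - i) := by
  have hle := h.le
  induction hi' using Nat.decreasingInduction with
  | self =>
    rw [h.height_low hS ht le_rfl (by omega)]
    push_cast [Nat.cast_sub ht]
    ring
  | of_succ j hj ih =>
    rw [height_eq_add, ih, if_pos, if_pos]
    · push_cast; ring
    · rw [Finset.mem_union, mem_wrapSet]
      omega
    · rw [h.mem_U]
      omega

/-- For t ≤ y the word starts with x left parentheses, continues with the word on M and ends with t
right and then y - t left ones. Only M and the position after the t right parentheses can go below
zero. -/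
theorem IsWrap.forall_height_nonneg_iff (h : IsWrap n x y U M C) (hS : S ⊆ M) (ht : t ≤ y) :
    (∀ i, 0 ≤ height U (S ∪ wrapSet n x y t) i) ↔
      (∀ i, -(x : ℤ) ≤ height M S i) ∧ (t : ℤ) - x ≤ height M S 0 := by
  have hle := h.le
  have hzero : ∀ i, n - x ≤ i → height M S i = 0 := fun i hi => height_of_forall_lt fun j hj => by
    have := h.mem_M j hj
    omega
  constructor
  · intro hp
    constructor
    · intro i
      rcases le_total i y with hi | hi
      · have h1 := hp y
        rw [h.height_middle ht le_rfl (by omega), h.height_M_of_le le_rfl] at h1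
        rw [h.height_M_of_le hi]
        omega
      · rcases le_total i (n - x) with hi' | hi'
        · have h1 := hp i
          rw [h.height_middle ht hi hi'] at h1
          omega
        · rw [hzero i hi']
          omega
    · have h1 := hp (y - t)
      rw [h.height_low hS ht le_rfl (by omega)] at h1
      push_cast [Nat.cast_sub ht] at h1
      omega
  · rintro ⟨h1, h2⟩ i
    by_cases hi : i ≤ y - t
    · rw [h.height_lowest hS ht hi]
      omega
    · by_cases hi2 : i ≤ y
      · rw [h.height_low hS ht (by omega) hi2]
        omega
      · by_cases hi3 : i ≤ n - x
        · rw [h.height_middle ht (by omega) hi3]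
          have := h1 i
          omega
        · by_cases hi4 : i ≤ n
          · rw [h.height_high ht (by omega) hi4]
            omega
          · rw [height_of_forall_lt]
            intro j hj
            rw [h.mem_U] at hj
            rcases hj with hj | hj | hj
            · omega
            · have := h.mem_M j hj; omega
            · omega

theorem IsWrap.isFusionWord_zero (h : IsWrap n x y U M C) (hS : S ⊆ M) :
    IsFusionWord n y U (S ∪ wrapSet n x y 0) ↔ ∀ i, -(x : ℤ) ≤ height M S i := by
  rw [IsFusionWord, h.forall_height_nonneg_iff hS (Nat.zero_le _)]
  constructor
  · exact fun h1 => h1.1.1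
  · refine fun h1 => ⟨⟨h1, by simpa using h1 0⟩, ?_⟩
    rintro ⟨⟨i, hi, hi'⟩, -⟩
    apply hi'
    rw [Finset.mem_union, mem_wrapSet]
    omega

/-- Here the low chain contains a right parenthesis, so not being exceptional means that the height
returns to zero before the low chain. This turns the bound -x on M into an attained minimum. -/
theorem IsWrap.isFusionWord_succ (h : IsWrap n x y U M C) (hS : S ⊆ M) (ht : t + 1 ≤ y) :
    IsFusionWord n y U (S ∪ wrapSet n x y (t + 1)) ↔
      Lowest M S x ∧ (t + 1 : ℤ) - x ≤ height M S 0 := by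
  have hle := h.le
  have hx := h.x_pos
  have hex : ∃ i < y, i ∉ S ∪ wrapSet n x y (t + 1) := by
    refine ⟨y - 1, by omega, ?_⟩
    rw [Finset.mem_union, mem_wrapSet]
    rintro (h1 | h1)
    · have := h.mem_M _ (hS h1)
      omega
    · omega
  rw [IsFusionWord, h.forall_height_nonneg_iff hS ht, Lowest]
  simp only [hex, true_and]
  push_cast
  have hiff : (¬ ∀ i, y ≤ i → i < n → 0 < height U (S ∪ wrapSet n x y (t + 1)) i) ↔
      ∃ i, height M S i ≤ -(x : ℤ) := by
    push Not
    constructor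
    · rintro ⟨i, h1, h2, h3⟩
      refine ⟨i, ?_⟩
      by_cases hi : i ≤ n - x
      · rw [h.height_middle ht h1 hi] at h3
        omega
      · rw [h.height_high ht (by omega) h2.le] at h3
        omega
    · rintro ⟨i, hi⟩
      have hi' : i < n - x := by
        by_contra h1
        rw [height_of_forall_lt] at hi
        · omega
        · intro j hj
          have := h.mem_M j hj
          omega
      rcases le_total y i with h1 | h1
      · refine ⟨i, h1, by omega, ?_⟩
        rw [h.height_middle ht h1 hi'.le]
        omega
      · refine ⟨y, le_rfl, by omega, ?_⟩
        rw [h.height_middle ht le_rfl (by omega), h.height_M_of_le le_rfl,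
          ← h.height_M_of_le h1]
        omega
  rw [hiff]
  constructor
  · rintro ⟨⟨h1, h2⟩, i, hi⟩
    exact ⟨⟨h1, i, le_antisymm hi (h1 i)⟩, h2⟩
  · rintro ⟨⟨h1, i, hi⟩, h2⟩
    exact ⟨⟨h1, h2⟩, i, hi.le⟩

/-- More than y right parentheses on the chain reach the position n - 1, which is read first and is
then unpaired. -/
theorem IsWrap.not_isFusionWord (h : IsWrap n x y U M C) (hS : S ⊆ M) (ht : y < t)
    (ht' : t ≤ x + y) : ¬ IsFusionWord n y U (S ∪ wrapSet n x y t) := by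
  have hle := h.le
  have hx := h.x_pos
  rintro ⟨h1, -⟩
  have h2 := h1 (n - 1)
  rw [height_eq_add, if_pos, if_neg, height_of_forall_lt] at h2
  · omega
  · intro j hj
    rw [h.mem_U] at hj
    rcases hj with hj | hj | hj
    · omega
    · have := h.mem_M j hj; omega
    · omega
  · rw [Finset.mem_union, mem_wrapSet]
    rintro (h3 | h3)
    · have := h.mem_M _ (hS h3)
      omega
    · omega
  · rw [h.mem_U]
    omega

end Heights

-- Replacing P by P + 1 shifts the sum over t by one, so it telescopes to words on M with P - (x +
-- y) and with P + 1 left parentheses. The terms of `card_words_sub_card_words` for this difference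
-- are the fusion words with t = 0 and with t = u + 1 ≤ y; t > y gives none.
open Classical in
theorem IsWrap.card_wrapWords_sub (h : IsWrap n x y U M C) {P : ℤ} (hP : (U.card : ℤ) ≤ 2 * P) :
    ((wrapWords n U C P).card : ℤ) - (wrapWords n U C (P + 1)).card =
      ({S ∈ wrapWords n U C P | IsFusionWord n y U S} : Finset (Finset ℕ)).card := by
  have h1 := h.card_filter_wrapWords P (fun _ => True)
  have h2 := h.card_filter_wrapWords (P + 1) (fun _ => True)
  simp only [Finset.filter_true] at h1 h2
  have h3 := card_words_sub_card_words M C (P := P) (x := x) (y := y)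
    (by rw [h.card_U] at hP; push_cast at hP; omega)
  rw [Finset.sum_range_succ'] at h1
  rw [Finset.sum_range_succ] at h2
  have h4 : ∑ t ∈ Finset.range (x + y), (words M C (P - (x + y) + ((t + 1 : ℕ) : ℤ))).card =
      ∑ t ∈ Finset.range (x + y), (words M C (P + 1 - (x + y) + (t : ℤ))).card := by
    refine Finset.sum_congr rfl fun t _ => ?_
    congr 2
    push_cast
    ring
  have h5 : P + 1 - (x + y) + ((x + y : ℕ) : ℤ) = P + 1 := by push_cast; ring
  rw [h4, Nat.cast_zero, add_zero] at h1
  rw [h5] at h2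
  have h6 : ((wrapWords n U C P).card : ℤ) - (wrapWords n U C (P + 1)).card =
      (words M C (P - (x + y))).card - (words M C (P + 1)).card := by
    rw [h1, h2]
    push_cast
    ring
  rw [h6, h3, h.card_filter_wrapWords P, show x + y + 1 = 1 + y + x by ring,
    Finset.sum_range_add, Finset.sum_range_add, Finset.sum_range_one]
  have h7 : ∑ t ∈ Finset.range x, ({S ∈ words M C (P - (x + y) + ((1 + y + t : ℕ) : ℤ)) |
      IsFusionWord n y U (S ∪ wrapSet n x y (1 + y + t))} : Finset (Finset ℕ)).card = 0 := by
    refine Finset.sum_eq_zero fun t ht => ?_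
    rw [Finset.mem_range] at ht
    rw [Finset.card_eq_zero, Finset.filter_eq_empty_iff]
    exact fun S hS => h.not_isFusionWord (mem_words.1 hS).1.1 (by omega) (by omega)
  rw [h7]
  push_cast
  rw [add_zero, add_zero]
  congr 1
  · congr 2
    exact Finset.filter_congr fun S hS => (h.isFusionWord_zero (mem_words.1 hS).1.1).symm
  · refine Finset.sum_congr rfl fun u hu => ?_
    rw [Finset.mem_range] at hu
    rw [add_comm (u : ℤ) 1, add_comm 1 u]
    congr 2
    refine Finset.filter_congr fun S hS => ?_
    rw [h.isFusionWord_succ (mem_words.1 hS).1.1 (by omega), add_comm (u : ℤ) 1]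

end Wrap

/-! ### Intermediate partitions as words -/

section RowSets

variable {n k : ℕ} {l v : ℕ → ℕ}

/-- The number of boxes that are added in row `i`, if one is added in each row of `A`. -/
def ind (A : Finset ℕ) (i : ℕ) : ℕ := if i ∈ A then 1 else 0

/-- Adding one box in each row of `A` to the partition `l` gives a restricted partition `η` such
that `v / η` is a vertical strip. -/
def IsRowSet (n k : ℕ) (l v : ℕ → ℕ) (A : Finset ℕ) : Prop :=
  A ⊆ Finset.range n ∧ (∀ i < n, l i + ind A i ≤ v i ∧ v i ≤ l i + ind A i + 1) ∧
    (∀ i, i + 1 < n → l (i + 1) + ind A (i + 1) ≤ l i + ind A i) ∧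
    l 0 + ind A 0 ≤ l (n - 1) + ind A (n - 1) + k

/-- The rows in which `v / l` has one box. -/
def singleRows (n : ℕ) (l v : ℕ → ℕ) : Finset ℕ := {i ∈ Finset.range n | v i = l i + 1}

/-- The rows in which `v / l` has two boxes. -/
def doubleRows (n : ℕ) (l v : ℕ → ℕ) : Finset ℕ := {i ∈ Finset.range n | v i = l i + 2}

theorem mem_singleRows {i : ℕ} : i ∈ singleRows n l v ↔ i < n ∧ v i = l i + 1 := by
  simp [singleRows]

theorem mem_doubleRows {i : ℕ} : i ∈ doubleRows n l v ↔ i < n ∧ v i = l i + 2 := by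
  simp [doubleRows]

/-- The first and the last row of `l` and `v` are at the largest distance, and both have one box of
`v / l`. -/
def Wraps (n k : ℕ) (l v : ℕ → ℕ) : Prop :=
  0 ∈ singleRows n l v ∧ n - 1 ∈ singleRows n l v ∧ l 0 = l (n - 1) + k

/-- The only obstructions are between rows of equal length with one box each, where the lower box
cannot come first, and between the first and last rows at maximal width. All other neighbouring
conditions follow from those on l and v. -/
theorem isRowSet_union_iff (hn : 0 < n) (hl : Antitone l) (hv : Antitone v)
    (hlk : l 0 ≤ l (n - 1) + k) (hvk : v 0 ≤ v (n - 1) + k)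
    (hlv : ∀ i < n, l i ≤ v i ∧ v i ≤ l i + 2) {S : Finset ℕ} (hS : S ⊆ singleRows n l v) :
    IsRowSet n k l v (S ∪ doubleRows n l v) ↔
      IsWord (singleRows n l v) (fun i => l i = l (i + 1)) S ∧
        (Wraps n k l v → 0 ∈ S → n - 1 ∈ S) := by
  have hmem : ∀ i, i ∈ S → v i = l i + 1 := fun i hi => (mem_singleRows.1 (hS hi)).2
  have hind : ∀ i < n, (i ∈ S ∧ v i = l i + 1 ∧ ind (S ∪ doubleRows n l v) i = 1) ∨
      (i ∉ S ∧ v i = l i + 1 ∧ ind (S ∪ doubleRows n l v) i = 0) ∨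
      (i ∉ S ∧ v i = l i + 2 ∧ ind (S ∪ doubleRows n l v) i = 1) ∨
      (i ∉ S ∧ v i = l i ∧ ind (S ∪ doubleRows n l v) i = 0) := by
    intro i hi
    have h1 := hlv i hi
    have h2 := hmem i
    simp only [ind, Finset.mem_union, mem_doubleRows, hi, true_and]
    by_cases hiS : i ∈ S
    · simp [hiS, h2 hiS]
    · by_cases hd : v i = l i + 2
      · simp [hiS, hd]
      · simp only [hiS, hd, or_self, if_false, not_false_eq_true, true_and, false_and, and_true,
          false_or]
        omega
  constructor
  · rintro ⟨-, -, h3, h4⟩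
    refine ⟨⟨hS, fun i hC hi hi' hiS => ?_⟩, fun hW h0 => ?_⟩
    · rw [mem_singleRows] at hi hi'
      have h5 := h3 i hi'.1
      have h6 := hind i hi.1
      have h7 := hind (i + 1) hi'.1
      by_contra hne
      simp only [hne, hiS, not_true_eq_false, false_and, false_or, or_false, true_and,
        not_false_eq_true] at h6 h7
      omega
    · have h6 := hind 0 hn
      have h7 := hind (n - 1) (by omega)
      have h8 := (mem_singleRows.1 hW.2.1).2
      have h9 := hW.2.2
      by_contra hne
      simp only [hne, h0, not_true_eq_false, false_and, false_or, or_false, true_and,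
        not_false_eq_true] at h6 h7
      omega
  · rintro ⟨h1, h2⟩
    refine ⟨?_, fun i hi => ?_, fun i hi => ?_, ?_⟩
    · intro i hi
      rw [Finset.mem_union, mem_doubleRows] at hi
      rw [Finset.mem_range]
      rcases hi with hi | hi
      · exact (mem_singleRows.1 (hS hi)).1
      · exact hi.1
    · have := hind i hi
      omega
    · have h5 := hl (Nat.le_succ i)
      have h6 := hv (Nat.le_succ i)
      have h7 := hind i (by omega)
      have h8 := hind (i + 1) hi
      have h9 := h1.2 i
      simp only [mem_singleRows] at h9
      simp only [Nat.succ_eq_add_one] at h5 h6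
      by_cases hiS : i + 1 ∈ S <;> by_cases hiS' : i ∈ S <;>
        simp only [hiS, hiS', not_true_eq_false, false_and, false_or, or_false, true_and,
          not_false_eq_true] at h7 h8
      · omega
      · by_contra hcon
        exact hiS' (h9 (by omega) (by omega) (by omega) hiS)
      · omega
      · omega
    · have h7 := hind 0 hn
      have h8 := hind (n - 1) (by omega)
      by_cases h0 : 0 ∈ S <;> by_cases h0' : n - 1 ∈ S <;>
        simp only [h0, h0', not_true_eq_false, false_and, false_or, or_false, true_and,
          not_false_eq_true] at h7 h8
      · omega
      · by_contra hcon
        refine h0' (h2 ⟨?_, ?_, ?_⟩ h0)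
        · rw [mem_singleRows]
          omega
        · rw [mem_singleRows]
          omega
        · omega
      · omega
      · omega

theorem IsRowSet.doubleRows_subset {A : Finset ℕ} (h : IsRowSet n k l v A) :
    doubleRows n l v ⊆ A := by
  intro i hi
  rw [mem_doubleRows] at hi
  have h1 := (h.2.1 i hi.1).2
  by_contra hne
  simp only [ind, hne, if_false] at h1
  omega

theorem IsRowSet.inter_union {A : Finset ℕ} (h : IsRowSet n k l v A) :
    (A ∩ singleRows n l v) ∪ doubleRows n l v = A := by
  ext i
  rw [Finset.mem_union, Finset.mem_inter]
  constructor
  · rintro (hi | hi)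
    · exact hi.1
    · exact h.doubleRows_subset hi
  · intro hi
    have hin := Finset.mem_range.1 (h.1 hi)
    have h1 := h.2.1 i hin
    simp only [ind, hi, if_true] at h1
    rw [mem_singleRows, mem_doubleRows]
    by_cases h2 : v i = l i + 1
    · exact Or.inl ⟨hi, hin, h2⟩
    · exact Or.inr ⟨hin, by omega⟩

theorem disjoint_singleRows_doubleRows : Disjoint (singleRows n l v) (doubleRows n l v) := by
  rw [Finset.disjoint_left]
  intro i hi hi'
  rw [mem_singleRows] at hi
  rw [mem_doubleRows] at hi'
  omega

open Classical in
/-- The sets `A` of rows as in `IsRowSet` with `s` elements. -/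
noncomputable def rowSets (n k : ℕ) (l v : ℕ → ℕ) (s : ℕ) : Finset (Finset ℕ) :=
  {A ∈ (Finset.range n).powerset | IsRowSet n k l v A ∧ A.card = s}

theorem mem_rowSets {s : ℕ} {A : Finset ℕ} :
    A ∈ rowSets n k l v s ↔ IsRowSet n k l v A ∧ A.card = s := by
  simp only [rowSets, Finset.mem_filter, Finset.mem_powerset, and_iff_right_iff_imp]
  exact fun h => h.1.1

open Classical in
theorem card_filter_rowSets (hn : 0 < n) (hl : Antitone l) (hv : Antitone v)
    (hlk : l 0 ≤ l (n - 1) + k) (hvk : v 0 ≤ v (n - 1) + k)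
    (hlv : ∀ i < n, l i ≤ v i ∧ v i ≤ l i + 2) (s : ℕ) (Q : Finset ℕ → Prop) :
    ({A ∈ rowSets n k l v s | Q (A ∩ singleRows n l v)} : Finset (Finset ℕ)).card =
      ({S ∈ words (singleRows n l v) (fun i => l i = l (i + 1)) (s - (doubleRows n l v).card) |
        (Wraps n k l v → 0 ∈ S → n - 1 ∈ S) ∧ Q S} : Finset (Finset ℕ)).card := by
  have hcard : ∀ {S : Finset ℕ}, S ⊆ singleRows n l v →
      (S ∪ doubleRows n l v).card = S.card + (doubleRows n l v).card := fun hS =>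
    Finset.card_union_of_disjoint (disjoint_singleRows_doubleRows.mono_left hS)
  refine Finset.card_bij (fun A _ => A ∩ singleRows n l v) ?_ ?_ ?_
  · intro A hA
    rw [Finset.mem_filter, mem_rowSets] at hA
    have h1 := hA.1.1.inter_union
    have h2 := hA.1.1
    rw [← h1, isRowSet_union_iff hn hl hv hlk hvk hlv Finset.inter_subset_right] at h2
    rw [Finset.mem_filter, mem_words]
    refine ⟨⟨h2.1, ?_⟩, h2.2, hA.2⟩
    have h3 := hcard (S := A ∩ singleRows n l v) Finset.inter_subset_right
    rw [h1, hA.1.2] at h3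
    rw [h3]
    push_cast
    ring
  · intro A hA A' hA' he
    rw [Finset.mem_filter, mem_rowSets] at hA hA'
    rw [← hA.1.1.inter_union, he, hA'.1.1.inter_union]
  · intro S hS
    rw [Finset.mem_filter, mem_words] at hS
    have hS' := hS.1.1.1
    have h1 : (S ∪ doubleRows n l v) ∩ singleRows n l v = S := by
      rw [Finset.union_inter_distrib_right, Finset.inter_eq_left.2 hS',
        Finset.disjoint_iff_inter_eq_empty.1 disjoint_singleRows_doubleRows.symm,
        Finset.union_empty]
    refine ⟨S ∪ doubleRows n l v, ?_, h1⟩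
    rw [Finset.mem_filter, mem_rowSets, isRowSet_union_iff hn hl hv hlk hvk hlv hS', h1]
    refine ⟨⟨⟨hS.1.1, hS.2.1⟩, ?_⟩, hS.2.2⟩
    have := hcard hS'
    have := hS.1.2
    omega

theorem eq_Ico_of_upper {T : Finset ℕ} (hT : T ⊆ Finset.range n)
    (h : ∀ i ∈ T, i + 1 < n → i + 1 ∈ T) : T = Finset.Ico (n - T.card) n := by
  have hup : ∀ d, ∀ i ∈ T, i + d < n → i + d ∈ T := by
    intro d
    induction d with
    | zero => exact fun i hi _ => hi
    | succ d ih => exact fun i hi hd => h (i + d) (ih i hi (by omega)) hd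
  have hcard : T.card ≤ n := by simpa using Finset.card_le_card hT
  apply Finset.eq_of_subset_of_card_le
  · intro i hi
    have h1 := Finset.mem_range.1 (hT hi)
    have h2 : Finset.Ico i n ⊆ T := by
      intro j hj
      rw [Finset.mem_Ico] at hj
      have := hup (j - i) i hi (by omega)
      rwa [show i + (j - i) = j by omega] at this
    have h3 := Finset.card_le_card h2
    rw [Nat.card_Ico] at h3
    rw [Finset.mem_Ico]
    omega
  · rw [Nat.card_Ico]
    omega

/-- The low chain consists of the single rows of length l 0, the high chain of those of length l (n
- 1). Monotonicity of l and v leaves no gaps in them. -/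
theorem Wraps.exists_isWrap (hn : 0 < n) (hk : 0 < k) (hl : Antitone l) (hv : Antitone v)
    (hW : Wraps n k l v) : ∃ x y M,
      IsWrap n x y (singleRows n l v) M (fun i => l i = l (i + 1)) ∧
        ∀ i, i < y ↔ i ∈ singleRows n l v ∧ l i = l 0 := by
  obtain ⟨h0, h1, h2⟩ := hW
  rw [mem_singleRows] at h0 h1
  set U := singleRows n l v with hU
  have hY : {i ∈ U | l i = l 0} = Finset.Ico 0 (0 + ({i ∈ U | l i = l 0} : Finset ℕ).card) := by
    apply eq_Ico_of_lower (b := n)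
    · intro i hi
      rw [Finset.mem_filter, hU, mem_singleRows] at hi
      simp [hi.1.1]
    · intro i _ hi
      rw [Finset.mem_filter, hU, mem_singleRows] at hi ⊢
      have h3 := hl (Nat.zero_le i)
      have h4 := hl (Nat.le_succ i)
      have h5 := hv (Nat.zero_le i)
      have h6 := hv (Nat.le_succ i)
      simp only [Nat.succ_eq_add_one] at h4 h6
      omega
  have hX : {i ∈ U | l i = l (n - 1)} =
      Finset.Ico (n - ({i ∈ U | l i = l (n - 1)} : Finset ℕ).card) n := by
    apply eq_Ico_of_upper
    · intro i hi
      rw [Finset.mem_filter, hU, mem_singleRows] at hi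
      simp [hi.1.1]
    · intro i hi hin
      rw [Finset.mem_filter, hU, mem_singleRows] at hi ⊢
      have h3 := hl (show i + 1 ≤ n - 1 by omega)
      have h4 := hl (Nat.le_succ i)
      have h5 := hv (show i + 1 ≤ n - 1 by omega)
      have h6 := hv (Nat.le_succ i)
      simp only [Nat.succ_eq_add_one] at h4 h6
      omega
  have hxn : ({i ∈ U | l i = l (n - 1)} : Finset ℕ).card ≤ n := by
    have : {i ∈ U | l i = l (n - 1)} ⊆ Finset.range n := by
      intro i hi
      rw [Finset.mem_filter, hU, mem_singleRows] at hi
      simp [hi.1.1]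
    simpa using Finset.card_le_card this
  generalize ({i ∈ U | l i = l 0} : Finset ℕ).card = y at hY
  generalize ({i ∈ U | l i = l (n - 1)} : Finset ℕ).card = x at hX hxn
  have hY' : ∀ i, i < y ↔ i ∈ U ∧ l i = l 0 := by
    intro i
    have := Finset.ext_iff.1 hY i
    simp only [Finset.mem_filter, Finset.mem_Ico, Nat.zero_le, true_and, zero_add] at this
    exact this.symm
  have hX' : ∀ i, (n ≤ i + x ∧ i < n) ↔ i ∈ U ∧ l i = l (n - 1) := by
    intro i
    have := Finset.ext_iff.1 hX i
    rw [Finset.mem_filter, Finset.mem_Ico] at this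
    rw [this]
    omega
  have hUn : ∀ i ∈ U, i < n := fun i hi => (mem_singleRows.1 hi).1
  refine ⟨x, y, {i ∈ U | l i ≠ l 0 ∧ l i ≠ l (n - 1)}, ?_, hY'⟩
  constructor
  · have := (hX' (n - 1)).2 ⟨mem_singleRows.2 h1, rfl⟩
    omega
  · exact (hY' 0).2 ⟨mem_singleRows.2 h0, rfl⟩
  -- A row in both chains would have both extreme lengths, which differ by k > 0.
  · by_contra hlt
    have h3 := (hX' (n - 1)).2 ⟨mem_singleRows.2 h1, rfl⟩
    have h4 := (hX' (n - x)).1 (by omega)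
    have h5 := (hY' (n - x)).1 (by omega)
    omega
  · intro i hi
    rw [Finset.mem_filter] at hi
    have h3 := hUn i hi.1
    have h4 : ¬ i < y := fun h => hi.2.1 ((hY' i).1 h).2
    have h5 : ¬ (n ≤ i + x ∧ i < n) := fun h => hi.2.2 ((hX' i).1 h).2
    omega
  · intro i
    rw [hX', hY', Finset.mem_filter]
    tauto
  · intro i hi
    have h3 := (hY' i).1 (by omega)
    have h4 := (hY' (i + 1)).1 hi
    rw [h3.2, h4.2]
  · intro i hi hi'
    have h3 := (hX' i).1 (by omega)
    have h4 := (hX' (i + 1)).1 (by omega)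
    rw [h3.2, h4.2]
  · intro i hi hiU hC
    have h3 := (hY' i).1 (by omega)
    have h4 := (hY' (i + 1)).2 ⟨hiU, hC ▸ h3.2⟩
    omega
  · intro i hi hiU hC
    by_cases hx0 : x = 0
    · have := (hX' (n - 1)).2 ⟨mem_singleRows.2 h1, rfl⟩
      omega
    have h3 := (hX' (i + 1)).1 (by omega)
    have h4 := (hX' i).2 ⟨hiU, hC.trans h3.2⟩
    omega

/-- The right parentheses of the word of `A` are paired, and the word is not exceptional. -/
def IsFusionRowSet (n k : ℕ) (l v : ℕ → ℕ) (A : Finset ℕ) : Prop :=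
  (∀ i, 0 ≤ height (singleRows n l v) (A ∩ singleRows n l v) i) ∧
    ¬ (Wraps n k l v ∧ (∃ i ∈ singleRows n l v, l i = l 0 ∧ i ∉ A) ∧
      ∀ i < n, ¬ (i ∈ singleRows n l v ∧ l i = l 0) →
        0 < height (singleRows n l v) (A ∩ singleRows n l v) i)

-- If l and v do not wrap, this is the classical cancellation, i.e. `card_words_sub_card_words` with
-- x = y = 0; otherwise it is the count on the cyclic chain.
open Classical in
theorem card_rowSets_sub (hn : 0 < n) (hk : 0 < k) (hl : Antitone l) (hv : Antitone v)
    (hlk : l 0 ≤ l (n - 1) + k) (hvk : v 0 ≤ v (n - 1) + k) {s q : ℕ}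
    (hsum : ∑ i ∈ Finset.range n, v i = ∑ i ∈ Finset.range n, l i + (s + q)) (hq : q ≤ s) :
    ((rowSets n k l v s).card : ℤ) - (rowSets n k l v (s + 1)).card =
      ({A ∈ rowSets n k l v s | IsFusionRowSet n k l v A} : Finset (Finset ℕ)).card := by
  by_cases hlv : ∀ i < n, l i ≤ v i ∧ v i ≤ l i + 2
  swap
  · have hempty : ∀ s, rowSets n k l v s = ∅ := by
      intro s
      rw [Finset.eq_empty_iff_forall_notMem]
      intro A hA
      rw [mem_rowSets] at hA
      apply hlv
      intro i hi
      have h1 := hA.1.2.1 i hi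
      simp only [ind] at h1
      split_ifs at h1 <;> omega
    simp [hempty]
  set U := singleRows n l v with hU
  set D := doubleRows n l v with hD
  -- With q ≤ s this gives |U| ≤ 2 (s - |D|): at least half of the parentheses are left ones, as the
  -- cancellation requires.
  have hcount : U.card + 2 * D.card = s + q := by
    have h1 : ∑ i ∈ Finset.range n, v i = ∑ i ∈ Finset.range n,
        (l i + ((if v i = l i + 1 then 1 else 0) + 2 * if v i = l i + 2 then 1 else 0)) := by
      refine Finset.sum_congr rfl fun i hi => ?_
      have := hlv i (Finset.mem_range.1 hi)
      split_ifs <;> omega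
    rw [Finset.sum_add_distrib, Finset.sum_add_distrib, ← Finset.mul_sum, Finset.sum_boole,
      Finset.sum_boole, hsum] at h1
    simp only [Nat.cast_id] at h1
    have h2 : U.card = ({i ∈ Finset.range n | v i = l i + 1} : Finset ℕ).card := rfl
    have h3 : D.card = ({i ∈ Finset.range n | v i = l i + 2} : Finset ℕ).card := rfl
    omega
  have hT := card_filter_rowSets hn hl hv hlk hvk hlv
  have h1 := hT s (fun _ => True)
  have h2 := hT (s + 1) (fun _ => True)
  simp only [Finset.filter_true, and_true] at h1 h2
  rw [← hU, ← hD] at h1 h2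
  by_cases hW : Wraps n k l v
  · obtain ⟨x, y, M, hwrap, hy⟩ := hW.exists_isWrap hn hk hl hv
    rw [← hU] at hwrap hy
    have h3 := hwrap.card_wrapWords_sub (P := (s : ℤ) - D.card) (by omega)
    have h4 : ∀ s, ({S ∈ words U (fun i => l i = l (i + 1)) s |
        Wraps n k l v → 0 ∈ S → n - 1 ∈ S} : Finset (Finset ℕ)) = wrapWords n U (fun i => l i = l (i + 1)) s := by
      intro s
      rw [wrapWords]
      exact Finset.filter_congr fun S _ => by simp [hW]
    rw [h4] at h1 h2
    rw [h1, h2, show ((s + 1 : ℕ) : ℤ) - D.card = s - D.card + 1 by push_cast; ring, h3]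
    have h5 := hT s (IsFusionWord n y U)
    rw [← hU, ← hD] at h5
    have h6 : ({A ∈ rowSets n k l v s | IsFusionRowSet n k l v A} : Finset (Finset ℕ)) =
        {A ∈ rowSets n k l v s | IsFusionWord n y U (A ∩ U)} := by
      refine Finset.filter_congr fun A _ => ?_
      rw [IsFusionRowSet, IsFusionWord, ← hU]
      simp only [hW, true_and]
      refine and_congr_right fun _ => not_congr (and_congr ?_ ?_)
      · constructor
        · rintro ⟨i, h7, h8, h9⟩
          exact ⟨i, (hy i).2 ⟨h7, h8⟩, fun h => h9 (Finset.mem_inter.1 h).1⟩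
        · rintro ⟨i, h7, h8⟩
          have h9 := (hy i).1 h7
          exact ⟨i, h9.1, h9.2, fun h => h8 (Finset.mem_inter.2 ⟨h, h9.1⟩)⟩
      · constructor
        · exact fun h i hi hin => h i hin fun h' => by have := (hy i).2 h'; omega
        · exact fun h i hin hi => h i (by by_contra h'; exact hi ((hy i).1 (by omega))) hin
    rw [h6, h5, ← Finset.filter_filter, h4]
  · have h4 : ∀ s, ({S ∈ words U (fun i => l i = l (i + 1)) s |
        Wraps n k l v → 0 ∈ S → n - 1 ∈ S} : Finset (Finset ℕ)) = words U (fun i => l i = l (i + 1)) s := fun s =>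
      Finset.filter_true_of_mem fun S _ h => absurd h hW
    rw [h4] at h1 h2
    have h3 := card_words_sub_card_words U (fun i => l i = l (i + 1)) (P := (s : ℤ) - D.card)
      (x := 0) (y := 0) (by push_cast; omega)
    simp only [CharP.cast_eq_zero, add_zero, sub_zero, neg_zero, Finset.range_zero,
      Finset.sum_empty] at h3
    rw [h1, h2, show ((s + 1 : ℕ) : ℤ) - D.card = s - D.card + 1 by push_cast; ring, h3]
    have h5 := hT s (fun S => ∀ i, 0 ≤ height U S i)
    rw [← hU, ← hD] at h5
    have h6 : ({A ∈ rowSets n k l v s | IsFusionRowSet n k l v A} : Finset (Finset ℕ)) =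
        {A ∈ rowSets n k l v s | ∀ i, 0 ≤ height U (A ∩ U) i} := by
      refine Finset.filter_congr fun A _ => ?_
      rw [IsFusionRowSet, ← hU]
      simp [hW]
    rw [h6, h5, ← Finset.filter_filter, h4]

end RowSets

/-! ### Words of labels -/

section Labels

/-- The label of the box that is added in row `i` to the partition `f`. -/
def rowContent (f : ℕ → ℕ) (i : ℕ) : ℤ := (f i : ℤ) - i

theorem rowContent_strictAnti {f : ℕ → ℕ} (hf : Antitone f) : StrictAnti (rowContent f) := by
  intro i j hij
  have := hf hij.le
  simp only [rowContent]
  omega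

theorem card_filter_image_rowContent {f : ℕ → ℕ} (hf : Antitone f) (A : Finset ℕ) (Q : ℤ → Prop)
    [DecidablePred Q] :
    ({x ∈ A.image (rowContent f) | Q x} : Finset ℤ).card =
      ({j ∈ A | Q (rowContent f j)} : Finset ℕ).card := by
  rw [Finset.filter_image, Finset.card_image_of_injective _ (rowContent_strictAnti hf).injective]

/-- Adding one box in each row of `A` to the partition `l` gives the partition `e`, and adding one
box in each row of `B` to `e` gives the partition `v`. -/
structure IsStripPair (n : ℕ) (l e v : ℕ → ℕ) (A B : Finset ℕ) : Prop where
  left_subset : A ⊆ Finset.range n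
  right_subset : B ⊆ Finset.range n
  antitone_l : Antitone l
  antitone_e : Antitone e
  antitone_v : Antitone v
  e_eq : ∀ i, e i = l i + ind A i
  v_eq : ∀ i, v i = e i + ind B i

/-- The number of left minus the number of right parentheses in the rows from `i` on. -/
def balance (A B : Finset ℕ) (i : ℕ) : ℤ :=
  (({j ∈ A | i ≤ j} : Finset ℕ).card : ℤ) - ({j ∈ B | i ≤ j} : Finset ℕ).card

theorem card_filter_le_eq_add (A : Finset ℕ) (i : ℕ) :
    ({j ∈ A | i ≤ j} : Finset ℕ).card = ({j ∈ A | i + 1 ≤ j} : Finset ℕ).card + ind A i := by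
  rw [ind]
  split_ifs with h
  · rw [filter_le_eq_insert h, Finset.card_insert_of_notMem (by simp)]
  · congr 1
    refine Finset.filter_congr fun j hj => ?_
    have : j ≠ i := fun h' => h (h' ▸ hj)
    omega

theorem balance_eq_add (A B : Finset ℕ) (i : ℕ) :
    balance A B i = balance A B (i + 1) + ind A i - ind B i := by
  simp only [balance, card_filter_le_eq_add _ i]
  push_cast
  ring

variable {n : ℕ} {l e v : ℕ → ℕ} {A B : Finset ℕ}

theorem IsStripPair.balance_eq_zero (h : IsStripPair n l e v A B) {i : ℕ} (hi : n ≤ i) :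
    balance A B i = 0 := by
  have hz : ∀ {T : Finset ℕ}, T ⊆ Finset.range n → ({j ∈ T | i ≤ j} : Finset ℕ).card = 0 := by
    intro T hT
    rw [Finset.card_eq_zero, Finset.filter_eq_empty_iff]
    intro j hj
    have := Finset.mem_range.1 (hT hj)
    omega
  simp [balance, hz h.left_subset, hz h.right_subset]

/-- A row with two boxes belongs to both A and B, so it cancels in the balance and can be omitted
from the word. -/
theorem IsStripPair.height_eq_balance (h : IsStripPair n l e v A B) (i : ℕ) :
    height (singleRows n l v) (A ∩ singleRows n l v) i = balance A B i := by
  by_cases hi : n ≤ i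
  · rw [h.balance_eq_zero hi, height_of_forall_lt]
    intro j hj
    have := (mem_singleRows.1 hj).1
    omega
  · push Not at hi
    induction hi.le using Nat.decreasingInduction with
    | self => omega
    | of_succ i hin ih =>
      have hs : height (singleRows n l v) (A ∩ singleRows n l v) (i + 1) = balance A B (i + 1) := by
        rcases Nat.lt_or_ge (i + 1) n with h1 | h1
        · exact ih h1
        · rw [h.balance_eq_zero h1, height_of_forall_lt]
          intro j hj
          have := (mem_singleRows.1 hj).1
          omega
      rw [height_eq_add, balance_eq_add, hs]
      have h1 := h.e_eq i
      have h2 := h.v_eq i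
      simp only [Finset.mem_inter, mem_singleRows, hin, true_and]
      by_cases hA : i ∈ A <;> by_cases hB : i ∈ B <;>
        simp only [ind, hA, hB, if_true, if_false] at h1 h2 ⊢
      · rw [if_neg (by omega)]; simp
      · rw [if_pos (by omega)]; simp [h2, h1]
      · rw [if_pos (by omega)]; simp; ring
      · rw [if_neg (by omega)]; simp

/-! #### Counting the labels up to a right parenthesis -/

theorem IsStripPair.card_right_le (h : IsStripPair n l e v A B) (i : ℕ) :
    ({x ∈ B.image (rowContent e) | x ≤ rowContent e i} : Finset ℤ).card =
      ({j ∈ B | i ≤ j} : Finset ℕ).card := by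
  rw [card_filter_image_rowContent h.antitone_e]
  congr 1
  exact Finset.filter_congr fun j _ => (rowContent_strictAnti h.antitone_e).le_iff_ge

theorem IsStripPair.rowContent_le (h : IsStripPair n l e v A B) (i : ℕ) :
    rowContent l i ≤ rowContent e i := by
  have := h.e_eq i
  simp only [rowContent]
  omega

/-- Only an inequality: if row i is in A, its second label is one larger than its first and may also
reach the left label of row i - 1. -/
theorem IsStripPair.le_card_left_le (h : IsStripPair n l e v A B) (i : ℕ) :
    ({j ∈ A | i ≤ j} : Finset ℕ).card ≤
      ({x ∈ A.image (rowContent l) | x ≤ rowContent e i} : Finset ℤ).card := by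
  rw [card_filter_image_rowContent h.antitone_l]
  refine Finset.card_le_card fun j hj => ?_
  rw [Finset.mem_filter] at hj ⊢
  exact ⟨hj.1, ((rowContent_strictAnti h.antitone_l).le_iff_ge.2 hj.2).trans (h.rowContent_le i)⟩

theorem IsStripPair.card_left_le (h : IsStripPair n l e v A B) {i : ℕ} (hi : i ∉ A) :
    ({x ∈ A.image (rowContent l) | x ≤ rowContent e i} : Finset ℤ).card =
      ({j ∈ A | i ≤ j} : Finset ℕ).card := by
  rw [card_filter_image_rowContent h.antitone_l]
  congr 1
  have h1 : rowContent e i = rowContent l i := by simp [rowContent, h.e_eq i, ind, hi]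
  rw [h1]
  exact Finset.filter_congr fun j _ => (rowContent_strictAnti h.antitone_l).le_iff_ge

/-- Labels increase as rows go up, so both sides count from the bottom. At a row of B outside A the
counts agree exactly; at a row of both sets the contributions to the balance cancel and the row
below decides. -/
theorem IsStripPair.forall_card_le_iff (h : IsStripPair n l e v A B) :
    (∀ b ∈ B.image (rowContent e), ({x ∈ B.image (rowContent e) | x ≤ b} : Finset ℤ).card ≤
      ({x ∈ A.image (rowContent l) | x ≤ b} : Finset ℤ).card) ↔ ∀ i, 0 ≤ balance A B i := by
  constructor
  · intro h1 i
    by_cases hi : n ≤ i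
    · rw [h.balance_eq_zero hi]
    · push Not at hi
      induction hi.le using Nat.decreasingInduction with
      | self => omega
      | of_succ i hin ih =>
        have hs : 0 ≤ balance A B (i + 1) := by
          rcases Nat.lt_or_ge (i + 1) n with h2 | h2
          · exact ih h2
          · rw [h.balance_eq_zero h2]
        by_cases hB : i ∈ B
        · by_cases hA : i ∈ A
          · rw [balance_eq_add, ind, ind, if_pos hA, if_pos hB]
            omega
          · have h2 := h1 _ (Finset.mem_image_of_mem _ hB)
            rw [h.card_right_le, h.card_left_le hA] at h2
            rw [balance]
            omega
        · rw [balance_eq_add, ind, ind, if_neg hB]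
          omega
  · intro h1 b hb
    obtain ⟨i, hi, rfl⟩ := Finset.mem_image.1 hb
    have h2 := h1 i
    rw [balance] at h2
    have h3 := h.le_card_left_le i
    rw [h.card_right_le]
    omega

/-! #### Ranks in decreasing sequences -/

theorem succ_le_card_filter_image_iff {p : ℕ} {f : Fin p → ℤ} (hf : StrictAnti f) (i : Fin p)
    (c : ℤ) : (i : ℕ) + 1 ≤ ({x ∈ Finset.univ.image f | x ≤ c} : Finset ℤ).card ↔ f i.rev ≤ c := by
  rw [Finset.filter_image, Finset.card_image_of_injective _ hf.injective]
  constructor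
  · intro h
    by_contra hc
    have h1 : ({j | f j ≤ c} : Finset (Fin p)) ⊆ Finset.Ioi i.rev := by
      intro j hj
      simp only [Finset.mem_filter, Finset.mem_univ, true_and] at hj
      rw [Finset.mem_Ioi]
      by_contra hle
      exact hc ((hf.antitone (not_lt.1 hle)).trans hj)
    have h2 := Finset.card_le_card h1
    rw [Fin.card_Ioi, Fin.val_rev] at h2
    omega
  · intro h
    have h1 : Finset.Ici i.rev ⊆ ({j | f j ≤ c} : Finset (Fin p)) := by
      intro j hj
      simp only [Finset.mem_filter, Finset.mem_univ, true_and]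
      exact (hf.antitone (Finset.mem_Ici.1 hj)).trans h
    have h2 := Finset.card_le_card h1
    rw [Fin.card_Ici, Fin.val_rev] at h2
    omega

/-- Dominance of sorted lists in terms of counting functions; this turns "fits" into the ballot
condition on parentheses. -/
theorem forall_rev_le_rev_iff {p q : ℕ} {f : Fin p → ℤ} {g : Fin q → ℤ} (hf : StrictAnti f)
    (hg : StrictAnti g) (hqp : q ≤ p) : (∀ i : Fin q, f (i.castLE hqp).rev ≤ g i.rev) ↔
      ∀ b ∈ Finset.univ.image g, ({x ∈ Finset.univ.image g | x ≤ b} : Finset ℤ).card ≤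
        ({x ∈ Finset.univ.image f | x ≤ b} : Finset ℤ).card := by
  have hcard : ∀ i : Fin q,
      ({x ∈ Finset.univ.image g | x ≤ g i.rev} : Finset ℤ).card = (i : ℕ) + 1 := by
    intro i
    rw [Finset.filter_image, Finset.card_image_of_injective _ hg.injective]
    have : ({j | g j ≤ g i.rev} : Finset (Fin q)) = Finset.Ici i.rev := by
      ext j
      simp [hg.le_iff_ge]
    rw [this, Fin.card_Ici, Fin.val_rev]
    omega
  simp only [Finset.mem_image, Finset.mem_univ, true_and, forall_exists_index,
    forall_apply_eq_imp_iff]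
  rw [← Fin.revPerm.forall_congr_right]
  refine forall_congr' fun i => ?_
  rw [← succ_le_card_filter_image_iff hf]
  have := hcard i.rev
  simp only [Fin.rev_rev, Fin.revPerm_apply, Fin.val_castLE] at this ⊢
  rw [this]

end Labels

/-! ### Exceptional words -/

section Exceptional

variable {n : ℕ} {l e v : ℕ → ℕ} {A B : Finset ℕ}

theorem IsStripPair.cases (h : IsStripPair n l e v A B) (i : ℕ) :
    (i ∈ A ∧ i ∈ B ∧ e i = l i + 1 ∧ v i = l i + 2) ∨
    (i ∈ A ∧ i ∉ B ∧ e i = l i + 1 ∧ v i = l i + 1) ∨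
    (i ∉ A ∧ i ∈ B ∧ e i = l i ∧ v i = l i + 1) ∨
    (i ∉ A ∧ i ∉ B ∧ e i = l i ∧ v i = l i) := by
  have h1 := h.e_eq i
  have h2 := h.v_eq i
  by_cases hA : i ∈ A <;> by_cases hB : i ∈ B <;>
    simp only [ind, hA, hB, if_true, if_false] at h1 h2 <;> simp [hA, hB] <;> omega

theorem IsStripPair.mem_iff (h : IsStripPair n l e v A B) (i : ℕ) :
    (i ∈ A ↔ e i = l i + 1) ∧ (i ∈ B ↔ v i = e i + 1) := by
  rcases h.cases i with h1 | h1 | h1 | h1 <;> simp [h1]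

/-- If the topmost box of the second strip in the last column is in a row with two boxes, its right
parenthesis is paired with the left one of the lowest such row. -/
theorem IsStripPair.paired_of_double (h : IsStripPair n l e v A B) {c i₀ i₁ : ℕ}
    (hl0 : l 0 = c) (hv0 : v 0 = c + 1) (hi₀ : i₀ ∈ B) (he₀ : e i₀ = c) (hl₀ : i₀ ∈ A)
    (htop : ∀ j ∈ B, e j = c → i₀ ≤ j) (hv₁ : v i₁ = c + 1) (hle : i₀ ≤ i₁)
    (hlow : ∀ j ∈ B, e j = c → j ≤ i₁) :
    Paired (A.image (rowContent l)) (B.image (rowContent e)) ((c : ℤ) - i₁ - 1) (c - i₀) := by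
  have hrow : ∀ j, j ≤ i₁ → v j = c + 1 := by
    intro j hj
    have h1 := h.antitone_v hj
    have h2 := h.antitone_v (Nat.zero_le j)
    omega
  have hl₀' : l i₀ + 1 = c := by
    have := (h.mem_iff i₀).1.1 hl₀
    omega
  have hdouble : ∀ j, i₀ ≤ j → j ≤ i₁ → j ∈ A ∧ j ∈ B ∧ e j = c ∧ l j + 1 = c := by
    intro j h1 h2
    have h3 := hrow j h2
    have h4 := h.antitone_l h1
    have h5 := h.cases j
    rw [(h.mem_iff j).1, (h.mem_iff j).2]
    omega
  have habove : ∀ j, j < i₀ → l j = c := by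
    intro j hj
    have h1 := hrow j (by omega)
    have h2 := h.antitone_l hj.le
    have h4 := h.antitone_l (Nat.zero_le j)
    have h3 := h.cases j
    by_contra hne
    have h5 : j ∈ B ∧ e j = c := by
      rw [(h.mem_iff j).2]
      omega
    have := htop j h5.1 h5.2
    omega
  -- Rows i₀ to i₁ all have two boxes, and the right label of row j is the left label of row j - 1.
  -- So every label strictly between the two parentheses carries an adjacent pair `()`.
  have hright : ∀ x ∈ B.image (rowContent e), (c : ℤ) - i₁ - 1 ≤ x → x < c - i₀ →
      x ∈ A.image (rowContent l) ∧ (c : ℤ) - i₁ - 1 < x := by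
    intro x hx h1 h2
    obtain ⟨j, hj, rfl⟩ := Finset.mem_image.1 hx
    have h3 : j ≤ i₁ := by
      by_contra h4
      have h5 := h.antitone_e (show i₀ ≤ j by omega)
      have h6 := mt (hlow j hj)
      simp only [rowContent] at h1
      omega
    have h4 : i₀ < j := by
      by_contra h4
      have h5 := h.antitone_e (show j ≤ i₀ by omega)
      simp only [rowContent] at h2
      omega
    have h5 := hdouble j h4.le h3
    have h6 := hdouble (j - 1) (by omega) (by omega)
    refine ⟨Finset.mem_image.2 ⟨j - 1, h6.1, ?_⟩, ?_⟩
    · simp only [rowContent]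
      omega
    · simp only [rowContent]
      omega
  have hleft : ∀ x ∈ A.image (rowContent l), (c : ℤ) - i₁ - 1 < x → x ≤ c - i₀ →
      x ∈ B.image (rowContent e) ∧ x < (c : ℤ) - i₀ := by
    intro x hx h1 h2
    obtain ⟨j, hj, rfl⟩ := Finset.mem_image.1 hx
    simp only [rowContent] at h1 h2
    have h3 : i₀ ≤ j := by
      by_contra h4
      have h5 := habove j (by omega)
      omega
    have h4 := h.antitone_l h3
    have h5 := hdouble j h3 (by omega)
    have h6 := hdouble (j + 1) (by omega) (by omega)
    refine ⟨Finset.mem_image.2 ⟨j + 1, h6.2.1, ?_⟩, ?_⟩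
    · simp only [rowContent]
      push_cast
      omega
    · simp only [rowContent]
      omega
  refine ⟨?_, ?_, by omega, ?_, fun y hy h1 h2 => ?_⟩
  · have h1 := hdouble i₁ hle le_rfl
    exact Finset.mem_image.2 ⟨i₁, h1.1, by simp only [rowContent]; omega⟩
  · exact Finset.mem_image.2 ⟨i₀, hi₀, by simp only [rowContent]; omega⟩
  · congr 1
    ext x
    simp only [Finset.mem_filter]
    constructor
    · rintro ⟨h1, h2, h3⟩
      exact ⟨(hright x h1 h2 h3).1, (hright x h1 h2 h3).2, h3.le⟩
    · rintro ⟨h1, h2, h3⟩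
      exact ⟨(hleft x h1 h2 h3).1, h2.le, (hleft x h1 h2 h3).2⟩
  · refine Finset.card_le_card fun x hx => ?_
    simp only [Finset.mem_filter] at hx ⊢
    have h3 := hright x hx.1 hx.2.1 (hx.2.2.trans_lt h2)
    exact ⟨h3.1, h3.2, hx.2.2⟩

/-- If row i₁ reaches the last column with its first possible box, the label c - i₁ - 1 is not a
left one. Otherwise rows with two boxes lie between i₀ and i₁, and the topmost of them closes that
left parenthesis before c - i₀. -/
theorem IsStripPair.not_paired_of_single (h : IsStripPair n l e v A B) {c i₀ i₁ : ℕ}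
    (hl0 : l 0 = c) (hv0 : v 0 = c + 1) (he₀ : l i₀ = c) (hv₁ : v i₁ = c + 1)
    (hlow : ∀ j ∈ A, l j = c → j ≤ i₁) :
    ¬ Paired (A.image (rowContent l)) (B.image (rowContent e)) ((c : ℤ) - i₁ - 1) (c - i₀) := by
  rintro ⟨h1, -, -, -, h2⟩
  have hl1 := h.antitone_l (Nat.zero_le i₁)
  by_cases hl₁ : l i₁ = c
  · obtain ⟨j, hj, h3⟩ := Finset.mem_image.1 h1
    simp only [rowContent] at h3
    have h4 := h.antitone_l (Nat.zero_le j)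
    have h5 := hlow j hj
    by_cases h6 : j ≤ i₁
    · have := h.antitone_l h6
      omega
    · omega
  · classical
    have hex : ∃ j, l j < c := ⟨i₁, by omega⟩
    obtain ⟨z, hz, hmin⟩ : ∃ z, l z < c ∧ ∀ j < z, l j = c := by
      refine ⟨Nat.find hex, Nat.find_spec hex, fun j hj => ?_⟩
      have h3 := Nat.find_min hex hj
      have h4 := h.antitone_l (Nat.zero_le j)
      omega
    have hz₁ : z ≤ i₁ := by
      by_contra h3
      exact hl₁ (hmin i₁ (by omega))
    have hz₀ : i₀ < z := by
      by_contra h3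
      have := h.antitone_l (show z ≤ i₀ by omega)
      omega
    have hdouble : ∀ j, z ≤ j → j ≤ i₁ → j ∈ B ∧ e j = c ∧ l j + 1 = c := by
      intro j h3 h4
      have h5 := h.antitone_v h4
      have h6 := h.antitone_v (Nat.zero_le j)
      have h7 := h.antitone_l h3
      have h8 := h.cases j
      rw [(h.mem_iff j).2]
      omega
    have hzc := hdouble z le_rfl hz₁
    -- Up to the right label of row z there are at least i₁ + 1 - z right labels but at most i₁ - z
    -- left ones after the given left parenthesis.
    have h3 := h2 ((c : ℤ) - z)
      (Finset.mem_image.2 ⟨z, hzc.1, by simp only [rowContent]; omega⟩) (by omega) (by omega)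
    rw [card_filter_image_rowContent h.antitone_e, card_filter_image_rowContent h.antitone_l] at h3
    have h4 : Finset.Icc z i₁ ⊆ ({j ∈ B | (c : ℤ) - i₁ - 1 ≤ rowContent e j ∧
        rowContent e j ≤ (c : ℤ) - z} : Finset ℕ) := by
      intro j hj
      rw [Finset.mem_Icc] at hj
      have h5 := hdouble j hj.1 hj.2
      rw [Finset.mem_filter]
      refine ⟨h5.1, ?_⟩
      simp only [rowContent]
      omega
    have h5 : ({j ∈ A | (c : ℤ) - i₁ - 1 < rowContent l j ∧ rowContent l j ≤ (c : ℤ) - z} :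
        Finset ℕ) ⊆ Finset.Ico z i₁ := by
      intro j hj
      rw [Finset.mem_filter] at hj
      simp only [rowContent] at hj
      rw [Finset.mem_Ico]
      have h6 : z ≤ j := by
        by_contra h7
        have := hmin j (by omega)
        omega
      have h7 := h.antitone_l h6
      omega
    have h6 := Finset.card_le_card h4
    have h7 := Finset.card_le_card h5
    rw [Nat.card_Icc] at h6
    rw [Nat.card_Ico] at h7
    omega

/-! #### The left parenthesis of the last row -/

theorem IsStripPair.card_right_Ico (h : IsStripPair n l e v A B) (i : ℕ) :
    ({x ∈ B.image (rowContent e) | rowContent l (n - 1) ≤ x ∧ x < rowContent e i} :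
      Finset ℤ).card = ({j ∈ B | i + 1 ≤ j} : Finset ℕ).card := by
  rw [card_filter_image_rowContent h.antitone_e]
  congr 1
  refine Finset.filter_congr fun j hj => ?_
  rw [(rowContent_strictAnti h.antitone_e).lt_iff_gt]
  have h1 := Finset.mem_range.1 (h.right_subset hj)
  have h2 := (rowContent_strictAnti h.antitone_l).antitone (show j ≤ n - 1 by omega)
  have h3 := h.rowContent_le j
  exact ⟨fun h4 => h4.2, fun h4 => ⟨h2.trans h3, h4⟩⟩

theorem IsStripPair.card_right_Icc (h : IsStripPair n l e v A B) (i : ℕ) :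
    ({x ∈ B.image (rowContent e) | rowContent l (n - 1) ≤ x ∧ x ≤ rowContent e i} :
      Finset ℤ).card = ({j ∈ B | i ≤ j} : Finset ℕ).card := by
  rw [card_filter_image_rowContent h.antitone_e]
  congr 1
  refine Finset.filter_congr fun j hj => ?_
  rw [(rowContent_strictAnti h.antitone_e).le_iff_ge]
  have h1 := Finset.mem_range.1 (h.right_subset hj)
  have h2 := (rowContent_strictAnti h.antitone_l).antitone (show j ≤ n - 1 by omega)
  have h3 := h.rowContent_le j
  exact ⟨fun h4 => h4.2, fun h4 => ⟨h2.trans h3, h4⟩⟩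

theorem IsStripPair.rowContent_last_le (h : IsStripPair n l e v A B) {i : ℕ} (hi : i < n) :
    rowContent l (n - 1) ≤ rowContent e i :=
  ((rowContent_strictAnti h.antitone_l).antitone (show i ≤ n - 1 by omega)).trans
    (h.rowContent_le i)

theorem IsStripPair.card_left_Ioc (h : IsStripPair n l e v A B) (hA : n - 1 ∈ A) {i : ℕ}
    (hi : i < n) :
    ({x ∈ A.image (rowContent l) | x ≤ rowContent e i} : Finset ℤ).card =
      ({x ∈ A.image (rowContent l) | rowContent l (n - 1) < x ∧ x ≤ rowContent e i} :
        Finset ℤ).card + 1 := by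
  have h1 : ({x ∈ A.image (rowContent l) | x ≤ rowContent e i} : Finset ℤ) =
      insert (rowContent l (n - 1))
        {x ∈ A.image (rowContent l) | rowContent l (n - 1) < x ∧ x ≤ rowContent e i} := by
    ext x
    simp only [Finset.mem_filter, Finset.mem_insert]
    constructor
    · rintro ⟨h2, h3⟩
      obtain ⟨j, hj, rfl⟩ := Finset.mem_image.1 h2
      have h4 := Finset.mem_range.1 (h.left_subset hj)
      rcases ((rowContent_strictAnti h.antitone_l).antitone
        (show j ≤ n - 1 by omega)).eq_or_lt with h5 | h5
      · exact Or.inl h5.symm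
      · exact Or.inr ⟨h2, h5, h3⟩
    · rintro (rfl | h2)
      · exact ⟨Finset.mem_image_of_mem _ hA, h.rowContent_last_le hi⟩
      · exact ⟨h2.1, h2.2.2⟩
  rw [h1, Finset.card_insert_of_notMem (by simp)]

/-- The left label of the last row is the smallest label, so being paired with row i says that the
word from its start through that right parenthesis is balanced. -/
theorem IsStripPair.balance_eq_zero_of_paired (h : IsStripPair n l e v A B) (hA : n - 1 ∈ A)
    {i : ℕ} (hi : i ∈ B) (hbal : 0 ≤ balance A B i)
    (hp : Paired (A.image (rowContent l)) (B.image (rowContent e)) (rowContent l (n - 1))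
      (rowContent e i)) : balance A B i = 0 := by
  have h1 := hp.2.2.2.1
  have h2 := h.card_left_Ioc hA (Finset.mem_range.1 (h.right_subset hi))
  have h3 := h.le_card_left_le i
  have h4 := card_filter_le_eq_add B i
  rw [h.card_right_Ico] at h1
  simp only [ind, hi, if_true] at h4
  rw [balance] at hbal ⊢
  omega

theorem IsStripPair.paired_of_balance (h : IsStripPair n l e v A B) (hA : n - 1 ∈ A) {i : ℕ}
    (hi : i ∈ B) (hiA : i ∉ A) (hbal : balance A B i = 0)
    (hpos : ∀ j, i < j → j < n → 0 < balance A B j) :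
    Paired (A.image (rowContent l)) (B.image (rowContent e)) (rowContent l (n - 1))
      (rowContent e i) := by
  have hin := Finset.mem_range.1 (h.right_subset hi)
  refine ⟨Finset.mem_image_of_mem _ hA, Finset.mem_image_of_mem _ hi, h.rowContent_last_le hin,
    ?_, ?_⟩
  · have h2 := h.card_left_Ioc hA hin
    have h4 := card_filter_le_eq_add B i
    rw [h.card_left_le hiA] at h2
    simp only [ind, hi, if_true] at h4
    rw [h.card_right_Ico]
    rw [balance] at hbal
    omega
  · intro c hc h1 h2
    obtain ⟨j, hj, rfl⟩ := Finset.mem_image.1 hc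
    rw [(rowContent_strictAnti h.antitone_e).lt_iff_gt] at h2
    have hjn := Finset.mem_range.1 (h.right_subset hj)
    have h3 := hpos j h2 hjn
    have h4 := h.card_left_Ioc hA hjn
    have h5 := h.le_card_left_le j
    rw [h.card_right_Icc]
    rw [balance] at h3
    omega

/-- The right parenthesis of row `i` is paired with the left parenthesis of the last row only if
it is the topmost one in the last column. -/
theorem IsStripPair.forall_paired_iff (h : IsStripPair n l e v A B) (hA : n - 1 ∈ A)
    (hB : n - 1 ∉ B) (hbal : ∀ i, 0 ≤ balance A B i) (hv0 : v 0 = l 0 + 1) {i₀ : ℕ}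
    (hi₀ : i₀ ∈ B) (hl₀ : l i₀ = l 0) (hiA : i₀ ∉ A) (htop : ∀ j ∈ B, e j = l 0 → i₀ ≤ j) :
    (∀ b, Paired (A.image (rowContent l)) (B.image (rowContent e)) (rowContent l (n - 1)) b →
        b = rowContent e i₀) ↔
      ∀ i < n, ¬ (i ∈ singleRows n l v ∧ l i = l 0) → 0 < balance A B i := by
  have hinj := (rowContent_strictAnti h.antitone_e).injective
  constructor
  · intro h1 i hin hi
    by_contra hle
    have hi0 : balance A B i = 0 := by
      have := hbal i
      omega
    -- The lowest row with balance zero is where the left parenthesis of the last row closes. It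
    -- remains outside the extreme chain, since that chain is closed upwards.
    obtain ⟨i, ⟨hin, hi0, hiY⟩, hmax⟩ : ∃ i, (i < n ∧ balance A B i = 0 ∧
        ¬ (i ∈ singleRows n l v ∧ l i = l 0)) ∧ ∀ j, i < j → j < n → 0 < balance A B j := by
      classical
      obtain ⟨i', h3, h4⟩ := Finset.exists_max_image
        ({i ∈ Finset.range n | balance A B i = 0} : Finset ℕ) id ⟨i, by simp [hin, hi0]⟩
      simp only [Finset.mem_filter, Finset.mem_range, id_eq] at h3 h4
      refine ⟨i', ⟨h3.1, h3.2, fun h5 => hi ?_⟩, fun j h5 h6 => ?_⟩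
      · have h6 := h4 i ⟨hin, hi0⟩
        have h7 := h.antitone_l h6
        have h8 := h.antitone_l (Nat.zero_le i)
        have h9 := h.antitone_v h6
        have h10 := h.antitone_v (Nat.zero_le i)
        rw [mem_singleRows] at h5 ⊢
        omega
      · have h7 := hbal j
        by_contra h8
        have := h4 j ⟨h6, by omega⟩
        omega
    have hne : i ≠ n - 1 := by
      rintro rfl
      rw [balance_eq_add, h.balance_eq_zero (by omega)] at hi0
      simp [ind, hA, hB] at hi0
    have h2 := hmax (i + 1) (by omega) (by omega)
    have h3 := balance_eq_add A B i
    have h4 : i ∈ B ∧ i ∉ A := by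
      by_cases h5 : i ∈ A <;> by_cases h6 : i ∈ B <;>
        simp only [ind, h5, h6, if_true, if_false] at h3 <;> first | omega | exact ⟨h6, h5⟩
    have h5 := hinj (h1 _ (h.paired_of_balance hA h4.1 h4.2 hi0 hmax))
    subst h5
    apply hiY
    have h6 := h.cases i
    rw [mem_singleRows]
    simp only [h4, not_true_eq_false, false_and, true_and, not_false_eq_true, false_or,
      or_false] at h6
    exact ⟨⟨hin, h6.2⟩, hl₀⟩
  · intro h1 b hb
    obtain ⟨i, hi, rfl⟩ := Finset.mem_image.1 hb.2.1
    have h2 := h.balance_eq_zero_of_paired hA hi (hbal i) hb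
    have hin := Finset.mem_range.1 (h.right_subset hi)
    have h3 : i ∈ singleRows n l v ∧ l i = l 0 := by
      by_contra h4
      have := h1 i hin h4
      omega
    have h4 := mem_singleRows.1 h3.1
    have h5 := (h.mem_iff i).2.1 hi
    have h6 := htop i hi (by omega)
    rcases h6.eq_or_lt with h7 | h7
    · rw [h7]
    · exfalso
      -- No row of A lies between i₀ and i: its box would be in the last column below the box of i₀,
      -- which is added later. So the balance drops strictly from i to i₀ and becomes negative.
      have h8 : ({j ∈ A | i₀ ≤ j} : Finset ℕ) = {j ∈ A | i ≤ j} := by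
        refine Finset.filter_congr fun j hj => ⟨fun h8 => ?_, fun h8 => by omega⟩
        by_contra h9
        have h10 := h.antitone_l (show j ≤ i by omega)
        have h11 := h.antitone_e h8
        have h12 := (h.mem_iff j).1.1 hj
        have h13 := h.cases i₀
        have h14 := (h.mem_iff i₀).1.not.1 hiA
        omega
      have h9 : ({j ∈ B | i ≤ j} : Finset ℕ).card < ({j ∈ B | i₀ ≤ j} : Finset ℕ).card := by
        apply Finset.card_lt_card
        rw [Finset.ssubset_iff_of_subset]
        · exact ⟨i₀, by simp [hi₀], by simp [h7]⟩
        · intro j hj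
          rw [Finset.mem_filter] at hj ⊢
          exact ⟨hj.1, by omega⟩
      have h10 := hbal i₀
      rw [balance] at h2 h10
      rw [h8] at h10
      omega

/-- The words that are excluded, in terms of boxes and labels. -/
theorem IsStripPair.exceptional_iff (h : IsStripPair n l e v A B) {k : ℕ} (hn : 0 < n)
    (hk : 0 < k) (hbal : ∀ i, 0 ≤ balance A B i) :
    (v 0 = v (n - 1) + k ∧ n - 1 ∈ A ∧ n - 1 ∉ B ∧ Xor (0 ∈ A) (0 ∈ B) ∧
      ∃ a₀ a₁ : ℤ, IsGreatest (rowContent e '' {i | i ∈ B ∧ e i + 1 = v 0}) a₀ ∧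
        IsLeast (rowContent l '' {i | i ∈ A ∧ l i + 1 = v 0} ∪
          rowContent e '' {i | i ∈ B ∧ e i + 1 = v 0}) a₁ ∧
        ¬ Paired (A.image (rowContent l)) (B.image (rowContent e)) (a₁ - 1) a₀ ∧
        ∀ b, Paired (A.image (rowContent l)) (B.image (rowContent e)) (rowContent l (n - 1)) b →
          b = a₀) ↔
      Wraps n k l v ∧ (∃ i ∈ singleRows n l v, l i = l 0 ∧ i ∉ A) ∧
        ∀ i < n, ¬ (i ∈ singleRows n l v ∧ l i = l 0) → 0 < balance A B i := by
  have he := rowContent_strictAnti h.antitone_e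
  have hc0 := h.cases 0
  have hcn := h.cases (n - 1)
  have hv0 := fun i => h.antitone_v (Nat.zero_le i)
  constructor
  · rintro ⟨h1, h2, h3, h4, a₀, a₁, ⟨⟨i₀, ⟨hi₀, he₀⟩, rfl⟩, htop⟩, ⟨hi₁, hlow⟩, h5, h6⟩
    have h7 : v 0 = l 0 + 1 := by
      rcases h4 with h4 | h4 <;> simp [h4] at hc0 <;> omega
    have h8 : v (n - 1) = l (n - 1) + 1 := by
      simp only [h2, h3, not_true_eq_false, false_and, true_and, not_false_eq_true, false_or,
        or_false] at hcn
      omega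
    have htop' : ∀ j ∈ B, e j = l 0 → i₀ ≤ j := fun j hj hej =>
      he.le_iff_ge.1 (htop ⟨j, ⟨hj, by omega⟩, rfl⟩)
    obtain ⟨i₁, hv₁, rfl⟩ : ∃ i₁, v i₁ = l 0 + 1 ∧ a₁ = (l 0 : ℤ) - i₁ := by
      rcases hi₁ with ⟨i, ⟨h9, h10⟩, rfl⟩ | ⟨i, ⟨h9, h10⟩, rfl⟩
      · have h11 := h.cases i
        have h12 := hv0 i
        rw [h7] at h10
        simp only [h9, not_true_eq_false, false_and, true_and, or_false] at h11
        exact ⟨i, by omega, by simp only [rowContent]; omega⟩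
      · have h11 := (h.mem_iff i).2.1 h9
        exact ⟨i, by omega, by simp only [rowContent]; omega⟩
    have hlow₁ : ∀ j ∈ A, l j = l 0 → j ≤ i₁ := by
      intro j hj hlj
      have := hlow (Or.inl ⟨j, ⟨hj, by omega⟩, rfl⟩)
      simp only [rowContent] at this
      omega
    have hlow₂ : ∀ j ∈ B, e j = l 0 → j ≤ i₁ := by
      intro j hj hlj
      have := hlow (Or.inr ⟨j, ⟨hj, by omega⟩, rfl⟩)
      simp only [rowContent] at this
      omega
    have he₀' : e i₀ = l 0 := by omega
    have hrc : rowContent e i₀ = (l 0 : ℤ) - i₀ := by simp only [rowContent, he₀']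
    -- The role of the condition on a₁ - 1: it excludes that the topmost box of the second strip in
    -- the last column lies in a row with two boxes.
    have hiA : i₀ ∉ A := by
      intro hiA
      apply h5
      rw [hrc]
      exact h.paired_of_double rfl h7 hi₀ he₀' hiA htop' hv₁ (hlow₂ i₀ hi₀ he₀') hlow₂
    have hc₀ := h.cases i₀
    simp only [hiA, hi₀, not_true_eq_false, false_and, true_and, not_false_eq_true, false_or,
      or_false] at hc₀
    have hl₀ : l i₀ = l 0 := by omega
    have hin := Finset.mem_range.1 (h.right_subset hi₀)
    refine ⟨⟨mem_singleRows.2 ⟨hn, h7⟩, mem_singleRows.2 ⟨by omega, h8⟩, by omega⟩,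
      ⟨i₀, mem_singleRows.2 ⟨hin, hc₀.2⟩, hl₀, hiA⟩, ?_⟩
    exact (h.forall_paired_iff h2 h3 hbal h7 hi₀ hl₀ hiA htop').1 h6
  · rintro ⟨⟨h1, h2, h3⟩, ⟨i, hiU, hli, hiA⟩, h4⟩
    rw [mem_singleRows] at h1 h2 hiU
    -- The last row is not in the extreme chain because k > 0, and a positive balance there means
    -- that its only box is a left parenthesis.
    have h5 := h4 (n - 1) (by omega) (by omega)
    rw [balance_eq_add, h.balance_eq_zero (by omega)] at h5
    have h6 : n - 1 ∈ A ∧ n - 1 ∉ B := by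
      rcases hcn with h6 | h6 | h6 | h6
      · omega
      · exact ⟨h6.1, h6.2.1⟩
      · simp [ind, h6] at h5
      · omega
    have hiB : i ∈ B := by
      have := (h.mem_iff i).1.not.1 hiA
      have := h.cases i
      rw [(h.mem_iff i).2]
      omega
    have hei : e i = l 0 := by
      have := (h.mem_iff i).2.1 hiB
      omega
    classical
    have hex : ∃ j, j ∈ B ∧ e j = l 0 := ⟨i, hiB, hei⟩
    obtain ⟨i₀, ⟨hi₀, he₀⟩, htop⟩ : ∃ i₀, (i₀ ∈ B ∧ e i₀ = l 0) ∧
        ∀ j ∈ B, e j = l 0 → i₀ ≤ j :=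
      ⟨Nat.find hex, Nat.find_spec hex, fun j hj hej => Nat.find_min' hex ⟨hj, hej⟩⟩
    have hl₀ : l i₀ = l 0 := by
      have h7 := h.antitone_l (htop i hiB hei)
      have h8 := h.antitone_l (Nat.zero_le i₀)
      omega
    have hiA₀ : i₀ ∉ A := by
      rw [(h.mem_iff i₀).1]
      omega
    obtain ⟨i₁, hi₁, hlow⟩ := Finset.exists_max_image
      ({j ∈ Finset.range n | (j ∈ A ∧ l j = l 0) ∨ (j ∈ B ∧ e j = l 0)} : Finset ℕ) id
      ⟨i₀, by simp [hi₀, he₀, Finset.mem_range.1 (h.right_subset hi₀)]⟩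
    simp only [Finset.mem_filter, Finset.mem_range, id_eq] at hi₁ hlow
    have hv₁ : v i₁ = l 0 + 1 := by
      have h7 := hv0 i₁
      rcases hi₁.2 with h8 | h8
      · have h9 := (h.mem_iff i₁).1.1 h8.1
        have h10 := h.cases i₁
        omega
      · have h9 := (h.mem_iff i₁).2.1 h8.1
        omega
    have hlow₁ : ∀ j ∈ A, l j = l 0 → j ≤ i₁ := fun j hj hlj =>
      hlow j ⟨Finset.mem_range.1 (h.left_subset hj), Or.inl ⟨hj, hlj⟩⟩
    have hlow₂ : ∀ j ∈ B, e j = l 0 → j ≤ i₁ := fun j hj hlj =>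
      hlow j ⟨Finset.mem_range.1 (h.right_subset hj), Or.inr ⟨hj, hlj⟩⟩
    have hrc : rowContent e i₀ = (l 0 : ℤ) - i₀ := by simp only [rowContent, he₀]
    refine ⟨by omega, h6.1, h6.2, ?_, rowContent e i₀, (l 0 : ℤ) - i₁, ⟨?_, ?_⟩, ⟨?_, ?_⟩, ?_, ?_⟩
    · rcases hc0 with h7 | h7 | h7 | h7
      · omega
      · exact Or.inl ⟨h7.1, h7.2.1⟩
      · exact Or.inr ⟨h7.2.1, h7.1⟩
      · omega
    · exact ⟨i₀, ⟨hi₀, by omega⟩, rfl⟩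
    · rintro _ ⟨j, ⟨hj, hej⟩, rfl⟩
      exact he.le_iff_ge.2 (htop j hj (by omega))
    · rcases hi₁.2 with h7 | h7
      · exact Or.inl ⟨i₁, ⟨h7.1, by omega⟩, by simp only [rowContent, h7.2]⟩
      · exact Or.inr ⟨i₁, ⟨h7.1, by omega⟩, by simp only [rowContent, h7.2]⟩
    · rintro _ (⟨j, ⟨hj, hej⟩, rfl⟩ | ⟨j, ⟨hj, hej⟩, rfl⟩)
      · have := hlow₁ j hj (by omega)
        simp only [rowContent]
        omega
      · have := hlow₂ j hj (by omega)
        simp only [rowContent]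
        omega
    · rw [hrc]
      exact h.not_paired_of_single rfl h1.2 hl₀ hv₁ hlow₁
    · exact (h.forall_paired_iff h6.1 h6.2 hbal h1.2 hi₀ hl₀ hiA₀ htop).2 h4

end Exceptional

/-! ### Decreasing paths and vertical strips -/

section Growth

/-- The partition `d (i + 1)` is obtained from `d i` by adding one box, for `i < m`. -/
structure IsGrowth (d : ℕ → YoungDiagram) (m : ℕ) : Prop where
  le_succ : ∀ i < m, d i ≤ d (i + 1)
  card_succ : ∀ i < m, (d (i + 1)).card = (d i).card + 1

/-- The label of the box that is added to `d i`. -/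
def stepLabel (d : ℕ → YoungDiagram) (i : ℕ) : ℤ :=
  ∑ c ∈ (d (i + 1)).cells \ (d i).cells, content c

/-- The labels of the first `m` steps are decreasing. -/
def IsDecreasing (d : ℕ → YoungDiagram) (m : ℕ) : Prop :=
  ∀ i j, i < j → j < m → stepLabel d j < stepLabel d i

variable {d : ℕ → YoungDiagram} {m : ℕ}

theorem IsGrowth.exists_boxes (h : IsGrowth d m) : ∃ c : ℕ → ℕ × ℕ, ∀ i < m,
    c i ∉ (d i).cells ∧ (d (i + 1)).cells = insert (c i) (d i).cells ∧
      stepLabel d i = content (c i) := by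
  have : ∀ i, ∃ c : ℕ × ℕ, i < m → c ∉ (d i).cells ∧
      (d (i + 1)).cells = insert c (d i).cells ∧ stepLabel d i = content c := by
    intro i
    by_cases hi : i < m
    · have h1 := h.le_succ i hi
      have h2 := h.card_succ i hi
      have h3 : (d i).cells ⊆ (d (i + 1)).cells := h1
      have h4 : ((d (i + 1)).cells \ (d i).cells).card = 1 := by
        rw [Finset.card_sdiff_of_subset h3]
        simp only [YoungDiagram.card] at h2
        omega
      obtain ⟨c, hc⟩ := Finset.card_eq_one.1 h4
      refine ⟨c, fun _ => ⟨?_, ?_, ?_⟩⟩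
      · have := Finset.mem_singleton_self c
        rw [← hc, Finset.mem_sdiff] at this
        exact this.2
      · rw [← Finset.sdiff_union_of_subset h3, hc, Finset.insert_eq]
      · rw [stepLabel, hc, Finset.sum_singleton]
    · exact ⟨(0, 0), fun h => absurd h hi⟩
  choose c hc using this
  exact ⟨c, hc⟩

theorem mem_cells_of_boxes {c : ℕ → ℕ × ℕ}
    (hc : ∀ i < m, (d (i + 1)).cells = insert (c i) (d i).cells) {j : ℕ} (hj : j ≤ m)
    {x : ℕ × ℕ} : x ∈ (d j).cells ↔ x ∈ (d 0).cells ∨ ∃ s < j, c s = x := by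
  induction j with
  | zero => simp
  | succ j ih =>
    rw [hc j (by omega), Finset.mem_insert, ih (by omega)]
    constructor
    · rintro (rfl | h | ⟨s, hs, rfl⟩)
      · exact Or.inr ⟨j, by omega, rfl⟩
      · exact Or.inl h
      · exact Or.inr ⟨s, by omega, rfl⟩
    · rintro (h | ⟨s, hs, rfl⟩)
      · exact Or.inr (Or.inl h)
      · by_cases hsj : s = j
        · exact Or.inl (by rw [hsj])
        · exact Or.inr (Or.inr ⟨s, by omega, rfl⟩)

theorem IsGrowth.monotone (h : IsGrowth d m) {i j : ℕ} (hij : i ≤ j) (hj : j ≤ m) : d i ≤ d j := by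
  induction j, hij using Nat.le_induction with
  | base => exact le_rfl
  | succ j _ ih => exact (ih (by omega)).trans (h.le_succ j (by omega))

theorem IsGrowth.card_eq (h : IsGrowth d m) {j : ℕ} (hj : j ≤ m) :
    (d j).card = (d 0).card + j := by
  induction j with
  | zero => rfl
  | succ j ih =>
    rw [h.card_succ j (by omega), ih (by omega)]
    rfl

theorem IsGrowth.image_stepLabel (h : IsGrowth d m) :
    (Finset.range m).image (stepLabel d) = ((d m).cells \ (d 0).cells).image content := by
  obtain ⟨c, hc⟩ := h.exists_boxes
  have hmem : ∀ {x}, x ∈ (d m).cells ↔ _ := mem_cells_of_boxes (fun i hi => (hc i hi).2.1) le_rfl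
  ext a
  simp only [Finset.mem_image, Finset.mem_range, Finset.mem_sdiff]
  constructor
  · rintro ⟨i, hi, rfl⟩
    refine ⟨c i, ⟨hmem.2 (Or.inr ⟨i, hi, rfl⟩), fun h0 => ?_⟩, (hc i hi).2.2.symm⟩
    exact (hc i hi).1 (h.monotone (Nat.zero_le i) hi.le h0)
  · rintro ⟨x, ⟨h1, h2⟩, rfl⟩
    obtain ⟨i, hi, rfl⟩ := (hmem.1 h1).resolve_left h2
    exact ⟨i, hi, (hc i hi).2.2⟩

/-- Two boxes of one row must be added from left to right, with increasing labels, so a decreasing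
path adds at most one box per row. -/
theorem IsGrowth.rowLen_le (h : IsGrowth d m) (hd : IsDecreasing d m) (i : ℕ) :
    (d m).rowLen i ≤ (d 0).rowLen i + 1 := by
  obtain ⟨c, hc⟩ := h.exists_boxes
  have hmem : ∀ {j x}, j ≤ m → (x ∈ (d j).cells ↔ _) := fun hj =>
    mem_cells_of_boxes (fun i hi => (hc i hi).2.1) hj
  by_contra hlt
  set r := (d 0).rowLen i with hr
  have hnot : ∀ b, r ≤ b → (i, b) ∉ (d 0).cells := by
    intro b hb hmem
    rw [YoungDiagram.mem_cells, YoungDiagram.mem_iff_lt_rowLen] at hmem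
    omega
  have h1 : (i, r + 1) ∈ (d m).cells := by
    rw [YoungDiagram.mem_cells, YoungDiagram.mem_iff_lt_rowLen]
    omega
  obtain ⟨t, ht, hct⟩ := ((hmem le_rfl).1 h1).resolve_left (hnot _ (by omega))
  have h2 : (i, r) ∈ (d (t + 1)).cells := by
    have h3 : (i, r + 1) ∈ (d (t + 1)).cells := (hmem ht).2 (Or.inr ⟨t, by omega, hct⟩)
    exact (d (t + 1)).up_left_mem le_rfl (Nat.le_succ r) h3
  obtain ⟨s, hs, hcs⟩ := ((hmem ht).1 h2).resolve_left (hnot _ le_rfl)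
  have hne : s ≠ t := by
    rintro rfl
    rw [hcs] at hct
    simp at hct
  have h3 := hd s t (by omega) ht
  rw [(hc s (by omega)).2.2, (hc t ht).2.2, hcs, hct] at h3
  simp only [content] at h3
  push_cast at h3
  omega

theorem IsGrowth.eq_of_isDecreasing {d' : ℕ → YoungDiagram} (h : IsGrowth d m)
    (hd : IsDecreasing d m) (h' : IsGrowth d' m) (hd' : IsDecreasing d' m) (h0 : d 0 = d' 0)
    (hm : d m = d' m) {i : ℕ} (hi : i ≤ m) : d i = d' i := by
  obtain ⟨c, hc⟩ := h.exists_boxes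
  obtain ⟨c', hc'⟩ := h'.exists_boxes
  -- At the first difference the box added by one path is still missing from the other, which must
  -- add it later and hence with a smaller label. By symmetry this is a contradiction.
  have key : ∀ {d d' : ℕ → YoungDiagram} {c c' : ℕ → ℕ × ℕ} {i : ℕ}, IsDecreasing d' m → i < m →
      (∀ i < m, c i ∉ (d i).cells ∧ (d (i + 1)).cells = insert (c i) (d i).cells ∧
        stepLabel d i = content (c i)) →
      (∀ i < m, c' i ∉ (d' i).cells ∧ (d' (i + 1)).cells = insert (c' i) (d' i).cells ∧
        stepLabel d' i = content (c' i)) →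
      d m = d' m → d i = d' i → c i ≠ c' i → content (c i) < content (c' i) := by
    intro d d' c c' i hd' hi hc hc' hm hdi hne
    have h1 : c i ∈ (d' m).cells := by
      rw [← hm]
      exact (mem_cells_of_boxes (fun i hi => (hc i hi).2.1) le_rfl).2 (Or.inr ⟨i, hi, rfl⟩)
    have h2 : c i ∉ (d' i).cells := hdi ▸ (hc i hi).1
    have hm' : ∀ {j x}, j ≤ m → (x ∈ (d' j).cells ↔ _) := fun hj =>
      mem_cells_of_boxes (fun i hi => (hc' i hi).2.1) hj
    rw [hm' hi.le] at h2
    push Not at h2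
    obtain ⟨t, ht, hct⟩ := ((hm' le_rfl).1 h1).resolve_left h2.1
    have h3 : ¬ t < i := fun hlt => h2.2 t hlt hct
    have h4 : t ≠ i := fun he => hne (by rw [← hct, he])
    rw [← hct, ← (hc' t ht).2.2, ← (hc' i hi).2.2]
    exact hd' i t (by omega) ht
  induction i with
  | zero => exact h0
  | succ i ih =>
    have hdi := ih (by omega)
    have hci : c i = c' i := by
      by_contra hne
      have h1 := key hd' hi hc hc' hm hdi hne
      have h2 := key hd hi hc' hc hm.symm hdi.symm (Ne.symm hne)
      omega
    apply YoungDiagram.ext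
    rw [(hc i hi).2.1, (hc' i hi).2.1, hci, hdi]

end Growth

/-! ### The decreasing path that fills a vertical strip from top to bottom -/

section Strip

variable {lam eta : YoungDiagram}

theorem fst_injOn_sdiff (hrow : ∀ i, eta.rowLen i ≤ lam.rowLen i + 1) :
    Set.InjOn Prod.fst ((eta.cells \ lam.cells : Finset (ℕ × ℕ)) : Set (ℕ × ℕ)) := by
  rintro ⟨a, b⟩ h1 ⟨a', b'⟩ h2 h3
  simp only [Finset.coe_sdiff, Set.mem_sdiff, Finset.mem_coe, YoungDiagram.mem_cells,
    YoungDiagram.mem_iff_lt_rowLen] at h1 h2 h3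
  subst h3
  have := hrow a
  exact Prod.ext rfl (by simp only; omega)

/-- The number of boxes of `eta / lam` above the row of `c`. -/
def boxRank (lam eta : YoungDiagram) (c : ℕ × ℕ) : ℕ :=
  ({x ∈ eta.cells \ lam.cells | x.1 < c.1} : Finset (ℕ × ℕ)).card

theorem boxRank_mono {c c' : ℕ × ℕ} (h : c.1 ≤ c'.1) : boxRank lam eta c ≤ boxRank lam eta c' := by
  refine Finset.card_le_card fun x hx => ?_
  rw [Finset.mem_filter] at hx ⊢
  exact ⟨hx.1, hx.2.trans_le h⟩

theorem boxRank_lt {c c' : ℕ × ℕ} (hc : c ∈ eta.cells \ lam.cells) (h : c.1 < c'.1) :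
    boxRank lam eta c < boxRank lam eta c' := by
  apply Finset.card_lt_card
  rw [Finset.ssubset_iff_of_subset]
  · exact ⟨c, by simp only [Finset.mem_filter]; exact ⟨hc, h⟩, by simp⟩
  · intro x hx
    rw [Finset.mem_filter] at hx ⊢
    exact ⟨hx.1, hx.2.trans h⟩

theorem boxRank_injOn (hrow : ∀ i, eta.rowLen i ≤ lam.rowLen i + 1) :
    Set.InjOn (boxRank lam eta) ((eta.cells \ lam.cells : Finset (ℕ × ℕ)) : Set (ℕ × ℕ)) := by
  intro c hc c' hc' he
  apply fst_injOn_sdiff hrow hc hc'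
  rcases lt_trichotomy c.1 c'.1 with h | h | h
  · have := boxRank_lt (Finset.mem_coe.1 hc) h
    omega
  · exact h
  · have := boxRank_lt (Finset.mem_coe.1 hc') h
    omega

theorem image_boxRank (hrow : ∀ i, eta.rowLen i ≤ lam.rowLen i + 1) :
    (eta.cells \ lam.cells).image (boxRank lam eta) =
      Finset.range (eta.cells \ lam.cells).card := by
  apply Finset.eq_of_subset_of_card_le
  · intro s hs
    obtain ⟨c, hc, rfl⟩ := Finset.mem_image.1 hs
    rw [Finset.mem_range, boxRank]
    apply Finset.card_lt_card
    rw [Finset.ssubset_iff_of_subset (Finset.filter_subset _ _)]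
    exact ⟨c, hc, by simp⟩
  · rw [Finset.card_image_of_injOn (boxRank_injOn hrow), Finset.card_range]

theorem card_filter_boxRank_lt (hrow : ∀ i, eta.rowLen i ≤ lam.rowLen i + 1) {s : ℕ}
    (hs : s ≤ (eta.cells \ lam.cells).card) :
    ({c ∈ eta.cells \ lam.cells | boxRank lam eta c < s} : Finset (ℕ × ℕ)).card = s := by
  have h1 : ({c ∈ eta.cells \ lam.cells | boxRank lam eta c < s} : Finset (ℕ × ℕ)).image
      (boxRank lam eta) = Finset.range s := by
    rw [← Finset.filter_image (p := fun i => i < s), image_boxRank hrow]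
    ext i
    simp only [Finset.mem_filter, Finset.mem_range]
    omega
  rw [← Finset.card_image_of_injOn ((boxRank_injOn hrow).mono _), h1, Finset.card_range]
  exact fun c hc => (Finset.mem_filter.1 hc).1

/-- The partition `lam` with the first `s` boxes of `eta / lam` added from above. -/
def stage (lam eta : YoungDiagram) (s : ℕ) : YoungDiagram where
  cells := lam.cells ∪ {c ∈ eta.cells \ lam.cells | boxRank lam eta c < s}
  isLowerSet := by
    intro c c' hle hc
    simp only [Finset.coe_union, Set.mem_union, Finset.mem_coe, Finset.mem_filter,
      Finset.mem_sdiff] at hc ⊢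
    by_cases hlam : c' ∈ lam.cells
    · exact Or.inl hlam
    · rcases hc with hc | hc
      · exact Or.inl (lam.isLowerSet hle hc)
      · exact Or.inr ⟨⟨eta.isLowerSet hle hc.1.1, hlam⟩, (boxRank_mono hle.1).trans_lt hc.2⟩

theorem card_stage (hrow : ∀ i, eta.rowLen i ≤ lam.rowLen i + 1) {s : ℕ}
    (hs : s ≤ (eta.cells \ lam.cells).card) : (stage lam eta s).card = lam.card + s := by
  have h1 : (stage lam eta s).card =
      (lam.cells ∪ {c ∈ eta.cells \ lam.cells | boxRank lam eta c < s}).card := rfl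
  rw [h1, Finset.card_union_of_disjoint, card_filter_boxRank_lt hrow hs]
  · rw [Finset.disjoint_right]
    exact fun c hc => (Finset.mem_sdiff.1 (Finset.mem_filter.1 hc).1).2

theorem stage_zero : stage lam eta 0 = lam := by
  apply YoungDiagram.ext
  simp [stage]

theorem stage_card (hle : lam ≤ eta) (hrow : ∀ i, eta.rowLen i ≤ lam.rowLen i + 1) :
    stage lam eta (eta.cells \ lam.cells).card = eta := by
  apply YoungDiagram.ext
  have h1 : (stage lam eta (eta.cells \ lam.cells).card).cells =
      lam.cells ∪ {c ∈ eta.cells \ lam.cells |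
        boxRank lam eta c < (eta.cells \ lam.cells).card} := rfl
  rw [h1, Finset.filter_true_of_mem, Finset.union_sdiff_of_subset hle]
  intro c hc
  rw [← Finset.mem_range, ← image_boxRank hrow]
  exact Finset.mem_image_of_mem _ hc

theorem isGrowth_stage (hrow : ∀ i, eta.rowLen i ≤ lam.rowLen i + 1) :
    IsGrowth (stage lam eta) (eta.cells \ lam.cells).card := by
  constructor
  · intro i _ c hc
    have hc' : c ∈ lam.cells ∪ {c ∈ eta.cells \ lam.cells | boxRank lam eta c < i} := hc
    show c ∈ lam.cells ∪ {c ∈ eta.cells \ lam.cells | boxRank lam eta c < i + 1}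
    rw [Finset.mem_union, Finset.mem_filter] at hc' ⊢
    exact hc'.imp_right fun h => ⟨h.1, by omega⟩
  · intro i hi
    rw [card_stage hrow hi, card_stage hrow hi.le]
    rfl

theorem isDecreasing_stage (hrow : ∀ i, eta.rowLen i ≤ lam.rowLen i + 1) :
    IsDecreasing (stage lam eta) (eta.cells \ lam.cells).card := by
  obtain ⟨c, hc⟩ := (isGrowth_stage hrow).exists_boxes
  have hrank : ∀ i < (eta.cells \ lam.cells).card, c i ∈ eta.cells \ lam.cells ∧
      boxRank lam eta (c i) = i := by
    intro i hi
    have h1 : c i ∈ (stage lam eta (i + 1)).cells := by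
      rw [(hc i hi).2.1]
      exact Finset.mem_insert_self _ _
    have h2 := (hc i hi).1
    simp only [stage, Finset.mem_union, Finset.mem_filter, not_or, not_and] at h1 h2
    have h3 := h1.resolve_left h2.1
    have h4 := h2.2 h3.1
    exact ⟨h3.1, by omega⟩
  intro i j hij hj
  have hi : i < (eta.cells \ lam.cells).card := by omega
  rw [(hc i hi).2.2, (hc j hj).2.2]
  obtain ⟨h1, h2⟩ := hrank i hi
  obtain ⟨h3, h4⟩ := hrank j hj
  have h5 : (c i).1 < (c j).1 := by
    by_contra hle
    have := boxRank_mono (lam := lam) (eta := eta) (not_lt.1 hle)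
    omega
  rw [Finset.mem_sdiff, YoungDiagram.mem_cells, YoungDiagram.mem_cells] at h1 h3
  rw [← Prod.mk.eta (p := c i), YoungDiagram.mem_iff_lt_rowLen,
    YoungDiagram.mem_iff_lt_rowLen] at h1
  rw [← Prod.mk.eta (p := c j), YoungDiagram.mem_iff_lt_rowLen,
    YoungDiagram.mem_iff_lt_rowLen] at h3
  have h6 := hrow (c i).1
  have h7 := hrow (c j).1
  have h8 := lam.rowLen_anti _ _ h5.le
  simp only [content]
  omega

end Strip

/-! ### The boxes of a vertical strip -/

section Boxes

/-- The boxes at the ends of the rows of `A`. -/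
def boxesOf (f : ℕ → ℕ) (A : Finset ℕ) : Finset (ℕ × ℕ) := A.image fun i => (i, f i)

theorem image_content_boxesOf (f : ℕ → ℕ) (A : Finset ℕ) :
    (boxesOf f A).image content = A.image (rowContent f) := by
  rw [boxesOf, Finset.image_image]
  rfl

theorem hasBot_boxesOf {f : ℕ → ℕ} {A : Finset ℕ} : HasBot (boxesOf f A) ↔ 0 ∈ A := by
  simp [HasBot, boxesOf]

theorem hasTop_boxesOf {n : ℕ} (hn : 0 < n) {f : ℕ → ℕ} {A : Finset ℕ} :
    HasTop n (boxesOf f A) ↔ n - 1 ∈ A := by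
  simp only [HasTop, boxesOf, Finset.mem_image, exists_exists_and_eq_and]
  constructor
  · rintro ⟨i, hi, h⟩
    rwa [show n - 1 = i by omega]
  · exact fun h => ⟨n - 1, h, by omega⟩

theorem image_lastColumn_boxesOf (nu : YoungDiagram) (f : ℕ → ℕ) (A : Finset ℕ) :
    content '' (lastColumn nu (boxesOf f A) : Set (ℕ × ℕ)) =
      rowContent f '' {i | i ∈ A ∧ f i + 1 = nu.rowLen 0} := by
  ext x
  simp only [lastColumn, boxesOf, Finset.coe_filter, Finset.mem_image, Set.mem_image,
    Set.mem_ofPred_eq]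
  constructor
  · rintro ⟨_, ⟨⟨i, hi, rfl⟩, h⟩, rfl⟩
    exact ⟨i, ⟨hi, h⟩, rfl⟩
  · rintro ⟨i, ⟨hi, h⟩, rfl⟩
    exact ⟨_, ⟨⟨i, hi, rfl⟩, h⟩, rfl⟩

theorem lastColumn_union (nu : YoungDiagram) (S T : Finset (ℕ × ℕ)) :
    lastColumn nu (S ∪ T) = lastColumn nu S ∪ lastColumn nu T :=
  Finset.filter_union _ _ _

variable {n : ℕ} {lam eta : YoungDiagram}

theorem rowLen_le_iff : lam ≤ eta ↔ ∀ i, lam.rowLen i ≤ eta.rowLen i := by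
  constructor
  · intro h i
    by_contra hlt
    have h1 : (i, eta.rowLen i) ∈ lam := YoungDiagram.mem_iff_lt_rowLen.2 (by omega)
    have h2 := YoungDiagram.mem_iff_lt_rowLen.1 (h h1)
    omega
  · rintro h ⟨a, b⟩ hab
    have h1 := YoungDiagram.mem_iff_lt_rowLen.1 hab
    exact YoungDiagram.mem_iff_lt_rowLen.2 (h1.trans_le (h a))

theorem rowLen_eq_add_ind (heta : eta.colLen 0 ≤ n) (hle : lam ≤ eta)
    (hrow : ∀ i, eta.rowLen i ≤ lam.rowLen i + 1) (i : ℕ) :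
    eta.rowLen i = lam.rowLen i + ind (singleRows n lam.rowLen eta.rowLen) i := by
  have h1 := rowLen_le_iff.1 hle i
  have h2 := hrow i
  simp only [ind, mem_singleRows]
  split_ifs with h3
  · exact h3.2
  · by_cases hi : i < n
    · omega
    · have := colLen_zero_le_iff.1 heta i (by omega)
      omega

theorem cells_sdiff_eq_boxesOf (heta : eta.colLen 0 ≤ n)
    (hrow : ∀ i, eta.rowLen i ≤ lam.rowLen i + 1) :
    eta.cells \ lam.cells = boxesOf lam.rowLen (singleRows n lam.rowLen eta.rowLen) := by
  ext ⟨a, b⟩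
  simp only [boxesOf, Finset.mem_sdiff, YoungDiagram.mem_cells, YoungDiagram.mem_iff_lt_rowLen,
    Finset.mem_image, mem_singleRows, Prod.mk.injEq]
  have h1 := hrow a
  have h2 := colLen_zero_le_iff.1 heta a
  constructor
  · intro h
    exact ⟨a, ⟨by omega, by omega⟩, rfl, by omega⟩
  · rintro ⟨i, h3, rfl, rfl⟩
    omega

theorem card_boxesOf (f : ℕ → ℕ) (A : Finset ℕ) : (boxesOf f A).card = A.card :=
  Finset.card_image_of_injective _ fun _ _ h => (Prod.ext_iff.1 h).1

end Boxes

/-! ### The two parts of a path -/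

section Path

/-- The partitions of a path, which is constant after its last step. -/
def YoungPath.nth {m : ℕ} (P : YoungPath m) (i : ℕ) : YoungDiagram := P.diag ⟨min i m, by omega⟩

theorem YoungPath.nth_eq {m : ℕ} (P : YoungPath m) (i : Fin (m + 1)) : P.nth i = P.diag i := by
  rw [YoungPath.nth]
  congr 1
  ext
  simp only
  omega

theorem YoungPath.isGrowth_nth {m : ℕ} (P : YoungPath m) {s t : ℕ} (h : s + t ≤ m) :
    IsGrowth (fun i => P.nth (s + i)) t := by
  constructor
  · intro i hi
    have := P.le_step ⟨s + i, by omega⟩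
    rwa [← P.nth_eq, ← P.nth_eq] at this
  · intro i hi
    have := P.card_step ⟨s + i, by omega⟩
    rwa [← P.nth_eq, ← P.nth_eq] at this

theorem YoungPath.ext_nth {m : ℕ} {P P' : YoungPath m} (h : ∀ i ≤ m, P.nth i = P'.nth i) :
    P = P' := by
  have h1 : P.diag = P'.diag := by
    funext i
    rw [← P.nth_eq, ← P'.nth_eq]
    exact h i (by omega)
  cases P
  cases P'
  simp only at h1
  subst h1
  rfl

variable {p q : ℕ} (P : YoungPath (p + q))

theorem YoungPath.label₁_eq (i : Fin p) :
    P.label₁ i = stepLabel (fun j => P.nth (0 + j)) i := by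
  simp only [YoungPath.label₁, YoungPath.label, stepLabel, ← P.nth_eq]
  simp

theorem YoungPath.label₂_eq (i : Fin q) :
    P.label₂ i = stepLabel (fun j => P.nth (p + j)) i := by
  simp only [YoungPath.label₂, YoungPath.label, stepLabel, ← P.nth_eq]
  simp [add_assoc]

theorem strictAnti_iff_isDecreasing {m : ℕ} {f : Fin m → ℤ} {d : ℕ → YoungDiagram}
    (h : ∀ i, f i = stepLabel d i) : StrictAnti f ↔ IsDecreasing d m := by
  constructor
  · intro h1 i j hij hj
    have h2 := @h1 ⟨i, by omega⟩ ⟨j, hj⟩ hij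
    rwa [h, h] at h2
  · intro h1 i j hij
    rw [h, h]
    exact h1 i j hij j.2

theorem image_eq_image_stepLabel {m : ℕ} {f : Fin m → ℤ} {d : ℕ → YoungDiagram}
    (h : ∀ i, f i = stepLabel d i) :
    Finset.univ.image f = (Finset.range m).image (stepLabel d) := by
  ext x
  simp only [Finset.mem_image, Finset.mem_univ, true_and, Finset.mem_range, h]
  exact ⟨fun ⟨i, hi⟩ => ⟨i, i.2, hi⟩, fun ⟨i, hi, h'⟩ => ⟨⟨i, hi⟩, h'⟩⟩

theorem YoungPath.first_eq : P.first = P.nth 0 := (P.nth_eq 0).symm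

theorem YoungPath.middle_eq : P.middle = P.nth p := (P.nth_eq ⟨p, by omega⟩).symm

theorem YoungPath.final_eq : P.final = P.nth (p + q) := (P.nth_eq (Fin.last _)).symm

theorem YoungPath.image_label₁ : Finset.univ.image P.label₁ = P.boxes₁.image content := by
  rw [image_eq_image_stepLabel P.label₁_eq, (P.isGrowth_nth (by omega)).image_stepLabel,
    YoungPath.boxes₁, P.middle_eq, P.first_eq]
  simp only [zero_add]

theorem YoungPath.image_label₂ : Finset.univ.image P.label₂ = P.boxes₂.image content := by
  rw [image_eq_image_stepLabel P.label₂_eq, (P.isGrowth_nth le_rfl).image_stepLabel,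
    YoungPath.boxes₂, P.middle_eq, P.final_eq]
  rfl

/-- The rows of the boxes of the first part of a path. -/
def YoungPath.rows₁ (n : ℕ) : Finset ℕ := singleRows n P.first.rowLen P.middle.rowLen

/-- The rows of the boxes of the second part of a path. -/
def YoungPath.rows₂ (n : ℕ) : Finset ℕ := singleRows n P.middle.rowLen P.final.rowLen

variable {n k : ℕ} {P}

theorem IsRestrictedPath.strips (h : IsRestrictedPath n k P) :
    (P.first ≤ P.middle ∧ ∀ i, P.middle.rowLen i ≤ P.first.rowLen i + 1) ∧
      P.middle ≤ P.final ∧ ∀ i, P.final.rowLen i ≤ P.middle.rowLen i + 1 := by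
  have h1 := P.isGrowth_nth (s := 0) (t := p) (by omega)
  have h2 := P.isGrowth_nth (s := p) (t := q) le_rfl
  have h3 := h1.rowLen_le ((strictAnti_iff_isDecreasing P.label₁_eq).1 h.1)
  have h4 := h2.rowLen_le ((strictAnti_iff_isDecreasing P.label₂_eq).1 h.2.1)
  have h5 := h1.monotone (Nat.zero_le p) le_rfl
  have h6 := h2.monotone (Nat.zero_le q) le_rfl
  simp only [zero_add, add_zero] at h3 h4 h5 h6
  rw [P.first_eq, P.middle_eq, P.final_eq]
  exact ⟨⟨h5, h3⟩, h6, h4⟩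

theorem IsRestrictedPath.isStripPair (h : IsRestrictedPath n k P) :
    IsStripPair n P.first.rowLen P.middle.rowLen P.final.rowLen (P.rows₁ n) (P.rows₂ n) where
  left_subset := Finset.filter_subset _ _
  right_subset := Finset.filter_subset _ _
  antitone_l := fun _ _ => YoungDiagram.rowLen_anti _ _ _
  antitone_e := fun _ _ => YoungDiagram.rowLen_anti _ _ _
  antitone_v := fun _ _ => YoungDiagram.rowLen_anti _ _ _
  e_eq := rowLen_eq_add_ind h.2.2.1.1 h.strips.1.1 h.strips.1.2
  v_eq := rowLen_eq_add_ind h.2.2.2.1 h.strips.2.1 h.strips.2.2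

theorem IsRestrictedPath.boxes₁_eq (h : IsRestrictedPath n k P) :
    P.boxes₁ = boxesOf P.first.rowLen (P.rows₁ n) :=
  cells_sdiff_eq_boxesOf h.2.2.1.1 h.strips.1.2

theorem IsRestrictedPath.boxes₂_eq (h : IsRestrictedPath n k P) :
    P.boxes₂ = boxesOf P.middle.rowLen (P.rows₂ n) :=
  cells_sdiff_eq_boxesOf h.2.2.2.1 h.strips.2.2

theorem IsRestrictedPath.isColumnStrict_iff (h : IsRestrictedPath n k P) (hqp : q ≤ p) :
    IsColumnStrict P ↔ ∀ i, 0 ≤ balance (P.rows₁ n) (P.rows₂ n) i := by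
  rw [← h.isStripPair.forall_card_le_iff, ← image_content_boxesOf, ← image_content_boxesOf,
    ← h.boxes₁_eq, ← h.boxes₂_eq, ← P.image_label₁, ← P.image_label₂,
    ← forall_rev_le_rev_iff h.1 h.2.1 hqp]
  exact ⟨fun h1 => h1.2.2.2, fun h1 => ⟨h.1, h.2.1, hqp, h1⟩⟩

theorem IsRestrictedPath.isExceptional_iff (h : IsRestrictedPath n k P) (hqp : q ≤ p) (hn : 0 < n)
    (hk : 0 < k) (hcs : IsColumnStrict P) :
    IsExceptional n k P ↔ Wraps n k P.first.rowLen P.final.rowLen ∧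
      (∃ i ∈ singleRows n P.first.rowLen P.final.rowLen,
        P.first.rowLen i = P.first.rowLen 0 ∧ i ∉ P.rows₁ n) ∧
      ∀ i < n, ¬ (i ∈ singleRows n P.first.rowLen P.final.rowLen ∧
        P.first.rowLen i = P.first.rowLen 0) → 0 < balance (P.rows₁ n) (P.rows₂ n) i := by
  rw [← h.isStripPair.exceptional_iff hn hk ((h.isColumnStrict_iff hqp).1 hcs), IsExceptional]
  simp only [hcs, true_and, YoungPath.Paired, P.image_label₁, P.image_label₂, lastColumn_union,
    Finset.coe_union, Set.image_union]
  rw [h.boxes₁_eq, h.boxes₂_eq]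
  simp only [image_content_boxesOf, hasBot_boxesOf, hasTop_boxesOf hn, image_lastColumn_boxesOf]
  refine and_congr_right fun _ => and_congr_right fun h1 => and_congr_right fun _ =>
    and_congr_right fun _ => exists_congr fun a₀ => exists_congr fun a₁ =>
    and_congr_right fun _ => and_congr_right fun _ => and_congr_right fun _ => ?_
  constructor
  · exact fun h2 => h2 (n - 1, P.first.rowLen (n - 1)) (Finset.mem_image_of_mem _ h1)
      (by simp only; omega)
  · intro h2 c hc hcn
    obtain ⟨i, hi, rfl⟩ := Finset.mem_image.1 hc
    simp only at hcn
    obtain rfl : i = n - 1 := by omega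
    exact h2

theorem IsRestrictedPath.isFusionRowSet_iff (h : IsRestrictedPath n k P) (hqp : q ≤ p)
    (hn : 0 < n) (hk : 0 < k) : IsColumnStrict P ∧ ¬ IsExceptional n k P ↔
      IsFusionRowSet n k P.first.rowLen P.final.rowLen (P.rows₁ n) := by
  rw [IsFusionRowSet]
  simp only [h.isStripPair.height_eq_balance]
  rw [← h.isColumnStrict_iff hqp]
  exact and_congr_right fun hcs => not_congr (h.isExceptional_iff hqp hn hk hcs)

theorem IsRestrictedPath.rows₁_mem_rowSets (h : IsRestrictedPath n k P) :
    P.rows₁ n ∈ rowSets n k P.first.rowLen P.final.rowLen p := by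
  have h1 := h.isStripPair
  rw [mem_rowSets]
  refine ⟨⟨h1.left_subset, fun i _ => ?_, fun i _ => ?_, ?_⟩, ?_⟩
  · rw [← h1.e_eq]
    exact ⟨rowLen_le_iff.1 h.strips.2.1 i, h.strips.2.2 i⟩
  · rw [← h1.e_eq, ← h1.e_eq]
    exact h1.antitone_e (Nat.le_succ i)
  · rw [← h1.e_eq, ← h1.e_eq]
    exact h.2.2.1.2
  · have h2 := (P.isGrowth_nth (s := 0) (t := p) (by omega)).card_eq le_rfl
    simp only [zero_add] at h2
    rw [← P.middle_eq, ← P.first_eq] at h2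
    have h3 := congrArg Finset.card h.boxes₁_eq
    have h4 : P.first.cells ⊆ P.middle.cells := h.strips.1.1
    rw [card_boxesOf, YoungPath.boxes₁, Finset.card_sdiff_of_subset h4] at h3
    simp only [YoungDiagram.card] at h2
    omega

/-- The row set determines the intermediate partition, and a decreasing path is determined by its
endpoints. -/
theorem IsRestrictedPath.eq_of_rows₁_eq {P' : YoungPath (p + q)} (h : IsRestrictedPath n k P)
    (h' : IsRestrictedPath n k P') (hfirst : P.first = P'.first) (hfinal : P.final = P'.final)
    (hrows : P.rows₁ n = P'.rows₁ n) : P = P' := by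
  have hmid : P.middle = P'.middle := by
    apply diagram_ext
    intro i
    rw [h.isStripPair.e_eq, h'.isStripPair.e_eq, hfirst, hrows]
  rw [P.first_eq, P'.first_eq] at hfirst
  rw [P.middle_eq, P'.middle_eq] at hmid
  rw [P.final_eq, P'.final_eq] at hfinal
  apply YoungPath.ext_nth
  intro i hi
  rcases Nat.le_total i p with hip | hip
  · have := (P.isGrowth_nth (s := 0) (t := p) (by omega)).eq_of_isDecreasing
      ((strictAnti_iff_isDecreasing P.label₁_eq).1 h.1)
      (P'.isGrowth_nth (s := 0) (t := p) (by omega))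
      ((strictAnti_iff_isDecreasing P'.label₁_eq).1 h'.1) hfirst (by simpa using hmid) hip
    simpa using this
  · have := (P.isGrowth_nth (s := p) (t := q) le_rfl).eq_of_isDecreasing
      ((strictAnti_iff_isDecreasing P.label₂_eq).1 h.2.1)
      (P'.isGrowth_nth (s := p) (t := q) le_rfl)
      ((strictAnti_iff_isDecreasing P'.label₂_eq).1 h'.2.1) hmid hfinal
      (show i - p ≤ q by omega)
    simpa [show p + (i - p) = i by omega] using this

end Path

/-! ### Counting paths -/

section Count

theorem IsDecreasing.congr {d d' : ℕ → YoungDiagram} {m : ℕ} (hd : IsDecreasing d m)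
    (h : ∀ i ≤ m, d i = d' i) : IsDecreasing d' m := by
  intro i j hij hj
  have h1 := hd i j hij hj
  simp only [stepLabel] at h1 ⊢
  rwa [← h i (by omega), ← h j (by omega), ← h (i + 1) (by omega), ← h (j + 1) (by omega)]

theorem exists_youngPath {lam eta nu : YoungDiagram} {p q : ℕ} (hle : lam ≤ eta)
    (hrow : ∀ i, eta.rowLen i ≤ lam.rowLen i + 1) (hle' : eta ≤ nu)
    (hrow' : ∀ i, nu.rowLen i ≤ eta.rowLen i + 1) (hp : (eta.cells \ lam.cells).card = p)
    (hq : (nu.cells \ eta.cells).card = q) :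
    ∃ P : YoungPath (p + q), P.first = lam ∧ P.middle = eta ∧ P.final = nu ∧
      StrictAnti P.label₁ ∧ StrictAnti P.label₂ := by
  have hg := isGrowth_stage hrow
  have hg' := isGrowth_stage hrow'
  have hd := isDecreasing_stage hrow
  have hd' := isDecreasing_stage hrow'
  have htop := stage_card hle hrow
  have htop' := stage_card hle' hrow'
  rw [hp] at hg hd htop
  rw [hq] at hg' hd' htop'
  set D : ℕ → YoungDiagram := fun i => if i ≤ p then stage lam eta i else stage eta nu (i - p)
    with hD
  have hD₁ : ∀ i ≤ p, stage lam eta i = D i := fun i hi => by simp only [hD, if_pos hi]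
  have hD₂ : ∀ i, stage eta nu i = D (p + i) := by
    intro i
    rcases Nat.eq_zero_or_pos i with rfl | hi
    · rw [stage_zero, add_zero, ← hD₁ p le_rfl, htop]
    · simp only [hD, if_neg (show ¬ p + i ≤ p by omega), Nat.add_sub_cancel_left]
  let P : YoungPath (p + q) :=
    { diag := fun i => D i
      le_step := by
        intro i
        simp only [Fin.val_castSucc, Fin.val_succ]
        rcases Nat.lt_or_ge (i : ℕ) p with hi | hi
        · rw [← hD₁ i hi.le, ← hD₁ _ hi]
          exact hg.le_succ i hi
        · obtain ⟨j, hj⟩ := Nat.exists_eq_add_of_le hi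
          rw [hj, add_assoc, ← hD₂, ← hD₂]
          exact hg'.le_succ j (by omega)
      card_step := by
        intro i
        simp only [Fin.val_castSucc, Fin.val_succ]
        rcases Nat.lt_or_ge (i : ℕ) p with hi | hi
        · rw [← hD₁ i hi.le, ← hD₁ _ hi]
          exact hg.card_succ i hi
        · obtain ⟨j, hj⟩ := Nat.exists_eq_add_of_le hi
          rw [hj, add_assoc, ← hD₂, ← hD₂]
          exact hg'.card_succ j (by omega) }
  have hnth : ∀ i ≤ p + q, P.nth i = D i := by
    intro i hi
    show D (min i (p + q)) = D i
    rw [min_eq_left hi]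
  refine ⟨P, ?_, ?_, ?_, ?_, ?_⟩
  · rw [P.first_eq, hnth 0 (by omega), ← hD₁ 0 (by omega), stage_zero]
  · rw [P.middle_eq, hnth p (by omega), ← hD₁ p le_rfl, htop]
  · rw [P.final_eq, hnth _ le_rfl, ← hD₂, htop']
  · refine (strictAnti_iff_isDecreasing P.label₁_eq).2 (hd.congr fun i hi => ?_)
    rw [zero_add, hnth i (by omega), hD₁ i hi]
  · refine (strictAnti_iff_isDecreasing P.label₂_eq).2 (hd'.congr fun i hi => ?_)
    rw [hnth _ (by omega), hD₂]

variable {n k : ℕ} {lam nu : YoungDiagram}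

theorem antitone_restrict {f : ℕ → ℕ} (h : ∀ i, i + 1 < n → f (i + 1) ≤ f i) :
    Antitone fun i : Fin n => f i := by
  have key : ∀ d i, i + d < n → f (i + d) ≤ f i := by
    intro d
    induction d with
    | zero => exact fun i _ => le_rfl
    | succ d ih => exact fun i hi => (h (i + d) hi).trans (ih i (by omega))
  intro i j hij
  have hij' : (i : ℕ) ≤ j := hij
  have := key (j - i) i (by omega)
  rwa [show (i : ℕ) + (j - i) = j by omega] at this

theorem IsRowSet.restr (hn : 0 < n) {l v : ℕ → ℕ} {A : Finset ℕ} (h : IsRowSet n k l v A) :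
    Restr k fun i : Fin n => l i + ind A i := by
  have h1 : Antitone fun i : Fin n => l i + ind A i :=
    antitone_restrict (f := fun i => l i + ind A i) h.2.2.1
  refine ⟨h1, fun i j => ?_⟩
  have h2 := @h1 ⟨0, hn⟩ i (Fin.mk_le_of_le_val (Nat.zero_le _))
  have h3 := @h1 j ⟨n - 1, by omega⟩ (Fin.mk_le_mk.2 (by omega))
  have h4 := h.2.2.2
  simp only at h2 h3 ⊢
  omega

theorem sum_ind {A : Finset ℕ} (hA : A ⊆ Finset.range n) : ∑ i : Fin n, ind A i = A.card := by
  rw [Finset.sum_fin_eq_sum_range, Finset.sum_congr rfl (g := fun i => if i ∈ A then 1 else 0)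
    fun i hi => by simp [ind, Finset.mem_range.1 hi]]
  rw [← Finset.sum_filter, Finset.filter_mem_eq_inter, Finset.inter_eq_right.2 hA]
  simp

theorem card_chains_eq_card_rowSets (hn : 0 < n) (hnu : IsRestricted n k nu) (s : ℕ) :
    (chains (VStrip k) (rows n lam) (rows n nu) s).card =
      (rowSets n k lam.rowLen nu.rowLen s).card := by
  symm
  have hnu' := ((isRestricted_iff hn).1 hnu).2
  refine Finset.card_bij (fun A _ => fun i : Fin n => lam.rowLen i + ind A i) ?_ ?_ ?_
  · intro A hA
    rw [mem_rowSets] at hA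
    have h1 := hA.1.restr hn
    simp only [chains, Finset.mem_filter, mem_vstrips]
    refine ⟨⟨⟨fun i => ?_, h1⟩, ?_⟩, fun i => hA.1.2.1 i i.2, hnu'⟩
    · simp only [rows, ind]
      split_ifs <;> omega
    · rw [Finset.sum_add_distrib, sum_ind hA.1.1, hA.2]
      rfl
  · intro A hA A' hA' he
    rw [mem_rowSets] at hA hA'
    ext i
    by_cases hi : i < n
    · have := congrFun he ⟨i, hi⟩
      simp only [ind] at this
      by_cases h1 : i ∈ A <;> by_cases h2 : i ∈ A' <;> simp [h1, h2] at this ⊢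
    · exact ⟨fun h => absurd (Finset.mem_range.1 (hA.1.1 h)) hi,
        fun h => absurd (Finset.mem_range.1 (hA'.1.1 h)) hi⟩
  · intro g hg
    simp only [chains, Finset.mem_filter, mem_vstrips] at hg
    obtain ⟨⟨⟨h1, h2⟩, h3⟩, h4, -⟩ := hg
    set A : Finset ℕ := (Finset.univ.filter fun i : Fin n => g i = rows n lam i + 1).image
      (fun i : Fin n => (i : ℕ)) with hA
    have hmem : ∀ i : Fin n, (i : ℕ) ∈ A ↔ g i = rows n lam i + 1 := by
      intro i
      rw [hA, Finset.mem_image]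
      constructor
      · rintro ⟨j, hj, hij⟩
        obtain rfl := Fin.ext hij
        exact (Finset.mem_filter.1 hj).2
      · exact fun h => ⟨i, Finset.mem_filter.2 ⟨Finset.mem_univ _, h⟩, rfl⟩
    have hg : ∀ i : Fin n, g i = lam.rowLen i + ind A i := by
      intro i
      have h5 := h1 i
      have h6 := hmem i
      simp only [rows] at h5 h6
      rw [ind]
      split_ifs with h7
      · exact h6.1 h7
      · have := mt h6.2 h7
        omega
    have hsub : A ⊆ Finset.range n := by
      intro i hi
      obtain ⟨j, -, rfl⟩ := Finset.mem_image.1 hi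
      exact Finset.mem_range.2 j.2
    refine ⟨A, ?_, funext fun i => (hg i).symm⟩
    rw [mem_rowSets]
    refine ⟨⟨hsub, fun i hi => ?_, fun i hi => ?_, ?_⟩, ?_⟩
    · have := h4 ⟨i, hi⟩
      rwa [hg] at this
    · have := @h2.1 ⟨i, by omega⟩ ⟨i + 1, hi⟩ (Fin.mk_le_mk.2 (Nat.le_succ i))
      rwa [hg, hg] at this
    · have := h2.2 ⟨0, hn⟩ ⟨n - 1, by omega⟩
      rwa [hg, hg] at this
    · rw [Finset.sum_congr rfl fun i _ => hg i, Finset.sum_add_distrib, sum_ind hsub] at h3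
      exact Nat.add_left_cancel h3

theorem IsRowSet.exists_path (hn : 0 < n) (hlam : lam.colLen 0 ≤ n) (hnu : IsRestricted n k nu)
    {p q : ℕ} (hcard : nu.card = lam.card + (p + q)) {A : Finset ℕ}
    (hA : IsRowSet n k lam.rowLen nu.rowLen A) (hAp : A.card = p) :
    ∃ P : YoungPath (p + q), P.first = lam ∧ P.final = nu ∧ IsRestrictedPath n k P ∧
      P.rows₁ n = A := by
  have hr := hA.restr hn
  set eta := toDiagram fun i : Fin n => lam.rowLen i + ind A i with heta
  have hres : IsRestricted n k eta := isRestricted_toDiagram hn hr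
  have hrl : ∀ i, eta.rowLen i = lam.rowLen i + ind A i := by
    intro i
    by_cases hi : i < n
    · exact rowLen_toDiagram hr.1 ⟨i, hi⟩
    · have h1 := colLen_zero_le_iff.1 hlam i (by omega)
      have h2 := colLen_zero_le_iff.1 hres.1 i (by omega)
      have h3 : i ∉ A := fun h => hi (Finset.mem_range.1 (hA.1 h))
      rw [h1, h2, ind, if_neg h3]
  have hstrip : ∀ i, eta.rowLen i ≤ nu.rowLen i ∧ nu.rowLen i ≤ eta.rowLen i + 1 := by
    intro i
    by_cases hi : i < n
    · rw [hrl]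
      exact hA.2.1 i hi
    · have h1 := colLen_zero_le_iff.1 hnu.1 i (by omega)
      have h2 := colLen_zero_le_iff.1 hres.1 i (by omega)
      omega
  have hle : lam ≤ eta := rowLen_le_iff.2 fun i => by rw [hrl]; omega
  have hle' : eta ≤ nu := rowLen_le_iff.2 fun i => (hstrip i).1
  have hrow : ∀ i, eta.rowLen i ≤ lam.rowLen i + 1 := by
    intro i
    rw [hrl, ind]
    split_ifs <;> omega
  have hrows : singleRows n lam.rowLen eta.rowLen = A := by
    ext i
    rw [mem_singleRows, hrl, ind]
    constructor
    · rintro ⟨-, h⟩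
      by_contra hne
      simp [hne] at h
    · exact fun h => ⟨Finset.mem_range.1 (hA.1 h), by rw [if_pos h]⟩
  have hp : (eta.cells \ lam.cells).card = p := by
    rw [cells_sdiff_eq_boxesOf hres.1 hrow, card_boxesOf, hrows, hAp]
  have hq : (nu.cells \ eta.cells).card = q := by
    have h1 := Finset.card_sdiff_of_subset (show lam.cells ⊆ eta.cells from hle)
    have h2 := Finset.card_sdiff_of_subset (show eta.cells ⊆ nu.cells from hle')
    have h3 := Finset.card_le_card (show lam.cells ⊆ eta.cells from hle)
    simp only [YoungDiagram.card] at hcard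
    omega
  obtain ⟨P, h1, h2, h3, h4, h5⟩ := exists_youngPath hle hrow hle' (fun i => (hstrip i).2) hp hq
  refine ⟨P, h1, h3, ⟨h4, h5, h2 ▸ hres, h3 ▸ hnu⟩, ?_⟩
  rw [YoungPath.rows₁, h1, h2, hrows]

/-- The rows of the first part give a bijection from the paths onto a subset of a finite collection
of row sets. -/
theorem fusionPaths_finite_and_ncard (hn : 0 < n) (hk : 0 < k) {mu : YoungDiagram}
    (hlam : lam.colLen 0 ≤ n) (hnu : IsRestricted n k nu)
    (hcard : nu.card = lam.card + (mu.colLen 0 + mu.colLen 1)) :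
    (fusionPaths n k lam mu nu).Finite ∧
      (fusionPaths n k lam mu nu).ncard =
        {A | A ∈ rowSets n k lam.rowLen nu.rowLen (mu.colLen 0) ∧
          IsFusionRowSet n k lam.rowLen nu.rowLen A}.ncard := by
  have hqp : mu.colLen 1 ≤ mu.colLen 0 := mu.colLen_anti 0 1 (Nat.zero_le 1)
  have hinj : Set.InjOn (fun P : YoungPath (mu.colLen 0 + mu.colLen 1) => P.rows₁ n)
      (fusionPaths n k lam mu nu) := by
    rintro P ⟨h1, h2, h3, -⟩ P' ⟨h1', h2', h3', -⟩ he
    exact h3.eq_of_rows₁_eq h3' (h1.trans h1'.symm) (h2.trans h2'.symm) he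
  have himage : (fun P : YoungPath (mu.colLen 0 + mu.colLen 1) => P.rows₁ n) ''
      (fusionPaths n k lam mu nu) =
        {A | A ∈ rowSets n k lam.rowLen nu.rowLen (mu.colLen 0) ∧
          IsFusionRowSet n k lam.rowLen nu.rowLen A} := by
    ext A
    constructor
    · rintro ⟨P, ⟨h1, h2, h3, h4⟩, rfl⟩
      have h5 := (h3.isFusionRowSet_iff hqp hn hk).1 h4
      have h6 := h3.rows₁_mem_rowSets
      rw [h1, h2] at h5 h6
      exact ⟨h6, h5⟩
    · rintro ⟨h1, h2⟩
      rw [mem_rowSets] at h1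
      obtain ⟨P, h3, h4, h5, rfl⟩ := h1.1.exists_path hn hlam hnu hcard h1.2
      rw [← h3, ← h4] at h2
      exact ⟨P, ⟨h3, h4, h5, (h5.isFusionRowSet_iff hqp hn hk).2 h2⟩, rfl⟩
  refine ⟨Set.Finite.of_finite_image ?_ hinj, ?_⟩
  · rw [himage]
    exact (rowSets n k lam.rowLen nu.rowLen (mu.colLen 0)).finite_toSet.subset fun A hA => hA.1
  · rw [← hinj.ncard_image, himage]

theorem fusionPaths_eq_empty {mu : YoungDiagram}
    (hcard : nu.card ≠ lam.card + (mu.colLen 0 + mu.colLen 1)) :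
    fusionPaths n k lam mu nu = ∅ := by
  rw [Set.eq_empty_iff_forall_notMem]
  rintro P ⟨rfl, rfl, -⟩
  have h1 := (P.isGrowth_nth (s := 0) (zero_add _).le).card_eq le_rfl
  simp only [zero_add] at h1
  rw [← P.final_eq, ← P.first_eq] at h1
  exact hcard h1

/-- The number of fusion paths as a difference of numbers of chains of vertical strips. -/
theorem ncard_fusionPaths (hn : 0 < n) (hk : 0 < k) {mu : YoungDiagram}
    (hlam : IsRestricted n k lam) (hnu : IsRestricted n k nu)
    (hcard : nu.card = lam.card + (mu.colLen 0 + mu.colLen 1)) :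
    ((fusionPaths n k lam mu nu).ncard : ℤ) =
      (chains (VStrip k) (rows n lam) (rows n nu) (mu.colLen 0)).card -
        (chains (VStrip k) (rows n lam) (rows n nu) (mu.colLen 0 + 1)).card := by
  classical
  rw [card_chains_eq_card_rowSets hn hnu, card_chains_eq_card_rowSets hn hnu,
    card_rowSets_sub (q := mu.colLen 1) hn hk (fun _ _ => lam.rowLen_anti _ _)
      (fun _ _ => nu.rowLen_anti _ _) hlam.2 hnu.2 ?_ (mu.colLen_anti 0 1 (Nat.zero_le 1)),
    (fusionPaths_finite_and_ncard hn hk hlam.1 hnu hcard).2, ← Set.ncard_coe_finset]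
  · congr 2
    ext A
    simp
  · rw [card_eq_sum_rows hlam.1, card_eq_sum_rows hnu.1] at hcard
    rw [Finset.sum_range, Finset.sum_range]
    exact hcard

end Count

/-! ### Partitions with at most two rows and their duals -/

section TwoRows

theorem rows_eq_twoRow {m : ℕ} {mu : YoungDiagram} (h : mu.colLen 0 ≤ 2) :
    rows (m + 1) mu = twoRow m (mu.rowLen 0) (mu.rowLen 1) := by
  funext i
  rw [colLen_zero_le_iff] at h
  simp only [rows, twoRow]
  split_ifs with h0 h1
  · rw [h0]
  · rw [h1]
  · exact h i (by omega)

variable {m a b : ℕ} {mu : YoungDiagram}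

theorem rowLen_of_rows_eq_twoCol (hmu : mu.colLen 0 ≤ m + 1) (ha : a ≤ m + 1) (hb : b ≤ m + 1)
    (h : rows (m + 1) mu = twoCol m a b) (i : ℕ) :
    mu.rowLen i = (if i < a then 1 else 0) + if i < b then 1 else 0 := by
  by_cases hi : i < m + 1
  · exact congrFun h ⟨i, hi⟩
  · rw [colLen_zero_le_iff.1 hmu i (by omega), if_neg (by omega), if_neg (by omega)]

theorem colLen_of_rows_eq_twoCol (hba : b ≤ a) (hmu : mu.colLen 0 ≤ m + 1) (ha : a ≤ m + 1)
    (h : rows (m + 1) mu = twoCol m a b) : mu.colLen 0 = a ∧ mu.colLen 1 = b := by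
  have hrow := rowLen_of_rows_eq_twoCol hmu ha (hba.trans ha) h
  constructor <;>
  · apply eq_of_forall_lt_iff
    intro i
    rw [← YoungDiagram.mem_iff_lt_colLen, YoungDiagram.mem_iff_lt_rowLen, hrow]
    split_ifs <;> omega

end TwoRows

theorem isRestricted_dual {n k : ℕ} (hk : 0 < k) {lam : YoungDiagram} (h : lam.colLen 0 ≤ n) :
    IsRestricted k n (dual k lam) := by
  rw [isRestricted_iff hk, rows_dual hk h]
  exact ⟨colLen_dual_le k lam, restr_dualFn hk _⟩

theorem card_dual {n k : ℕ} (hk : 0 < k) {lam : YoungDiagram} (h : lam.colLen 0 ≤ n) :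
    (dual k lam).card = lam.card := by
  rw [card_eq_sum_rows (colLen_dual_le k lam), rows_dual hk h, sum_dualFn hk, card_eq_sum_rows h]


end Fusion

/-! ### The theorem: duality of chains combined with the path count -/

open Fusion in
theorem theorem16 (n k : ℕ) (hn : 3 ≤ n) (hk : 1 ≤ k) (lam mu nu : YoungDiagram)
    (hlam : IsRestricted n k lam) (hmu : IsRestricted n k mu) (hnu : IsRestricted n k nu)
    (hrows : mu.colLen 0 ≤ 2) :
    (∃! N, IsFusionExpansion n k lam mu N) ∧
    (∃! N, IsFusionExpansion k n (dual k lam) (dual k mu) N) ∧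
    (dual k mu).rowLen 0 ≤ 2 ∧
    fusionCoeff n k lam mu nu = fusionCoeff k n (dual k lam) (dual k mu) (dual k nu) ∧
    (fusionPaths k n (dual k lam) (dual k mu) (dual k nu)).Finite ∧
    fusionCoeff n k lam mu nu =
      ((fusionPaths k n (dual k lam) (dual k mu) (dual k nu)).ncard : ℚ) := by
  obtain ⟨m, rfl⟩ : ∃ m, n = m + 1 := ⟨n - 1, by omega⟩
  obtain ⟨k, rfl⟩ : ∃ k', k = k' + 1 := ⟨k - 1, by omega⟩
  have hba : mu.rowLen 1 ≤ mu.rowLen 0 := mu.rowLen_anti 0 1 (Nat.zero_le 1)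
  -- Here n ≥ 3 enters: with at most two rows the n-th part of μ is zero, so μ_1 is bounded by the
  -- level.
  have ha : mu.rowLen 0 ≤ k + 1 := by
    have h1 := hmu.2
    rw [colLen_zero_le_iff.1 hrows (m + 1 - 1) (by omega)] at h1
    omega
  have hmu' : rows (m + 1) mu = twoRow m (mu.rowLen 0) (mu.rowLen 1) := rows_eq_twoRow hrows
  have hdual : rows (k + 1) (dual (k + 1) mu) = twoCol k (mu.rowLen 0) (mu.rowLen 1) := by
    rw [rows_dual (Nat.add_one_pos k) hmu.1, hmu', dualFn_twoRow (by omega) ha (hba.trans ha)]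
  have hcol := colLen_of_rows_eq_twoCol hba (colLen_dual_le _ mu) ha hdual
  obtain ⟨hexp, hcoeff⟩ := fusionCoeff_twoRow (by omega) hba ha hlam hmu.1 hmu'
  obtain ⟨hexp', hcoeff'⟩ := fusionCoeff_twoCol (k := m + 1) (by omega) hba ha
    (isRestricted_dual (Nat.add_one_pos k) hlam.1) (colLen_dual_le _ mu) hdual
  have h2 := hcoeff nu hnu.1
  have h4 := hcoeff' (dual (k + 1) nu) (colLen_dual_le _ nu)
  have hrl := ((isRestricted_iff (Nat.add_one_pos m)).1 hlam).2
  have hrn := ((isRestricted_iff (Nat.add_one_pos m)).1 hnu).2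
  have hcard : mu.card = mu.rowLen 0 + mu.rowLen 1 := by
    rw [card_eq_sum_rows hmu.1, hmu', sum_twoRow (by omega)]
  have heq : fusionCoeff (m + 1) (k + 1) lam mu nu =
      fusionCoeff (k + 1) (m + 1) (dual (k + 1) lam) (dual (k + 1) mu) (dual (k + 1) nu) := by
    rw [h2, h4, card_dual (Nat.add_one_pos k) hlam.1, card_dual (Nat.add_one_pos k) hmu.1,
      card_dual (Nat.add_one_pos k) hnu.1, rows_dual (Nat.add_one_pos k) hlam.1,
      rows_dual (Nat.add_one_pos k) hnu.1, card_chains_dualFn (Nat.add_one_pos m) (Nat.add_one_pos k) hrl hrn,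
      card_chains_dualFn (Nat.add_one_pos m) (Nat.add_one_pos k) hrl hrn]
  refine ⟨hexp, hexp', ?_, heq, ?_⟩
  · rw [rowLen_of_rows_eq_twoCol (colLen_dual_le _ mu) ha (hba.trans ha) hdual]
    split_ifs <;> omega
  · rw [heq]
    -- If the sizes do not match, the coefficient is zero and there is no path, since the length of
    -- a path prescribes the growth in size.
    by_cases hsize : (dual (k + 1) nu).card = (dual (k + 1) lam).card + (dual (k + 1) mu).card
    · have hsize' : (dual (k + 1) nu).card = (dual (k + 1) lam).card +
          ((dual (k + 1) mu).colLen 0 + (dual (k + 1) mu).colLen 1) := by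
        rw [hsize, hcol.1, hcol.2, card_dual (Nat.add_one_pos k) hmu.1, hcard]
      have hlam' := isRestricted_dual (Nat.add_one_pos k) hlam.1
      have hnu' := isRestricted_dual (Nat.add_one_pos k) hnu.1
      refine ⟨(fusionPaths_finite_and_ncard (Nat.add_one_pos k) (Nat.add_one_pos m) hlam'.1 hnu'
        hsize').1, ?_⟩
      have h5 := ncard_fusionPaths (Nat.add_one_pos k) (Nat.add_one_pos m) hlam' hnu' hsize'
      rw [h4, if_pos hsize, ← hcol.1]
      exact_mod_cast h5.symm
    · have hempty : fusionPaths (k + 1) (m + 1) (dual (k + 1) lam) (dual (k + 1) mu)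
          (dual (k + 1) nu) = ∅ := by
        apply fusionPaths_eq_empty
        rwa [hcol.1, hcol.2, ← hcard, ← card_dual (Nat.add_one_pos k) hmu.1]
      rw [hempty, h4, if_neg hsize]
      simp
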